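/- **Setting.** There are finitely many players $i=1,\dots,n$; player $i$ has finite nonempty state and action sets $S_i,A_i$, transition probabilities $P_i(s_i'\mid s_i,a_i)$, and a reward function $r_i(s,a)\in[0,1]$ of the joint state $s=(s_1,\dots,s_n)$ and joint action $a=(a_1,\dots,a_n)$. The game starts in a given joint state $s^0$, and given the joint state and action at time $t$ the states $s_i^{t+1}$ are drawn independently from $P_i(\cdot\mid s_i^t,a_i^t)$. A stationary policy of player $i$ is a map $\pi_i$ from $S_i$ to distributions on $A_i$; players randomize independently. The payoff of player $i$ is $V_i(\pi)=\mathbb E\big[\lim_{T\to\infty}\frac1T\sum_{t=0}^{T}r_i(s^t,a^t)\big]$, and a profile $\pi^*$ of stationary policies is a stationary $\epsilon$-Nash equilibrium if $V_i(\pi^*)\ge V_i(\pi_i,\pi^*_{-i})-\epsilon$ for all $i$ and all stationary policies $\pi_i$. Let $\tau>0$ and assume that for every player $i$ and every stationary policy $\pi_i$ the induced chain $P^{\pi_i}(s_i'\mid s_i)=\sum_{a_i}P_i(s_i'\mid s_i,a_i)\pi_i(a_i\mid s_i)$ is ergodic (irreducible and aperiodic) and $\|(v-v')P^{\pi_i}\|_1\le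 e^{-1/\tau}\|v-v'\|_1$ for all distributions $v,v'$ on $S_i$. Let $\mathcal P_i$ be the polytope of $\rho_i\in\mathbb R_{\ge0}^{S_i\times A_i}$ with $\sum_{s_i,a_i}\rho_i(s_i,a_i)=1$ and $\sum_{s_i,a_i}P_i(s_i'\mid s_i,a_i)\rho_i(s_i,a_i)=\sum_{a_i}\rho_i(s_i',a_i)$ for all $s_i'$, and for $\delta_i>0$ let $\mathcal P_i^{\delta_i}=\{\rho_i\in\mathcal P_i:\rho_i\ge\delta_i\mathbf 1\}$. The policy induced by $\rho_i$ is $\pi_i(a_i\mid s_i)=\rho_i(s_i,a_i)/\sum_{a_i'}\rho_i(s_i,a_i')$. **Algorithm.** Inputs: an integer $d\ge0$, and for each player $i$ a number $\delta_i>0$, an initial $\rho_i^1\in\mathcal P_i^{\delta_i}$, a strongly convex regularizer $h_i$ on $\mathcal P_i^{\delta_i}$, and step sizes $\eta_i^k>0$, $k\ge1$. Put $Y_i^1=0$ and $\tau^1=0$. In batch $k=1,2,\dots$, which begins at the end $\tau^k$ of the previous batch, every player $i$ plays the stationary policy $\pi_i^k$ induced by $\rho_i^k$ (the action at time $\tau^k$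 itself, for $k\ge2$, still belongs to batch $k-1$). From time $\tau^k+d$ on, whenever player $i$ visits a state $s_i$ for the first time, at a time $t$ say, it adds $r_i(s^t,a^t)/\pi_i^k(a_i^t\mid s_i)$ to the $(s_i,a_i^t)$-th coordinate of a vector $R_i^k$ that is initially zero. The batch ends at the first time $\tau^{k+1}$ at which every player has in this way sampled all its states. Then $Y_i^{k+1}=Y_i^k+\eta_i^kR_i^k$ and $\rho_i^{k+1}=\operatorname{argmax}_{\rho_i\in\mathcal P_i^{\delta_i}}\{\langle\rho_i,Y_i^{k+1}\rangle-h_i(\rho_i)\}$, where the maximizers in the update are assumed to exist. **Theorem.** There are thresholds $\bar\delta_i>0$, depending for each player $i$ only on its own transition probabilities $P_i$ and on $\epsilon>0$, such that the following holds whenever $0<\delta_i\le\bar\delta_i$ for all $i$. Let $d\ge\tau\ln\big(\frac3\epsilon\max_i|A_i||S_i|\big)$, and let every player follow the algorithm with step sizes such that $\sum_{k=1}^\infty\eta_i^k=\infty$ and $\sum_{k=1}^\infty\big(\eta_i^k/w_i^k\big)^2<\infty$, where $w_i^k=\sum_{\ell=1}^k\eta_i^\ell$. If with positive probability the sequence $\rho^k=(\rho_1^k,\dots,\rho_n^k)$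 converges to some point $\rho^*$, then the stationary policy profile induced by $\rho^*$ is a stationary $\epsilon$-Nash equilibrium of the stochastic game. More generally, almost surely, whenever $\rho^k$ converges, the policy profile induced by its (possibly random) limit is a stationary $\epsilon$-Nash equilibrium. -/

import Mathlib

open MeasureTheory ProbabilityTheory Filter Topology

noncomputable section

/-- Transition probabilities of one player: `p s a s'` is the probability of moving from
`s` to `s'` under action `a`. -/
abbrev TransitionModel (X Y : Type*) [Fintype X] : Type _ := X → Y → stdSimplex ℝ X

/-- A stationary policy of one player: `π s a` is the probability of playing `a` in state `s`. -/
abbrev StationaryPolicy (X Y : Type*) [Fintype Y] : Type _ := X → stdSimplex ℝ Y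

/-- A payoff-coupled stochastic game with independent chains: player `i` has its own states `S i`,
actions `A i` and transition probabilities; the rewards lie in `[0, 1]` and depend on the joint
state and the joint action. -/
structure StochasticGame {ι : Type*} (S A : ι → Type*) [∀ i, Fintype (S i)] where
  P : ∀ i, TransitionModel (S i) (A i)
  r : ι → (∀ i, S i) → (∀ i, A i) → ℝ
  r_mem : ∀ i s a, r i s a ∈ Set.Icc (0 : ℝ) 1

/-- A joint state together with a joint action: what happens in one time instance. -/
def JointStep {ι : Type*} (S A : ι → Type*) : Type _ := (∀ i, S i) × (∀ i, A i)

section SinglePlayer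

variable {X Y : Type*} [Fintype X] [DecidableEq X] [Fintype Y]

/-- The transition matrix of the chain that a stationary policy induces on the states. -/
def inducedChain (p : TransitionModel X Y) (π : StationaryPolicy X Y) : Matrix X X ℝ :=
  Matrix.of fun s s' => ∑ a, p s a s' * π s a

/-- Under every stationary policy the induced chain is ergodic (irreducible and aperiodic, i.e. its
transition matrix is primitive) and contracts the `ℓ¹`-distance between distributions by the
factor `exp (-1 / τ)` in each step. -/
def UniformlyErgodic (p : TransitionModel X Y) (τ : ℝ) : Prop :=
  ∀ π : StationaryPolicy X Y, (inducedChain p π).IsPrimitive ∧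
    ∀ v v' : stdSimplex ℝ X,
      ∑ s', |∑ s, (v s - v' s) * inducedChain p π s s'| ≤ Real.exp (-1 / τ) * ∑ s, |v s - v' s|

/-- The polytope of feasible occupation measures. -/
def occupationPolytope (p : TransitionModel X Y) : Set (X × Y → ℝ) :=
  {ρ | (∀ z, 0 ≤ ρ z) ∧
    (∀ s', ∑ z : X × Y, (p z.1 z.2 s' - if z.1 = s' then 1 else 0) * ρ z = 0) ∧
    ∑ z, ρ z = 1}

/-- The shrunk occupation polytope: all coordinates are at least `δ`. -/
def shrunkPolytope (p : TransitionModel X Y) (δ : ℝ) : Set (X × Y → ℝ) :=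
  {ρ | ρ ∈ occupationPolytope p ∧ ∀ z, δ ≤ ρ z}

open Classical in
/-- The stationary policy `π(a|s) = ρ(s,a) / ∑ₐ' ρ(s,a')` of an occupation measure (an arbitrary
distribution on the actions in the case that this formula does not give a distribution). -/
def inducedPolicy [Nonempty Y] (ρ : X × Y → ℝ) : StationaryPolicy X Y := fun s =>
  if h : (fun a => ρ (s, a) / ∑ a', ρ (s, a')) ∈ stdSimplex ℝ Y then ⟨_, h⟩
  else ⟨Pi.single (Classical.arbitrary Y) 1, single_mem_stdSimplex ℝ _⟩

/-- The objective `⟨ρ, y⟩ - h ρ` of the dual averaging update. -/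
def dualObjective (h : (X × Y → ℝ) → ℝ) (y ρ : X × Y → ℝ) : ℝ := ∑ z, ρ z * y z - h ρ

open Classical in
/-- The dual averaging update: the maximizer of `⟨ρ, y⟩ - h ρ` over `K`
(a junk value if there is none). -/
def dualArgmax (K : Set (X × Y → ℝ)) (h : (X × Y → ℝ) → ℝ) (y : X × Y → ℝ) : X × Y → ℝ :=
  if hex : ∃ ρ ∈ K, IsMaxOn (dualObjective h y) K ρ then hex.choose else 0

end SinglePlayer

variable {ι : Type*} [Fintype ι] [DecidableEq ι] {S A : ι → Type*}
  [∀ i, Fintype (S i)] [∀ i, DecidableEq (S i)] [∀ i, Nonempty (S i)]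
  [∀ i, Fintype (A i)] [∀ i, DecidableEq (A i)] [∀ i, Nonempty (A i)]

instance : Fintype (JointStep S A) := inferInstanceAs (Fintype ((∀ i, S i) × (∀ i, A i)))
instance : MeasurableSpace (JointStep S A) := ⊤
instance : DiscreteMeasurableSpace (JointStep S A) := ⟨fun _ => trivial⟩

/-! ### The law of the play -/

/-- Probability that independent draws, one from each `q i`, give the vector `x`. -/
def jointProb {X : ι → Type*} [∀ i, Fintype (X i)] (q : ∀ i, stdSimplex ℝ (X i)) (x : ∀ i, X i) :
    ℝ :=
  ∏ i, q i (x i)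

/-- The law of a joint step whose state is drawn from `q` (independently over the players) and
whose action is then drawn from the stationary policies `π`. -/
def stepLaw (q : ∀ i, stdSimplex ℝ (S i)) (π : ∀ i, StationaryPolicy (S i) (A i)) :
    Measure (JointStep S A) :=
  ∑ z : JointStep S A,
    ENNReal.ofReal (jointProb q z.1 * jointProb (fun i => π i (z.1 i)) z.2) • Measure.dirac z

theorem sum_jointProb {X : ι → Type*} [∀ i, Fintype (X i)] (q : ∀ i, stdSimplex ℝ (X i)) :
    ∑ x, jointProb q x = 1 := by
  have h := Finset.prod_univ_sum (fun i => (Finset.univ : Finset (X i))) (fun i x => q i x)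
  have h1 : ∀ i, ∑ x, q i x = 1 := fun i => (q i).2.2
  simp only [h1, Finset.prod_const_one, Fintype.piFinset_univ] at h
  exact h.symm

instance (q : ∀ i, stdSimplex ℝ (S i)) (π : ∀ i, StationaryPolicy (S i) (A i)) :
    IsProbabilityMeasure (stepLaw q π) := by
  constructor
  have h : ∑ z : JointStep S A, jointProb q z.1 * jointProb (fun i => π i (z.1 i)) z.2 = 1 := by
    have h' := Fintype.sum_prod_type
      (fun z : (∀ i, S i) × (∀ i, A i) => jointProb q z.1 * jointProb (fun i => π i (z.1 i)) z.2)
    refine h'.trans ?_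
    simp [← Finset.mul_sum, sum_jointProb]
  simp only [stepLaw, Measure.finsetSum_apply, Measure.smul_apply, measure_univ, smul_eq_mul,
    mul_one]
  rw [← ENNReal.ofReal_sum_of_nonneg, h, ENNReal.ofReal_one]
  exact fun z _ => mul_nonneg (Finset.prod_nonneg fun i _ => (q i).2.1 _)
    (Finset.prod_nonneg fun i _ => (π i (z.1 i)).2.1 _)

/-- A finite history, continued in an arbitrary way to an infinite play. -/
def extendHistory {t : ℕ} (h : Finset.Iic t → JointStep S A) : ℕ → JointStep S A := fun u =>
  if hu : u ∈ Finset.Iic t then h ⟨u, hu⟩ else h ⟨t, Finset.mem_Iic.2 le_rfl⟩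

/-- The transition kernel of the play from the history up to time `t` to the step of time `t + 1`:
the states `sᵢᵗ⁺¹` are drawn independently from `P i (sᵢᵗ) (aᵢᵗ)`, and then the actions `aᵢᵗ⁺¹`
independently from the stationary policies that the rule `σ (t + 1)` derives from the history. -/
def stepKernel (G : StochasticGame S A)
    (σ : ℕ → (ℕ → JointStep S A) → ∀ i, StationaryPolicy (S i) (A i)) (t : ℕ) :
    Kernel (Finset.Iic t → JointStep S A) (JointStep S A) where
  toFun h := stepLaw (fun i => G.P i ((extendHistory h t).1 i) ((extendHistory h t).2 i))
    (σ (t + 1) (extendHistory h))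
  measurable' := measurable_of_countable _

instance (G : StochasticGame S A)
    (σ : ℕ → (ℕ → JointStep S A) → ∀ i, StationaryPolicy (S i) (A i)) (t : ℕ) :
    IsMarkovKernel (stepKernel G σ t) :=
  ⟨fun _ => inferInstanceAs (IsProbabilityMeasure (stepLaw _ _))⟩

/-- The law of the play `(s⁰, a⁰), (s¹, a¹), …` started in `s⁰ = s₀`. The rule `σ t ω` names the
stationary policies used at time `t`; it is only ever evaluated on (an extension of) the history
`ω 0, …, ω (t - 1)`. -/
def playLaw (G : StochasticGame S A) (s₀ : ∀ i, S i)
    (σ : ℕ → (ℕ → JointStep S A) → ∀ i, StationaryPolicy (S i) (A i)) :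
    Measure (ℕ → JointStep S A) :=
  Kernel.trajMeasure (X := fun _ => JointStep S A)
    (stepLaw (fun i => ⟨Pi.single (s₀ i) 1, single_mem_stdSimplex ℝ _⟩)
      (σ 0 fun _ => (s₀, fun _ => Classical.arbitrary _)))
    (stepKernel G σ)

/-! ### The stochastic game and its equilibria -/

/-- The payoff `E[lim_T (1/T) ∑_{t ≤ T} rᵢ(sᵗ, aᵗ)]` of player `i` under the stationary policies `π`
(the upper limit equals the limit wherever the latter exists, in particular almost surely in
ergodic games). -/
def payoff (G : StochasticGame S A) (s₀ : ∀ i, S i) (i : ι)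
    (π : ∀ i, StationaryPolicy (S i) (A i)) : ℝ :=
  ∫ ω, limsup (fun T : ℕ => 1 / (T : ℝ) * ∑ t ∈ Finset.range (T + 1), G.r i (ω t).1 (ω t).2) atTop
    ∂(playLaw G s₀ fun _ _ => π)

/-- A stationary `ε`-Nash equilibrium of the game with initial state `s₀`. -/
def IsStationaryNE (G : StochasticGame S A) (s₀ : ∀ i, S i) (ε : ℝ)
    (π : ∀ i, StationaryPolicy (S i) (A i)) : Prop :=
  ∀ i (π' : StationaryPolicy (S i) (A i)),
    payoff G s₀ i (Function.update π i π') - ε ≤ payoff G s₀ i π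

/-! ### The dual averaging algorithm -/

/-- The inputs of the algorithm: the threshold `d`, the shrinking parameters `δ`, the regularizers
`h`, the step sizes (`η i k` is used at the end of batch `k`, the batches being numbered from `0`)
and the initial occupation measures `ρ₀`. -/
structure AlgInput (S A : ι → Type*) where
  d : ℕ
  δ : ι → ℝ
  h : ∀ i, (S i × A i → ℝ) → ℝ
  η : ι → ℕ → ℝ
  ρ₀ : ∀ i, S i × A i → ℝ

/-- The variables of the algorithm at a time `t` in batch `k`, before the step of time `t`:
`elapsed` is the number of time instances since the end of the previous batch, `ρ i` and `Y i` are
the occupation measure and the dual score of player `i`, `R i` is the part collected so far of the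
reward vector, and `unvisited i` is the set of states of player `i` still to be sampled. -/
structure AlgState (S A : ι → Type*) where
  batch : ℕ
  elapsed : ℕ
  ρ : ∀ i, S i × A i → ℝ
  Y : ∀ i, S i × A i → ℝ
  R : ∀ i, S i × A i → ℝ
  unvisited : ∀ i, Finset (S i)

/-- The initial values: batch `0` starts at time `0`. -/
def AlgState.init (I : AlgInput S A) : AlgState S A where
  batch := 0
  elapsed := 0
  ρ := I.ρ₀
  Y := 0
  R := 0
  unvisited := fun _ => Finset.univ

/-- The stationary policies in use, obtained from the current occupation measures. -/
def AlgState.policy (x : AlgState S A) : ∀ i, StationaryPolicy (S i) (A i) :=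
  fun i => inducedPolicy (x.ρ i)

/-- The reward vectors after the joint step `z`. Sampling starts when `d` time instances have
elapsed; then `rᵢ(s, a) / πᵢ(aᵢ|sᵢ)` is added at the coordinate `(sᵢ, aᵢ)` if `sᵢ` is visited for
the first time. -/
def AlgState.sampledR (G : StochasticGame S A) (I : AlgInput S A) (x : AlgState S A)
    (z : JointStep S A) : ∀ i, S i × A i → ℝ := fun i =>
  if I.d ≤ x.elapsed ∧ z.1 i ∈ x.unvisited i then
    x.R i + Pi.single (z.1 i, z.2 i) (G.r i z.1 z.2 / x.policy i (z.1 i) (z.2 i))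
  else x.R i

/-- The states still to be sampled after the joint step `z`. -/
def AlgState.stillUnvisited (I : AlgInput S A) (x : AlgState S A) (z : JointStep S A) :
    ∀ i, Finset (S i) := fun i =>
  if I.d ≤ x.elapsed then (x.unvisited i).erase (z.1 i) else x.unvisited i

/-- One time instance of the algorithm. If all players have sampled all their states, then the
batch ends with the dual averaging update; the next time instance is the first one after its
end. -/
def AlgState.next (G : StochasticGame S A) (I : AlgInput S A) (x : AlgState S A)
    (z : JointStep S A) : AlgState S A :=
  if ∀ i, x.stillUnvisited I z i = ∅ then
    let Y' : ∀ i, S i × A i → ℝ := fun i => x.Y i + I.η i x.batch • x.sampledR G I z i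
    { batch := x.batch + 1
      elapsed := 1
      ρ := fun i => dualArgmax (shrunkPolytope (G.P i) (I.δ i)) (I.h i) (Y' i)
      Y := Y'
      R := 0
      unvisited := fun _ => Finset.univ }
  else
    { x with
      elapsed := x.elapsed + 1
      R := x.sampledR G I z
      unvisited := x.stillUnvisited I z }

/-- The variables of the algorithm at time `t`, as a function of the steps before time `t`. -/
def algState (G : StochasticGame S A) (I : AlgInput S A) (ω : ℕ → JointStep S A) :
    ℕ → AlgState S A
  | 0 => AlgState.init I
  | t + 1 => (algState G I ω t).next G I (ω t)

/-- The law of the play when every player follows the algorithm. -/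
def algLaw (G : StochasticGame S A) (s₀ : ∀ i, S i) (I : AlgInput S A) :
    Measure (ℕ → JointStep S A) :=
  playLaw G s₀ fun t ω => (algState G I ω t).policy

/-- The occupation measures `ρᵏ` with which batch `k` is played. -/
def iterate (G : StochasticGame S A) (I : AlgInput S A) (ω : ℕ → JointStep S A) (k : ℕ) :
    ∀ i, S i × A i → ℝ :=
  (algState G I ω (sInf {t | (algState G I ω t).batch = k})).ρ

end

/-!
The payoff of a stationary profile is linear in the occupation measure of each player
(`payoff_eq_avgValue`, `avgValue_update_eq_sum`), so the partial derivative of the payoff of player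
`i` in the coordinate `u` is `v u = avgValue r (Function.update ρ i (Pi.single u 1))`. The proof
shows that the weighted averages of the reward vectors approximate this gradient at the limit `ρ*`.
The limit of dual averaging against such an average is an approximate best response.

*One batch.* The algorithm uses fixed policies within a batch, so until its end the players are
independent, each together with its set of unsampled states (`real_arrivalEvent`). This gives the
exact law of the last joint step of a batch, given the past before the batch (`batchKernel`,
`real_lastStep`), and the exact mean of the reward vector (`expectedReward`,
`setIntegral_batchReward`): player `i` samples `u` while the opponents have the laws of their own
chains at that time.

*Many batches with the same policies.* The common end of the batch makes the states of the players
dependent, so the opponents need not be close to stationary when player `i` samples. What counts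
is the sum over `j` of the distances of the joint law from one with an independent stationary
coordinate `j` (`dependenceOn`). From the end of a batch to the end of the next one this sum
contracts by `q = exp (-d / τ)`, up to the constant `4` (`sum_dependenceOn_le`). The reason is that
a player's coordinate is distorted by the end of the batch only if the player is the last one to
finish, strictly after all the others, and the probabilities of these events have sum at most `1`,
whatever the number of players (`dependence_stopped_le`, `sum_unique_last_le`). Hence after many
batches the mean reward vector is within about `2 q / (1 - q)` of the gradient
(`abs_sum_reward_sub_le`, `exists_iterate_expectedReward_close`).

*Averages along the algorithm.* The policies vary, but they converge, and the laws of a batch are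
continuous in them (`tendsto_batchKernel`, `tendsto_expectedReward`). The law of large numbers for
weighted averages, from the convergence of square summable martingales and Kronecker's lemma, holds
also with a conditioning `m` batches back (`ae_tendsto_wAvg_sub_cellMean`). It allows the
reward vectors to be replaced by their conditional means, and these by their `m`-th iterates under
the limit kernel (`eventually_abs_wAvg_sub_le_of_iterate`), to which the previous paragraph applies
(`ae_eventually_wAvg_batchReward_close`). The same law of large numbers, for single steps and equal
weights, yields the formula for the payoff.

*Optimality.* If the averaged rewards are eventually within `β` of the gradient, then the limit of
dual averaging is optimal up to `2 β` in the shrunk polytope (`sum_sub_mul_le_of_dualArgmax`). With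
the threshold `shrinkThreshold` the restriction to the shrunk polytope costs at most `ε / 10`
(`payoff_update_le`). For `ε < 1` and a player with at least two actions the bound on `d` gives
`q ≤ ε / 6`, hence `2 q / (1 - q) < (9 / 20) ε`, and `2 * (9 / 20) + 1 / 10 = 1`. The other cases
are trivial: payoffs lie in `[0, 1]`, and a player with one action cannot deviate.
-/

noncomputable section

set_option linter.unusedSectionVars false

/-! ### Contracting finite chains -/

section Chain

open Matrix

variable {X : Type*} [Fintype X] [DecidableEq X]

/-- A stochastic matrix that contracts the `ℓ¹`-norm of row vectors with zero sum by the
factor `c`. -/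
structure IsContractingChain (K : Matrix X X ℝ) (c : ℝ) : Prop where
  nonneg : ∀ x y, 0 ≤ K x y
  row_sum : ∀ x, ∑ y, K x y = 1
  contract : ∀ ν : X → ℝ, ∑ x, ν x = 0 → ∑ y, |(ν ᵥ* K) y| ≤ c * ∑ x, |ν x|

lemma sum_vecMul_of_row_sum {K : Matrix X X ℝ} (hK : ∀ x, ∑ y, K x y = 1) (ν : X → ℝ) :
    ∑ y, (ν ᵥ* K) y = ∑ x, ν x := by
  simp only [Matrix.vecMul, dotProduct]
  rw [Finset.sum_comm]
  simp [← Finset.mul_sum, hK]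

lemma vecMul_nonneg_of_nonneg {K : Matrix X X ℝ} (hK : ∀ x y, 0 ≤ K x y) {ν : X → ℝ}
    (hν : ∀ x, 0 ≤ ν x) (y : X) : 0 ≤ (ν ᵥ* K) y :=
  Finset.sum_nonneg fun x _ => mul_nonneg (hν x) (hK x y)

namespace IsContractingChain

variable {K : Matrix X X ℝ} {c : ℝ}

lemma pow_nonneg (h : IsContractingChain K c) (t : ℕ) (x y : X) : 0 ≤ (K ^ t) x y := by
  induction t generalizing y with
  | zero => rw [pow_zero, Matrix.one_apply]; split_ifs <;> norm_num
  | succ t ih =>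
    rw [pow_succ, Matrix.mul_apply]
    exact Finset.sum_nonneg fun z _ => mul_nonneg (ih z) (h.nonneg z y)

lemma pow_row_sum (h : IsContractingChain K c) (t : ℕ) (x : X) : ∑ y, (K ^ t) x y = 1 := by
  induction t with
  | zero => simp [Matrix.one_apply]
  | succ t ih =>
    simp only [pow_succ, Matrix.mul_apply]
    rw [Finset.sum_comm]
    simp [← Finset.mul_sum, h.row_sum, ih]

lemma sum_vecMul_pow (h : IsContractingChain K c) (t : ℕ) (ν : X → ℝ) :
    ∑ y, (ν ᵥ* K ^ t) y = ∑ x, ν x :=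
  sum_vecMul_of_row_sum (h.pow_row_sum t) ν

lemma contract_pow (h : IsContractingChain K c) (hc : 0 ≤ c) (t : ℕ) (ν : X → ℝ)
    (hν : ∑ x, ν x = 0) : ∑ y, |(ν ᵥ* K ^ t) y| ≤ c ^ t * ∑ x, |ν x| := by
  induction t with
  | zero => simp
  | succ t ih =>
    have h1 := h.contract (ν ᵥ* K ^ t) (by rw [h.sum_vecMul_pow, hν])
    rw [Matrix.vecMul_vecMul, ← pow_succ] at h1
    calc _ ≤ _ := h1
      _ ≤ c * (c ^ t * ∑ x, |ν x|) := by gcongr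
      _ = _ := by ring

lemma tendsto_vecMul_pow_zero (h : IsContractingChain K c) (hc : 0 ≤ c) (hc1 : c < 1)
    (ν : X → ℝ) (hν : ∑ x, ν x = 0) (y : X) :
    Tendsto (fun t : ℕ => (ν ᵥ* K ^ t) y) atTop (𝓝 0) := by
  have h1 : Tendsto (fun t : ℕ => c ^ t * ∑ x, |ν x|) atTop (𝓝 0) := by
    simpa using (tendsto_pow_atTop_nhds_zero_of_lt_one hc hc1).mul_const (∑ x, |ν x|)
  refine squeeze_zero_norm (fun t => ?_) h1
  rw [Real.norm_eq_abs]
  exact (Finset.single_le_sum (f := fun y => |(ν ᵥ* K ^ t) y|) (fun _ _ => abs_nonneg _)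
    (Finset.mem_univ y)).trans (h.contract_pow hc t ν hν)

lemma vecMul_pow_of_fixed {μ : X → ℝ} (hμ : μ ᵥ* K = μ) (t : ℕ) : μ ᵥ* K ^ t = μ := by
  induction t with
  | zero => simp
  | succ t ih => rw [pow_succ, ← Matrix.vecMul_vecMul, ih, hμ]

lemma tendsto_vecMul_pow (h : IsContractingChain K c) (hc : 0 ≤ c) (hc1 : c < 1) {κ μ : X → ℝ}
    (hκ : ∑ x, κ x = 1) (hμ1 : ∑ x, μ x = 1) (hμ : μ ᵥ* K = μ) (y : X) :
    Tendsto (fun t : ℕ => (κ ᵥ* K ^ t) y) atTop (𝓝 (μ y)) := by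
  have h1 := (h.tendsto_vecMul_pow_zero hc hc1 (κ - μ) (by simp [hκ, hμ1]) y).add_const (μ y)
  simpa [Matrix.sub_vecMul, vecMul_pow_of_fixed hμ] using h1

/-- The fixed vector comes from the singularity of `K - 1`; its sum is not zero because of the
contraction, and it is nonnegative as a limit of distributions. -/
lemma exists_stationary [Nonempty X] (h : IsContractingChain K c) (hc : 0 ≤ c) (hc1 : c < 1) :
    ∃ μ : X → ℝ, (∀ x, 0 ≤ μ x) ∧ ∑ x, μ x = 1 ∧ μ ᵥ* K = μ := by
  have hdet : (K - 1).det = 0 := by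
    rw [← Matrix.exists_mulVec_eq_zero_iff]
    refine ⟨fun _ => 1, fun h0 => ?_, ?_⟩
    · exact one_ne_zero (congrFun h0 (Classical.arbitrary X))
    · ext x
      simp [Matrix.mulVec, dotProduct, h.row_sum, Matrix.one_apply]
  obtain ⟨ν, hν0, hν⟩ := Matrix.exists_vecMul_eq_zero_iff.2 hdet
  have hfix : ν ᵥ* K = ν := by
    rw [Matrix.vecMul_sub, Matrix.vecMul_one] at hν
    exact sub_eq_zero.1 hν
  have hsum : ∑ x, ν x ≠ 0 := by
    intro h0
    have h1 := h.contract ν h0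
    rw [hfix] at h1
    have h2 : 0 ≤ ∑ x, |ν x| := Finset.sum_nonneg fun _ _ => abs_nonneg _
    have h3 : ∑ x, |ν x| = 0 := by nlinarith
    refine hν0 (funext fun x => ?_)
    have := (Finset.sum_eq_zero_iff_of_nonneg (fun _ _ => abs_nonneg _)).1 h3 x (Finset.mem_univ x)
    simpa using this
  set μ : X → ℝ := (∑ x, ν x)⁻¹ • ν with hμ
  have hμ1 : ∑ x, μ x = 1 := by
    simp [hμ, ← Finset.mul_sum, hsum]
  have hμK : μ ᵥ* K = μ := by rw [hμ, Matrix.smul_vecMul, hfix]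
  refine ⟨μ, fun y => ?_, hμ1, hμK⟩
  refine ge_of_tendsto' (h.tendsto_vecMul_pow hc hc1
    (κ := Pi.single (Classical.arbitrary X) 1) (by simp) hμ1 hμK y) fun t => ?_
  exact vecMul_nonneg_of_nonneg (h.pow_nonneg t)
    (fun x => by rw [Pi.single_apply]; split_ifs <;> norm_num) y

end IsContractingChain

/-! ### The sampling of the states by one chain -/

/-- The states still to be sampled when `y` is visited `e` time instances after the end of the
previous batch and those in `V` were to be sampled before. -/
def remaining (d e : ℕ) (V : Finset X) (y : X) : Finset X := if d ≤ e then V.erase y else V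

/-- Let a chain with transition matrix `K` have the law `κ` one time instance after the end of
the previous batch. `arrivalLaw K d κ t V y` is the probability that `t + 1` time instances after
this end it is in `y` and that the states in `V` were unsampled immediately before. -/
def arrivalLaw (K : Matrix X X ℝ) (d : ℕ) (κ : X → ℝ) : ℕ → Finset X → X → ℝ
  | 0, V, y => if V = Finset.univ then κ y else 0
  | t + 1, V, y =>
    ∑ x, (∑ W, if remaining d (t + 1) W x = V then arrivalLaw K d κ t W x else 0) * K x y

/-- As `arrivalLaw`, with the unsampled states counted immediately after the visit. -/
def departureLaw (K : Matrix X X ℝ) (d : ℕ) (κ : X → ℝ) (t : ℕ) (V : Finset X) (y : X) : ℝ :=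
  ∑ W, if remaining d (t + 1) W y = V then arrivalLaw K d κ t W y else 0

/-- The probability that at most `t` time instances after the end of the previous batch all states
have been sampled. -/
def coverProb (K : Matrix X X ℝ) (d : ℕ) (κ : X → ℝ) (t : ℕ) : ℝ :=
  ∑ y, arrivalLaw K d κ t ∅ y

/-- The probability that `s` is sampled exactly `t + 1` time instances after the end of the
previous batch. -/
def firstVisitProb (K : Matrix X X ℝ) (d : ℕ) (κ : X → ℝ) (s : X) (t : ℕ) : ℝ :=
  if d ≤ t + 1 then ∑ V with s ∈ V, arrivalLaw K d κ t V s else 0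

section Laws

variable {K : Matrix X X ℝ} {d : ℕ} {κ : X → ℝ}

lemma arrivalLaw_succ (t : ℕ) (V : Finset X) (y : X) :
    arrivalLaw K d κ (t + 1) V y = ∑ x, departureLaw K d κ t V x * K x y := rfl

lemma arrivalLaw_nonneg (hK : ∀ x y, 0 ≤ K x y) (hκ : ∀ x, 0 ≤ κ x) (t : ℕ) (V : Finset X)
    (y : X) : 0 ≤ arrivalLaw K d κ t V y := by
  induction t generalizing V y with
  | zero => rw [arrivalLaw]; split_ifs; exacts [hκ y, le_rfl]
  | succ t ih =>
    refine Finset.sum_nonneg fun x _ => mul_nonneg (Finset.sum_nonneg fun W _ => ?_) (hK x y)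
    split_ifs; exacts [ih W x, le_rfl]

lemma departureLaw_nonneg (hK : ∀ x y, 0 ≤ K x y) (hκ : ∀ x, 0 ≤ κ x) (t : ℕ) (V : Finset X)
    (y : X) : 0 ≤ departureLaw K d κ t V y := by
  refine Finset.sum_nonneg fun W _ => ?_
  split_ifs; exacts [arrivalLaw_nonneg hK hκ t W y, le_rfl]

lemma sum_departureLaw (t : ℕ) (y : X) :
    ∑ V, departureLaw K d κ t V y = ∑ V, arrivalLaw K d κ t V y := by
  simp only [departureLaw]
  rw [Finset.sum_comm]
  simp

lemma sum_arrivalLaw (t : ℕ) (y : X) : ∑ V, arrivalLaw K d κ t V y = (κ ᵥ* K ^ t) y := by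
  induction t generalizing y with
  | zero => simp [arrivalLaw]
  | succ t ih =>
    simp only [arrivalLaw_succ]
    rw [Finset.sum_comm]
    simp only [← Finset.sum_mul, sum_departureLaw, ih]
    rw [pow_succ, ← Matrix.vecMul_vecMul]
    rfl

lemma arrivalLaw_empty_le_departureLaw (hK : ∀ x y, 0 ≤ K x y) (hκ : ∀ x, 0 ≤ κ x) (t : ℕ)
    (y : X) : arrivalLaw K d κ t ∅ y ≤ departureLaw K d κ t ∅ y := by
  have h : remaining d (t + 1) (∅ : Finset X) y = ∅ := by simp [remaining]
  rw [departureLaw]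
  refine le_trans (by rw [if_pos h]) (Finset.single_le_sum (f := fun W =>
    if remaining d (t + 1) W y = ∅ then arrivalLaw K d κ t W y else 0) (fun W _ => ?_)
    (Finset.mem_univ ∅))
  split_ifs; exacts [arrivalLaw_nonneg hK hκ t W y, le_rfl]

lemma departureLaw_le (hK : ∀ x y, 0 ≤ K x y) (hκ : ∀ x, 0 ≤ κ x) (t : ℕ) (V : Finset X)
    (y : X) : departureLaw K d κ t V y ≤ (κ ᵥ* K ^ t) y := by
  rw [← sum_arrivalLaw (d := d), ← sum_departureLaw]
  exact Finset.single_le_sum (f := fun V => departureLaw K d κ t V y)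
    (fun W _ => departureLaw_nonneg hK hκ t W y) (Finset.mem_univ V)

lemma arrivalLaw_eq_zero {t : ℕ} (ht : t + 1 ≤ d) {V : Finset X} (hV : V ≠ Finset.univ) (y : X) :
    arrivalLaw K d κ t V y = 0 := by
  induction t generalizing V y with
  | zero => simp [arrivalLaw, hV]
  | succ t ih =>
    refine Finset.sum_eq_zero fun x _ => ?_
    rw [Finset.sum_eq_zero, zero_mul]
    intro W _
    have : remaining d (t + 1) W x = W := by rw [remaining, if_neg (by omega)]
    rw [this]
    split_ifs with h
    · subst h; exact ih (by omega) hV x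
    · rfl

lemma departureLaw_empty_eq_zero [Nonempty X] {t : ℕ} (ht : t + 1 < d) (y : X) :
    departureLaw K d κ t ∅ y = 0 := by
  refine Finset.sum_eq_zero fun W _ => ?_
  have : remaining d (t + 1) W y = W := by rw [remaining, if_neg (by omega)]
  rw [this]
  split_ifs with h
  · subst h; exact arrivalLaw_eq_zero ht.le Finset.univ_nonempty.ne_empty.symm y
  · rfl

lemma arrivalLaw_empty_eq_zero [Nonempty X] {t : ℕ} (ht : t + 1 ≤ d) (y : X) :
    arrivalLaw K d κ t ∅ y = 0 :=
  arrivalLaw_eq_zero ht Finset.univ_nonempty.ne_empty.symm y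

lemma coverProb_zero [Nonempty X] : coverProb K d κ 0 = 0 := by
  refine Finset.sum_eq_zero fun y _ => ?_
  rw [arrivalLaw, if_neg Finset.univ_nonempty.ne_empty.symm]

lemma sum_departureLaw_empty (hK : ∀ x, ∑ y, K x y = 1) (t : ℕ) :
    ∑ y, departureLaw K d κ t ∅ y = coverProb K d κ (t + 1) := by
  simp only [coverProb, arrivalLaw_succ]
  exact (sum_vecMul_of_row_sum hK (departureLaw K d κ t ∅)).symm

lemma coverProb_nonneg (hK : ∀ x y, 0 ≤ K x y) (hκ : ∀ x, 0 ≤ κ x) (t : ℕ) :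
    0 ≤ coverProb K d κ t :=
  Finset.sum_nonneg fun y _ => arrivalLaw_nonneg hK hκ t ∅ y

lemma coverProb_le_succ (hK : ∀ x y, 0 ≤ K x y) (hK1 : ∀ x, ∑ y, K x y = 1)
    (hκ : ∀ x, 0 ≤ κ x) (t : ℕ) : coverProb K d κ t ≤ coverProb K d κ (t + 1) := by
  rw [← sum_departureLaw_empty hK1]
  exact Finset.sum_le_sum fun y _ => arrivalLaw_empty_le_departureLaw hK hκ t y

lemma firstVisitProb_nonneg (hK : ∀ x y, 0 ≤ K x y) (hκ : ∀ x, 0 ≤ κ x) (s : X) (t : ℕ) :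
    0 ≤ firstVisitProb K d κ s t := by
  rw [firstVisitProb]
  split_ifs
  · exact Finset.sum_nonneg fun V _ => arrivalLaw_nonneg hK hκ t V s
  · exact le_rfl

/-- The probability that `s` is unsampled and the chain is in `y` evolves by killing the
chain in `s` once the sampling has begun. -/
lemma sum_arrivalLaw_mem_succ (s : X) (t : ℕ) (y : X) :
    ∑ V with s ∈ V, arrivalLaw K d κ (t + 1) V y =
      ∑ x, ((∑ V with s ∈ V, arrivalLaw K d κ t V x) -
        if x = s then firstVisitProb K d κ s t else 0) * K x y := by
  simp only [arrivalLaw_succ]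
  rw [Finset.sum_comm]
  refine Finset.sum_congr rfl fun x _ => ?_
  rw [← Finset.sum_mul]
  congr 1
  simp only [departureLaw]
  rw [Finset.sum_comm]
  have h1 : ∀ W : Finset X, (∑ V with s ∈ V,
      if remaining d (t + 1) W x = V then arrivalLaw K d κ t W x else 0) =
      if s ∈ remaining d (t + 1) W x then arrivalLaw K d κ t W x else 0 := by
    intro W
    rw [Finset.sum_ite_eq]
    simp
  simp only [h1, Finset.sum_filter]
  by_cases hx : x = s
  · subst hx
    by_cases hd : d ≤ t + 1
    · simp [remaining, hd, firstVisitProb, Finset.sum_filter]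
    · simp [remaining, hd, firstVisitProb]
  · simp only [hx, if_false, sub_zero]
    refine Finset.sum_congr rfl fun W _ => ?_
    by_cases hd : d ≤ t + 1 <;> simp [remaining, hd, Ne.symm hx]

lemma sum_firstVisitProb [Nonempty X] (hK : ∀ x, ∑ y, K x y = 1) (hκ : ∑ x, κ x = 1) (s : X)
    (N : ℕ) : ∑ t ∈ Finset.range N, firstVisitProb K d κ s t =
      1 - ∑ y, ∑ V with s ∈ V, arrivalLaw K d κ N V y := by
  induction N with
  | zero => simp [arrivalLaw, Finset.sum_ite_eq', hκ]
  | succ N ih =>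
    rw [Finset.sum_range_succ, ih]
    simp only [sum_arrivalLaw_mem_succ]
    have := sum_vecMul_of_row_sum hK (fun x => (∑ V with s ∈ V, arrivalLaw K d κ N V x) -
        if x = s then firstVisitProb K d κ s N else 0)
    simp only [Matrix.vecMul, dotProduct] at this
    rw [this, Finset.sum_sub_distrib, Finset.sum_ite_eq', if_pos (Finset.mem_univ s)]
    ring

lemma sum_firstVisitProb_le [Nonempty X] (hK : ∀ x y, 0 ≤ K x y) (hK1 : ∀ x, ∑ y, K x y = 1)
    (hκ0 : ∀ x, 0 ≤ κ x) (hκ : ∑ x, κ x = 1) (s : X) (N : ℕ) :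
    ∑ t ∈ Finset.range N, firstVisitProb K d κ s t ≤ 1 := by
  rw [sum_firstVisitProb hK1 hκ]
  have : 0 ≤ ∑ y, ∑ V with s ∈ V, arrivalLaw K d κ N V y :=
    Finset.sum_nonneg fun y _ => Finset.sum_nonneg fun V _ => arrivalLaw_nonneg hK hκ0 N V y
  linarith

lemma sum_sum_arrivalLaw (hK1 : ∀ x, ∑ y, K x y = 1) (hκ : ∑ x, κ x = 1) (N : ℕ) :
    ∑ y, ∑ V, arrivalLaw K d κ N V y = 1 := by
  simp only [sum_arrivalLaw]
  induction N with
  | zero => simpa using hκ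
  | succ N ih =>
    simp only [pow_succ, ← Matrix.vecMul_vecMul]
    rw [sum_vecMul_of_row_sum hK1, ih]

lemma coverProb_le_one (hK : ∀ x y, 0 ≤ K x y) (hK1 : ∀ x, ∑ y, K x y = 1)
    (hκ0 : ∀ x, 0 ≤ κ x) (hκ : ∑ x, κ x = 1) (N : ℕ) : coverProb K d κ N ≤ 1 := by
  rw [← sum_sum_arrivalLaw (d := d) hK1 hκ N]
  exact Finset.sum_le_sum fun y _ => Finset.single_le_sum
    (f := fun V => arrivalLaw K d κ N V y) (fun V _ => arrivalLaw_nonneg hK hκ0 N V y)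
    (Finset.mem_univ ∅)

lemma coverProb_le_sum_firstVisitProb [Nonempty X] (hK : ∀ x y, 0 ≤ K x y)
    (hK1 : ∀ x, ∑ y, K x y = 1) (hκ0 : ∀ x, 0 ≤ κ x) (hκ : ∑ x, κ x = 1) (s : X) (N : ℕ) :
    coverProb K d κ N ≤ ∑ t ∈ Finset.range N, firstVisitProb K d κ s t := by
  rw [sum_firstVisitProb hK1 hκ, ← sum_sum_arrivalLaw (d := d) hK1 hκ N, coverProb,
    ← Finset.sum_sub_distrib]
  refine Finset.sum_le_sum fun y _ => ?_
  rw [← Finset.sum_filter_add_sum_filter_not Finset.univ (fun V : Finset X => s ∈ V),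
    add_sub_cancel_left]
  exact Finset.single_le_sum (f := fun V => arrivalLaw K d κ N V y)
    (fun V _ => arrivalLaw_nonneg hK hκ0 N V y) (by simp)

/-- A primitive chain visits `s` almost surely: with `k` such that `K ^ k` is positive, the mass
that has not yet seen `s` is at most a multiple of the mass arriving in `s` during the next
`k` steps, and the latter tends to zero since the visits have total mass at most one. -/
lemma tendsto_unvisited_zero [Nonempty X] (hK1 : ∀ x, ∑ y, K x y = 1) (hprim : K.IsPrimitive)
    (hκ0 : ∀ x, 0 ≤ κ x) (hκ : ∑ x, κ x = 1) (s : X) :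
    Tendsto (fun N => ∑ y, ∑ V with s ∈ V, arrivalLaw K d κ N V y) atTop (𝓝 0) := by
  have hK := hprim.nonneg
  obtain ⟨k, -, hk⟩ := hprim.exists_pos_pow
  obtain ⟨x₀, hx₀⟩ := Finite.exists_min fun x => (K ^ k) x s
  set f := fun t => firstVisitProb K d κ s t with hf
  set u := fun t y => ∑ V with s ∈ V, arrivalLaw K d κ t V y with hu
  have hu0 : ∀ t y, 0 ≤ u t y := fun t y =>
    Finset.sum_nonneg fun V _ => arrivalLaw_nonneg hK hκ0 t V y
  have hf0 : ∀ t, 0 ≤ f t := firstVisitProb_nonneg hK hκ0 s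
  have hKle : ∀ x y, K x y ≤ 1 := fun x y => by
    rw [← hK1 x]; exact Finset.single_le_sum (fun z _ => hK x z) (Finset.mem_univ y)
  have hsumm : Summable f :=
    summable_of_sum_range_le hf0 (sum_firstVisitProb_le hK hK1 hκ0 hκ s)
  have hflim := hsumm.tendsto_atTop_zero
  have hstep : ∀ t y, (u t ᵥ* K) y ≤ u (t + 1) y + f t := by
    intro t y
    have h1 : u (t + 1) y = (u t ᵥ* K) y - f t * K s y := by
      simp only [hu, hf, sum_arrivalLaw_mem_succ, Matrix.vecMul, dotProduct, sub_mul,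
        Finset.sum_sub_distrib, ite_mul, zero_mul, Finset.sum_ite_eq', Finset.mem_univ, if_true]
    rw [h1]
    nlinarith [hf0 t, hKle s y]
  have hpow : ∀ j t y, (u t ᵥ* K ^ j) y ≤
      u (t + j) y + (Fintype.card X : ℝ) ^ j * ∑ l ∈ Finset.range j, f (t + l) := by
    intro j t
    induction j with
    | zero => simp
    | succ j ih =>
      intro y
      rw [pow_succ, ← Matrix.vecMul_vecMul]
      have hcard : (1 : ℝ) ≤ Fintype.card X := by exact_mod_cast Fintype.card_pos
      have hS : 0 ≤ ∑ l ∈ Finset.range j, f (t + l) := Finset.sum_nonneg fun _ _ => hf0 _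
      calc ((u t ᵥ* K ^ j) ᵥ* K) y
          ≤ ∑ x, (u (t + j) x + (Fintype.card X : ℝ) ^ j * ∑ l ∈ Finset.range j, f (t + l))
              * K x y := Finset.sum_le_sum fun x _ => mul_le_mul_of_nonneg_right (ih x) (hK x y)
        _ = (u (t + j) ᵥ* K) y + ∑ x, ((Fintype.card X : ℝ) ^ j *
              ∑ l ∈ Finset.range j, f (t + l)) * K x y := by
            simp only [add_mul, Finset.sum_add_distrib]; rfl
        _ ≤ (u (t + j + 1) y + f (t + j)) + ∑ _x : X, ((Fintype.card X : ℝ) ^ j *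
              ∑ l ∈ Finset.range j, f (t + l)) * 1 := by
            gcongr with x _
            · exact hstep _ _
            · exact hKle x y
        _ = u (t + (j + 1)) y + (1 * f (t + j) + (Fintype.card X : ℝ) ^ (j + 1) *
              ∑ l ∈ Finset.range j, f (t + l)) := by
            simp only [mul_one, Finset.sum_const, Finset.card_univ, nsmul_eq_mul]
            rw [← add_assoc t j 1]; ring
        _ ≤ _ := by
            rw [Finset.sum_range_succ, mul_add, add_comm (_ * ∑ l ∈ _, _)]
            gcongr
            · exact hf0 _
            · exact one_le_pow₀ hcard
  -- once the sampling has begun, the mass in `s` is the mass of the first visits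
  have hmass : ∀ t, d ≤ t → (K ^ k) x₀ s * ∑ y, u t y ≤
      f (t + k) + (Fintype.card X : ℝ) ^ k * ∑ l ∈ Finset.range k, f (t + l) := by
    intro t ht
    have h1 := hpow k t s
    have h2 : u (t + k) s = f (t + k) := by
      simp only [hu, hf, firstVisitProb, if_pos (show d ≤ t + k + 1 by omega)]
    rw [h2] at h1
    refine le_trans ?_ h1
    rw [Finset.mul_sum]
    refine Finset.sum_le_sum fun x _ => ?_
    rw [mul_comm]
    exact mul_le_mul_of_nonneg_left (hx₀ x) (hu0 t x)
  have hlim : Tendsto (fun t => ((K ^ k) x₀ s)⁻¹ * (f (t + k) + (Fintype.card X : ℝ) ^ k *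
      ∑ l ∈ Finset.range k, f (t + l))) atTop (𝓝 0) := by
    have h1 : Tendsto (fun t => ∑ l ∈ Finset.range k, f (t + l)) atTop (𝓝 0) := by
      simpa using tendsto_finsetSum (Finset.range k)
        fun l _ => (tendsto_add_atTop_iff_nat l).2 hflim
    simpa using (((tendsto_add_atTop_iff_nat k).2 hflim).add
      (h1.const_mul ((Fintype.card X : ℝ) ^ k))).const_mul ((K ^ k) x₀ s)⁻¹
  refine tendsto_of_tendsto_of_tendsto_of_le_of_le' tendsto_const_nhds hlim
    (Eventually.of_forall fun t => Finset.sum_nonneg fun y _ => hu0 t y) ?_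
  filter_upwards [eventually_ge_atTop d] with t ht
  rw [← div_eq_inv_mul, le_div_iff₀' (hk x₀ s)]
  exact hmass t ht

lemma tendsto_coverProb [Nonempty X] (hK1 : ∀ x, ∑ y, K x y = 1) (hprim : K.IsPrimitive)
    (hκ0 : ∀ x, 0 ≤ κ x) (hκ : ∑ x, κ x = 1) :
    Tendsto (coverProb K d κ) atTop (𝓝 1) := by
  have hK := hprim.nonneg
  have h1 : Tendsto (fun N => 1 - ∑ s, ∑ y, ∑ V with s ∈ V, arrivalLaw K d κ N V y) atTop
      (𝓝 1) := by
    simpa using (tendsto_finsetSum Finset.univ fun s _ =>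
      tendsto_unvisited_zero (d := d) hK1 hprim hκ0 hκ s).const_sub 1
  refine tendsto_of_tendsto_of_tendsto_of_le_of_le h1 tendsto_const_nhds (fun N => ?_)
    (coverProb_le_one hK hK1 hκ0 hκ)
  have h2 := sum_sum_arrivalLaw (d := d) hK1 hκ N
  have h3 : ∀ y, ∑ V, arrivalLaw K d κ N V y ≤ arrivalLaw K d κ N ∅ y +
      ∑ s, ∑ V with s ∈ V, arrivalLaw K d κ N V y := by
    intro y
    simp only [Finset.sum_filter]
    rw [Finset.sum_comm, ← Finset.add_sum_erase _ _ (Finset.mem_univ (∅ : Finset X))]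
    gcongr
    refine (Finset.sum_le_sum fun V hV => ?_).trans (Finset.sum_le_sum_of_subset_of_nonneg
      (Finset.subset_univ _) fun V _ _ => Finset.sum_nonneg fun s _ => ?_)
    · obtain ⟨s, hs⟩ := Finset.nonempty_iff_ne_empty.2 (Finset.ne_of_mem_erase hV)
      refine le_trans (by rw [if_pos hs]) (Finset.single_le_sum
        (f := fun s => if s ∈ V then arrivalLaw K d κ N V y else 0) (fun x _ => ?_)
        (Finset.mem_univ s))
      split_ifs; exacts [arrivalLaw_nonneg hK hκ0 N V y, le_rfl]
    · split_ifs; exacts [arrivalLaw_nonneg hK hκ0 N V y, le_rfl]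
  have h4 := Finset.sum_le_sum fun y (_ : y ∈ Finset.univ) => h3 y
  rw [h2, Finset.sum_add_distrib, Finset.sum_comm] at h4
  simp only [coverProb]
  linarith

end Laws

lemma continuous_arrivalLaw (d t : ℕ) (V : Finset X) (y : X) :
    Continuous fun q : Matrix X X ℝ × (X → ℝ) => arrivalLaw q.1 d q.2 t V y := by
  induction t generalizing V y with
  | zero =>
    simp only [arrivalLaw]
    split_ifs <;> fun_prop
  | succ t ih =>
    simp only [arrivalLaw]
    refine continuous_finsetSum _ fun x _ => Continuous.mul ?_ (by fun_prop)
    refine continuous_finsetSum _ fun W _ => ?_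
    split_ifs
    · exact ih W x
    · exact continuous_const

end Chain

/-! ### The chain of a stationary policy -/

section SinglePlayer

open Matrix

variable {X Y : Type*} [Fintype X] [DecidableEq X] [Fintype Y]

lemma inducedChain_apply (p : TransitionModel X Y) (π : StationaryPolicy X Y) (s s' : X) :
    inducedChain p π s s' = ∑ a, p s a s' * π s a := rfl

lemma inducedChain_nonneg (p : TransitionModel X Y) (π : StationaryPolicy X Y) (s s' : X) :
    0 ≤ inducedChain p π s s' :=
  Finset.sum_nonneg fun a _ => mul_nonneg ((p s a).2.1 s') ((π s).2.1 a)

lemma inducedChain_row_sum (p : TransitionModel X Y) (π : StationaryPolicy X Y) (s : X) :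
    ∑ s', inducedChain p π s s' = 1 := by
  simp only [inducedChain_apply]
  rw [Finset.sum_comm]
  have h1 : ∀ a, ∑ s', p s a s' = 1 := fun a => (p s a).2.2
  have h2 : ∑ a, π s a = 1 := (π s).2.2
  simp [← Finset.sum_mul, h1, h2]

lemma continuous_inducedChain (p : TransitionModel X Y) : Continuous (inducedChain p) := by
  refine continuous_matrix fun s s' => ?_
  simp only [inducedChain_apply]
  refine continuous_finsetSum _ fun a _ => continuous_const.mul ?_
  exact (continuous_apply a).comp (continuous_subtype_val.comp (continuous_apply s))

/-- A zero-sum vector is a multiple of the difference of two distributions, so the contraction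
of the distances of distributions carries over. -/
lemma UniformlyErgodic.isContractingChain {p : TransitionModel X Y} {τ : ℝ}
    (h : UniformlyErgodic p τ) (π : StationaryPolicy X Y) :
    IsContractingChain (inducedChain p π) (Real.exp (-1 / τ)) := by
  refine ⟨inducedChain_nonneg p π, inducedChain_row_sum p π, fun ν hν => ?_⟩
  set m := ∑ x, (ν x)⁺ with hm
  have hm' : ∑ x, (ν x)⁻ = m := by
    have : ∑ x, ((ν x)⁺ - (ν x)⁻) = 0 := by simpa [posPart_sub_negPart] using hν
    rw [Finset.sum_sub_distrib] at this
    linarith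
  have hm0 : 0 ≤ m := Finset.sum_nonneg fun x _ => posPart_nonneg _
  rcases hm0.eq_or_lt with h0 | hpos
  · have h1 : ∀ x, (ν x)⁺ = 0 := fun x =>
      (Finset.sum_eq_zero_iff_of_nonneg (fun x _ => posPart_nonneg (ν x))).1 h0.symm x
        (Finset.mem_univ x)
    have h2 : ∀ x, (ν x)⁻ = 0 := fun x =>
      (Finset.sum_eq_zero_iff_of_nonneg (fun x _ => negPart_nonneg (ν x))).1 (hm'.trans h0.symm) x
        (Finset.mem_univ x)
    have h3 : ν = 0 := by
      ext x
      have := posPart_sub_negPart (ν x)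
      rw [h1, h2] at this
      simpa using this.symm
    simp [h3]
  · let v : stdSimplex ℝ X := ⟨fun x => (ν x)⁺ / m,
      fun x => div_nonneg (posPart_nonneg _) hpos.le, by
        rw [← Finset.sum_div]; exact div_self hpos.ne'⟩
    let v' : stdSimplex ℝ X := ⟨fun x => (ν x)⁻ / m,
      fun x => div_nonneg (negPart_nonneg _) hpos.le, by
        rw [← Finset.sum_div, hm']; exact div_self hpos.ne'⟩
    have hv : ∀ x, v x - v' x = ν x / m := fun x => by
      change (ν x)⁺ / m - (ν x)⁻ / m = _
      rw [← sub_div, posPart_sub_negPart]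
    have h1 := (h π).2 v v'
    simp only [hv, abs_div, abs_of_pos hpos] at h1
    have h2 : ∀ s', |∑ s, ν s / m * inducedChain p π s s'| = |(ν ᵥ* inducedChain p π) s'| / m := by
      intro s'
      rw [← abs_of_pos hpos, ← abs_div, abs_of_pos hpos]
      congr 1
      simp only [Matrix.vecMul, dotProduct, Finset.sum_div]
      exact Finset.sum_congr rfl fun s _ => by ring
    simp only [h2, ← Finset.sum_div] at h1
    rwa [← mul_div_assoc, div_le_div_iff_of_pos_right hpos] at h1

end SinglePlayer

/-! ### The dependence of one coordinate on the others -/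

section Dependence

open Matrix

variable {X W : Type*} [Fintype X] [DecidableEq X] [Fintype W]

/-- The `ℓ¹`-distance of a measure `θ` on `X × W` from the product of `μ` and the `W`-marginal
of `θ`. -/
def dependence (μ : X → ℝ) (θ : X → W → ℝ) : ℝ := ∑ w, ∑ x, |θ x w - μ x * ∑ u, θ u w|

/-- The image of a measure on `X × W` under a product kernel. -/
def pushProd (θ : X → W → ℝ) (M : X → X → ℝ) (M' : W → W → ℝ) (y : X) (v : W) : ℝ :=
  ∑ w, ∑ x, θ x w * (M x y * M' w v)

lemma dependence_nonneg (μ : X → ℝ) (θ : X → W → ℝ) : 0 ≤ dependence μ θ :=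
  Finset.sum_nonneg fun _ _ => Finset.sum_nonneg fun _ _ => abs_nonneg _

lemma dependence_add_le (μ : X → ℝ) (θ θ' : X → W → ℝ) :
    dependence μ (fun x w => θ x w + θ' x w) ≤ dependence μ θ + dependence μ θ' := by
  simp only [dependence, ← Finset.sum_add_distrib]
  refine Finset.sum_le_sum fun w _ => Finset.sum_le_sum fun x _ => ?_
  rw [Finset.sum_add_distrib]
  refine le_trans (le_of_eq ?_) (abs_add_le _ _)
  congr 1
  ring

lemma dependence_neg (μ : X → ℝ) (θ : X → W → ℝ) :
    dependence μ (fun x w => -θ x w) = dependence μ θ := by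
  simp only [dependence]
  refine Finset.sum_congr rfl fun w _ => Finset.sum_congr rfl fun x _ => ?_
  rw [← abs_neg]
  congr 1
  rw [Finset.sum_neg_distrib]
  ring

lemma dependence_sum_le {κ : Type*} (s : Finset κ) (μ : X → ℝ) (θ : κ → X → W → ℝ) :
    dependence μ (fun x w => ∑ t ∈ s, θ t x w) ≤ ∑ t ∈ s, dependence μ (θ t) := by
  classical
  induction s using Finset.induction_on with
  | empty => simp [dependence]
  | insert a s ha ih =>
    simp only [Finset.sum_insert ha]
    exact (dependence_add_le μ _ _).trans (by gcongr)

lemma dependence_le_of_nonneg {μ : X → ℝ} (hμ0 : ∀ x, 0 ≤ μ x) (hμ1 : ∑ x, μ x = 1)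
    {θ : X → W → ℝ} (hθ : ∀ x w, 0 ≤ θ x w) : dependence μ θ ≤ 2 * ∑ w, ∑ x, θ x w := by
  rw [dependence, Finset.mul_sum]
  refine Finset.sum_le_sum fun w _ => ?_
  have hS : 0 ≤ ∑ u, θ u w := Finset.sum_nonneg fun u _ => hθ u w
  calc ∑ x, |θ x w - μ x * ∑ u, θ u w| ≤ ∑ x, (θ x w + μ x * ∑ u, θ u w) := by
        refine Finset.sum_le_sum fun x _ => (abs_sub _ _).trans ?_
        rw [abs_of_nonneg (hθ x w), abs_of_nonneg (mul_nonneg (hμ0 x) hS)]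
    _ = 2 * ∑ x, θ x w := by
        rw [Finset.sum_add_distrib, ← Finset.sum_mul, hμ1]; ring

lemma sum_pushProd (θ : X → W → ℝ) (M : X → X → ℝ) (M' : W → W → ℝ) :
    ∑ v, ∑ y, pushProd θ M M' y v = ∑ w, ∑ x, θ x w * ((∑ y, M x y) * ∑ v, M' w v) := by
  simp only [pushProd]
  calc _ = ∑ v, ∑ w, ∑ x, ∑ y, θ x w * (M x y * M' w v) := by
        refine Finset.sum_congr rfl fun v _ => ?_
        rw [Finset.sum_comm]
        refine Finset.sum_congr rfl fun w _ => Finset.sum_comm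
    _ = ∑ w, ∑ x, ∑ v, ∑ y, θ x w * (M x y * M' w v) := by
        rw [Finset.sum_comm]
        refine Finset.sum_congr rfl fun w _ => Finset.sum_comm
    _ = _ := by
        refine Finset.sum_congr rfl fun w _ => Finset.sum_congr rfl fun x _ => ?_
        simp only [← Finset.mul_sum, ← Finset.sum_mul]

lemma pushProd_nonneg {θ : X → W → ℝ} (hθ : ∀ x w, 0 ≤ θ x w) {M : X → X → ℝ}
    (hM : ∀ x y, 0 ≤ M x y) {M' : W → W → ℝ} (hM' : ∀ w v, 0 ≤ M' w v) (y : X) (v : W) :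
    0 ≤ pushProd θ M M' y v :=
  Finset.sum_nonneg fun w _ => Finset.sum_nonneg fun x _ =>
    mul_nonneg (hθ x w) (mul_nonneg (hM x y) (hM' w v))

/-- A product kernel contracts the dependence as much as its first factor contracts zero-sum
vectors, when `μ` is stationary for that factor. -/
lemma dependence_pushProd_le {μ : X → ℝ} (hμ1 : ∑ x, μ x = 1) {M : Matrix X X ℝ}
    (hM1 : ∀ x, ∑ y, M x y = 1) (hμM : μ ᵥ* M = μ) {q : ℝ}
    (hq : ∀ ν : X → ℝ, ∑ x, ν x = 0 → ∑ y, |(ν ᵥ* M) y| ≤ q * ∑ x, |ν x|)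
    {M' : W → W → ℝ} (hM' : ∀ w v, 0 ≤ M' w v) (θ : X → W → ℝ) :
    dependence μ (pushProd θ M M') ≤
      q * ∑ w, (∑ v, M' w v) * ∑ x, |θ x w - μ x * ∑ u, θ u w| := by
  set ν : W → X → ℝ := fun w x => θ x w - μ x * ∑ u, θ u w with hν
  have hν0 : ∀ w, ∑ x, ν w x = 0 := fun w => by
    simp only [hν, Finset.sum_sub_distrib, ← Finset.sum_mul, hμ1]; ring
  have h1 : ∀ y v, pushProd θ M M' y v - μ y * ∑ u, pushProd θ M M' u v =
      ∑ w, M' w v * (ν w ᵥ* M) y := by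
    intro y v
    have h2 : ∑ u, pushProd θ M M' u v = ∑ w, M' w v * ∑ x, θ x w := by
      simp only [pushProd]
      rw [Finset.sum_comm]
      refine Finset.sum_congr rfl fun w _ => ?_
      rw [Finset.sum_comm, Finset.mul_sum]
      refine Finset.sum_congr rfl fun x _ => ?_
      rw [← Finset.mul_sum, ← Finset.sum_mul, hM1]; ring
    have h3 : ∀ w, (ν w ᵥ* M) y = ∑ x, θ x w * M x y - μ y * ∑ u, θ u w := by
      intro w
      conv_rhs => rw [← hμM]
      simp only [hν, Matrix.vecMul, dotProduct, sub_mul, Finset.sum_sub_distrib]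
      congr 1
      rw [Finset.sum_mul]
      exact Finset.sum_congr rfl fun x _ => by ring
    rw [h2, Finset.mul_sum]
    simp only [pushProd]
    rw [← Finset.sum_sub_distrib]
    refine Finset.sum_congr rfl fun w _ => ?_
    have h4 : ∑ x, θ x w * (M x y * M' w v) = M' w v * ∑ x, θ x w * M x y := by
      rw [Finset.mul_sum]
      exact Finset.sum_congr rfl fun x _ => by ring
    rw [h3, h4]
    ring
  simp only [dependence, h1]
  calc ∑ v, ∑ y, |∑ w, M' w v * (ν w ᵥ* M) y|
      ≤ ∑ v, ∑ y, ∑ w, M' w v * |(ν w ᵥ* M) y| := by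
        refine Finset.sum_le_sum fun v _ => Finset.sum_le_sum fun y _ =>
          (Finset.abs_sum_le_sum_abs _ _).trans (le_of_eq ?_)
        exact Finset.sum_congr rfl fun w _ => by rw [abs_mul, abs_of_nonneg (hM' w v)]
    _ = ∑ w, (∑ v, M' w v) * ∑ y, |(ν w ᵥ* M) y| := by
        have : ∀ v, ∑ y, ∑ w, M' w v * |(ν w ᵥ* M) y| = ∑ w, M' w v * ∑ y, |(ν w ᵥ* M) y| := by
          intro v
          rw [Finset.sum_comm]
          simp only [Finset.mul_sum]
        simp only [this]
        rw [Finset.sum_comm]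
        simp only [Finset.sum_mul]
    _ ≤ ∑ w, (∑ v, M' w v) * (q * ∑ x, |ν w x|) := by
        refine Finset.sum_le_sum fun w _ => ?_
        exact mul_le_mul_of_nonneg_left (hq (ν w) (hν0 w)) (Finset.sum_nonneg fun v _ => hM' w v)
    _ = _ := by
        rw [Finset.mul_sum]
        exact Finset.sum_congr rfl fun w _ => by ring

/-- Let one coordinate and the others be stopped when the later of two independent times is
reached: `P t`, `Q t` describe the coordinate and `P' t`, `Q' t` the others on the event that
their time has been reached before, respectively by, time `t`, and `M t` describes the coordinate
without this restriction. Where the others stop, the coordinate has been moved by `M t`, which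
contracts its dependence; the correction is at most twice the probability that the coordinate
stops strictly later than the others, counted once for the mass that is missing and once for the
mass that comes in its place. -/
lemma dependence_stopped_le {μ : X → ℝ} (hμ0 : ∀ x, 0 ≤ μ x) (hμ1 : ∑ x, μ x = 1) {N : ℕ}
    {M : ℕ → Matrix X X ℝ} {P Q : ℕ → X → X → ℝ} {P' Q' : ℕ → W → W → ℝ} {q : ℝ} (hq0 : 0 ≤ q)
    (hM1 : ∀ t x, ∑ y, M t x y = 1) (hμM : ∀ t, μ ᵥ* M t = μ)
    (hq : ∀ t, Q' t = P' t ∨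
      ∀ ν : X → ℝ, ∑ x, ν x = 0 → ∑ y, |(ν ᵥ* M t) y| ≤ q * ∑ x, |ν x|)
    (hPQ : ∀ t x y, P t x y ≤ Q t x y) (hQM : ∀ t x y, Q t x y ≤ M t x y)
    (hP' : ∀ t w v, 0 ≤ P' t w v) (hPQ' : ∀ t w v, P' t w v ≤ Q' t w v)
    (hsum : ∀ w, ∑ t ∈ Finset.range N, ∑ v, (Q' t w v - P' t w v) ≤ 1)
    {θ : X → W → ℝ} (hθ : ∀ x w, 0 ≤ θ x w) :
    dependence μ (fun y v => ∑ t ∈ Finset.range N,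
        (pushProd θ (Q t) (Q' t) y v - pushProd θ (P t) (P' t) y v)) ≤
      q * dependence μ θ + 2 * ∑ w, ∑ x, θ x w * ∑ t ∈ Finset.range N,
        ((1 - ∑ y, Q t x y) * (∑ v, Q' t w v - ∑ v, P' t w v) +
          (∑ y, Q t x y - ∑ y, P t x y) * ∑ v, P' t w v) := by
  -- `Q ⊗ Q' - P ⊗ P' = M ⊗ (Q' - P') - (M - Q) ⊗ (Q' - P') + (Q - P) ⊗ P'`
  have hdec : ∀ t y v, pushProd θ (Q t) (Q' t) y v - pushProd θ (P t) (P' t) y v =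
      pushProd θ (M t) (fun w v => Q' t w v - P' t w v) y v +
      (-pushProd θ (fun x y => M t x y - Q t x y) (fun w v => Q' t w v - P' t w v) y v +
      pushProd θ (fun x y => Q t x y - P t x y) (P' t) y v) := by
    intro t y v
    simp only [pushProd, ← Finset.sum_neg_distrib, ← Finset.sum_add_distrib,
      ← Finset.sum_sub_distrib]
    exact Finset.sum_congr rfl fun w _ => Finset.sum_congr rfl fun x _ => by ring
  simp only [hdec, Finset.sum_add_distrib (s := Finset.range N)]
  refine (dependence_add_le μ _ _).trans (add_le_add ?_ ((dependence_add_le μ _ _).trans ?_))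
  · refine (dependence_sum_le _ μ _).trans ?_
    have h1 : ∀ t, dependence μ (pushProd θ (M t) fun w v => Q' t w v - P' t w v) ≤
        q * ∑ w, (∑ v, (Q' t w v - P' t w v)) * ∑ x, |θ x w - μ x * ∑ u, θ u w| := by
      intro t
      rcases hq t with h | h
      · rw [h]
        have : pushProd θ (M t) (fun w v => P' t w v - P' t w v) = fun _ _ => 0 := by
          ext y v
          simp [pushProd]
        rw [this]
        simp [dependence]
      · exact dependence_pushProd_le hμ1 (hM1 t) (hμM t) h
          (fun w v => sub_nonneg.2 (hPQ' t w v)) θ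
    refine (Finset.sum_le_sum fun t _ => h1 t).trans ?_
    rw [← Finset.mul_sum, dependence]
    refine mul_le_mul_of_nonneg_left ?_ hq0
    rw [Finset.sum_comm]
    refine Finset.sum_le_sum fun w _ => ?_
    rw [← Finset.sum_mul]
    exact mul_le_of_le_one_left (Finset.sum_nonneg fun _ _ => abs_nonneg _) (hsum w)
  · have h2 : ∀ t, dependence μ (fun y v =>
        -pushProd θ (fun x y => M t x y - Q t x y) (fun w v => Q' t w v - P' t w v) y v) ≤
        2 * ∑ w, ∑ x, θ x w * ((1 - ∑ y, Q t x y) * (∑ v, Q' t w v - ∑ v, P' t w v)) := by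
      intro t
      rw [dependence_neg]
      refine (dependence_le_of_nonneg hμ0 hμ1 (pushProd_nonneg hθ
        (fun x y => sub_nonneg.2 (hQM t x y)) fun w v => sub_nonneg.2 (hPQ' t w v))).trans ?_
      rw [sum_pushProd]
      simp only [Finset.sum_sub_distrib, hM1, le_refl]
    have h3 : ∀ t, dependence μ (pushProd θ (fun x y => Q t x y - P t x y) (P' t)) ≤
        2 * ∑ w, ∑ x, θ x w * ((∑ y, Q t x y - ∑ y, P t x y) * ∑ v, P' t w v) := by
      intro t
      refine (dependence_le_of_nonneg hμ0 hμ1 (pushProd_nonneg hθ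
        (fun x y => sub_nonneg.2 (hPQ t x y)) (hP' t))).trans ?_
      rw [sum_pushProd]
      simp only [Finset.sum_sub_distrib, le_refl]
    refine (add_le_add ((dependence_sum_le _ μ _).trans (Finset.sum_le_sum fun t _ => h2 t))
      ((dependence_sum_le _ μ _).trans (Finset.sum_le_sum fun t _ => h3 t))).trans (le_of_eq ?_)
    rw [← Finset.mul_sum, ← Finset.mul_sum, ← mul_add, ← Finset.sum_add_distrib]
    congr 1
    simp only [← Finset.sum_add_distrib, ← mul_add]
    rw [Finset.sum_comm]
    refine Finset.sum_congr rfl fun w _ => ?_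
    rw [Finset.sum_comm]
    simp only [Finset.mul_sum]

end Dependence

/-- The difference of the products is at least the sum of its terms of first order. -/
lemma prod_sub_prod_ge {ι : Type*} [DecidableEq ι] (s : Finset ι) {x y : ι → ℝ}
    (hy : ∀ i, 0 ≤ y i) (hxy : ∀ i, y i ≤ x i) :
    ∑ j ∈ s, (x j - y j) * ∏ i ∈ s.erase j, y i ≤ ∏ i ∈ s, x i - ∏ i ∈ s, y i := by
  induction s using Finset.induction_on with
  | empty => simp
  | insert a s ha ih =>
    rw [Finset.sum_insert ha, Finset.prod_insert ha, Finset.prod_insert ha,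
      Finset.erase_insert ha]
    have h1 : ∑ j ∈ s, (x j - y j) * ∏ i ∈ (insert a s).erase j, y i =
        y a * ∑ j ∈ s, (x j - y j) * ∏ i ∈ s.erase j, y i := by
      rw [Finset.mul_sum]
      refine Finset.sum_congr rfl fun j hj => ?_
      have hja : j ≠ a := fun h => ha (h ▸ hj)
      rw [Finset.erase_insert_of_ne hja.symm, Finset.prod_insert (by simp [ha])]
      ring
    rw [h1]
    have h2 : ∏ i ∈ s, y i ≤ ∏ i ∈ s, x i :=
      Finset.prod_le_prod (fun i _ => hy i) fun i _ => hxy i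
    nlinarith [mul_le_mul_of_nonneg_left ih (hy a), hxy a,
      mul_le_mul_of_nonneg_left h2 (sub_nonneg.2 (hxy a))]

/-- Let independent times have the distribution functions `g i`. The probability that there is a
last one, strictly after all others, is at most one. It is counted here in two ways: according to
the time of the last of the others, and according to the time of the very last one. -/
lemma sum_unique_last_le {ι : Type*} [Fintype ι] [DecidableEq ι] {g : ι → ℕ → ℝ}
    (h0 : ∀ i t, 0 ≤ g i t) (h1 : ∀ i t, g i t ≤ 1) (hmono : ∀ i t, g i t ≤ g i (t + 1)) (N : ℕ) :
    ∑ j, ∑ t ∈ Finset.range N, ((1 - g j (t + 1)) *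
        (∏ i ∈ Finset.univ.erase j, g i (t + 1) - ∏ i ∈ Finset.univ.erase j, g i t) +
      (g j (t + 1) - g j t) * ∏ i ∈ Finset.univ.erase j, g i t) ≤ 2 := by
  rw [Finset.sum_comm]
  set F : ℕ → ℝ := fun t => ∏ i, g i t with hF
  -- if the times are `≤ t` with probabilities `g i t`, then `F t` is the probability that all are,
  -- and `E t` the probability that all but at most one are
  set E : ℕ → ℝ := fun t => F t + ∑ j, (1 - g j t) * ∏ i ∈ Finset.univ.erase j, g i t with hE
  have hF0 : ∀ t, 0 ≤ F t := fun t => Finset.prod_nonneg fun i _ => h0 i t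
  have hF1 : ∀ t, F t ≤ 1 := fun t => Finset.prod_le_one (fun i _ => h0 i t) fun i _ => h1 i t
  have hE0 : ∀ t, 0 ≤ E t := fun t => add_nonneg (hF0 t) <| Finset.sum_nonneg fun j _ =>
    mul_nonneg (sub_nonneg.2 (h1 j t)) (Finset.prod_nonneg fun i _ => h0 i t)
  have hE1 : ∀ t, E t ≤ 1 := fun t => by
    have := prod_sub_prod_ge Finset.univ (x := fun _ => 1) (fun i => h0 i t) fun i => h1 i t
    simp only [Finset.prod_const_one] at this
    simp only [hE, hF]
    linarith
  have hinc : ∀ t, ∑ j, (g j (t + 1) - g j t) * ∏ i ∈ Finset.univ.erase j, g i t ≤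
      F (t + 1) - F t := fun t =>
    prod_sub_prod_ge Finset.univ (fun i => h0 i t) fun i => hmono i t
  have hstep : ∀ t, ∑ j, ((1 - g j (t + 1)) *
        (∏ i ∈ Finset.univ.erase j, g i (t + 1) - ∏ i ∈ Finset.univ.erase j, g i t) +
      (g j (t + 1) - g j t) * ∏ i ∈ Finset.univ.erase j, g i t) ≤
      (E (t + 1) - E t) + (F (t + 1) - F t) := by
    intro t
    rw [Finset.sum_add_distrib]
    refine add_le_add ?_ (hinc t)
    have h3 := hinc t
    have h4 : ∑ j, (1 - g j (t + 1)) *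
        (∏ i ∈ Finset.univ.erase j, g i (t + 1) - ∏ i ∈ Finset.univ.erase j, g i t) =
        (E (t + 1) - E t) - (F (t + 1) - F t) +
        ∑ j, (g j (t + 1) - g j t) * ∏ i ∈ Finset.univ.erase j, g i t := by
      have : (E (t + 1) - E t) - (F (t + 1) - F t) =
          ∑ j, (1 - g j (t + 1)) * ∏ i ∈ Finset.univ.erase j, g i (t + 1) -
          ∑ j, (1 - g j t) * ∏ i ∈ Finset.univ.erase j, g i t := by
        simp only [hE]; ring
      rw [this, ← Finset.sum_sub_distrib, ← Finset.sum_add_distrib]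
      exact Finset.sum_congr rfl fun j _ => by ring
    linarith
  refine (Finset.sum_le_sum fun t _ => hstep t).trans ?_
  rw [Finset.sum_add_distrib, Finset.sum_range_sub, Finset.sum_range_sub]
  linarith [hE1 N, hE0 0, hF1 N, hF0 0]

/-! ### Test functions in a coordinate moved by a contracting kernel -/

section Dependence

open Matrix

variable {X W : Type*} [Fintype X] [DecidableEq X] [Fintype W]

/-- Subtracting the constant `1 / 2` from `c` does not change the sum. -/
lemma abs_sum_mul_le_half {m c : X → ℝ} (hm : ∑ y, m y = 0) (h0 : ∀ y, 0 ≤ c y)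
    (h1 : ∀ y, c y ≤ 1) : |∑ y, m y * c y| ≤ 1 / 2 * ∑ y, |m y| := by
  have h : ∑ y, m y * c y = ∑ y, m y * (c y - 1 / 2) := by
    simp only [mul_sub, Finset.sum_sub_distrib, ← Finset.sum_mul, hm]
    ring
  rw [h, Finset.mul_sum]
  refine (Finset.abs_sum_le_sum_abs _ _).trans (Finset.sum_le_sum fun y _ => ?_)
  rw [abs_mul, mul_comm]
  refine mul_le_mul_of_nonneg_right ?_ (abs_nonneg _)
  rw [abs_le]
  constructor <;> linarith [h0 y, h1 y]

/-- The error made by evaluating a `[0, 1]`-valued function in a coordinate that was moved by a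
contracting kernel up to a random time, instead of in an independent stationary coordinate. -/
lemma abs_sum_moved_sub_le {μ : X → ℝ} (hμ1 : ∑ x, μ x = 1) {N : ℕ} {M : ℕ → Matrix X X ℝ}
    {q : ℝ} (hq0 : 0 ≤ q) (hM1 : ∀ t x, ∑ y, M t x y = 1) (hμM : ∀ t, μ ᵥ* M t = μ)
    {f : ℕ → W → ℝ} (hf0 : ∀ t w, 0 ≤ f t w) (hf1 : ∀ w, ∑ t ∈ Finset.range N, f t w ≤ 1)
    (hq : ∀ t, (∀ w, f t w = 0) ∨
      ∀ ν : X → ℝ, ∑ x, ν x = 0 → ∑ y, |(ν ᵥ* M t) y| ≤ q * ∑ x, |ν x|)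
    {c : ℕ → W → X → ℝ} (hc0 : ∀ t w y, 0 ≤ c t w y) (hc1 : ∀ t w y, c t w y ≤ 1)
    (θ : X → W → ℝ) :
    |∑ w, ∑ x, θ x w * ∑ t ∈ Finset.range N, f t w * ∑ y, (M t x y - μ y) * c t w y| ≤
      q / 2 * dependence μ θ := by
  set ν : W → X → ℝ := fun w x => θ x w - μ x * ∑ u, θ u w with hν
  have hν0 : ∀ w, ∑ x, ν w x = 0 := fun w => by
    simp only [hν, Finset.sum_sub_distrib, ← Finset.sum_mul, hμ1]; ring
  have h3 : ∀ t w y, (ν w ᵥ* M t) y = ∑ x, θ x w * (M t x y - μ y) := by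
    intro t w y
    have h4 : ∑ x, μ x * M t x y = μ y := by
      conv_rhs => rw [← hμM t]
      rfl
    simp only [hν, Matrix.vecMul, dotProduct, sub_mul, mul_sub, Finset.sum_sub_distrib]
    congr 1
    rw [← Finset.sum_mul]
    conv_rhs => rw [← h4, Finset.mul_sum]
    exact Finset.sum_congr rfl fun x _ => by ring
  have h5 : ∑ w, ∑ x, θ x w * ∑ t ∈ Finset.range N, f t w * ∑ y, (M t x y - μ y) * c t w y =
      ∑ w, ∑ t ∈ Finset.range N, f t w * ∑ y, (ν w ᵥ* M t) y * c t w y := by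
    refine Finset.sum_congr rfl fun w _ => ?_
    simp only [Finset.mul_sum]
    rw [Finset.sum_comm]
    refine Finset.sum_congr rfl fun t _ => ?_
    rw [Finset.sum_comm]
    refine Finset.sum_congr rfl fun y _ => ?_
    rw [h3, Finset.sum_mul, Finset.mul_sum]
    exact Finset.sum_congr rfl fun x _ => by ring
  rw [h5, dependence, Finset.mul_sum]
  refine (Finset.abs_sum_le_sum_abs _ _).trans (Finset.sum_le_sum fun w _ => ?_)
  have hA : 0 ≤ ∑ x, |ν w x| := Finset.sum_nonneg fun _ _ => abs_nonneg _
  calc |∑ t ∈ Finset.range N, f t w * ∑ y, (ν w ᵥ* M t) y * c t w y|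
      ≤ ∑ t ∈ Finset.range N, f t w * (q / 2 * ∑ x, |ν w x|) := by
        refine (Finset.abs_sum_le_sum_abs _ _).trans (Finset.sum_le_sum fun t _ => ?_)
        rw [abs_mul, abs_of_nonneg (hf0 t w)]
        rcases hq t with h | h
        · simp [h w]
        · refine mul_le_mul_of_nonneg_left ?_ (hf0 t w)
          have h6 := abs_sum_mul_le_half (m := ν w ᵥ* M t) (c := c t w)
            (by rw [sum_vecMul_of_row_sum (hM1 t), hν0]) (hc0 t w) (hc1 t w)
          have h7 := h (ν w) (hν0 w)
          linarith
    _ = (∑ t ∈ Finset.range N, f t w) * (q / 2 * ∑ x, |ν w x|) := by rw [Finset.sum_mul]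
    _ ≤ 1 * (q / 2 * ∑ x, |ν w x|) :=
        mul_le_mul_of_nonneg_right (hf1 w) (mul_nonneg (by linarith) hA)
    _ = _ := by rw [one_mul]

end Dependence

/-! ### The joint law of the end of a batch -/

section Joint

open Matrix

variable {ι : Type*} [Fintype ι] [DecidableEq ι] {S : ι → Type*}
  [∀ i, Fintype (S i)] [∀ i, DecidableEq (S i)]

lemma sum_prod_pi {X : ι → Type*} [∀ i, Fintype (X i)] (f : ∀ i, X i → ℝ) :
    ∑ x : ∀ i, X i, ∏ i, f i (x i) = ∏ i, ∑ u, f i u := by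
  rw [Finset.prod_univ_sum, Fintype.piFinset_univ]

/-- A point of the product given by its coordinate `j` and the other coordinates. -/
def combine (j : ι) (x : S j) (w : ∀ i : {i // i ≠ j}, S i) : ∀ i, S i :=
  (Equiv.piSplitAt j S).symm (x, w)

@[simp] lemma combine_self (j : ι) (x : S j) (w : ∀ i : {i // i ≠ j}, S i) :
    combine j x w j = x := by simp [combine, Equiv.piSplitAt]

lemma combine_of_ne {j i : ι} (h : i ≠ j) (x : S j) (w : ∀ i : {i // i ≠ j}, S i) :
    combine j x w i = w ⟨i, h⟩ := by simp [combine, Equiv.piSplitAt, h]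

lemma sum_combine (j : ι) (F : (∀ i, S i) → ℝ) :
    ∑ x, F x = ∑ w, ∑ x, F (combine j x w) := by
  rw [← Equiv.sum_comp (Equiv.piSplitAt j S).symm F, Fintype.sum_prod_type_right]
  rfl

lemma prod_combine (j : ι) (f : ∀ i, S i → S i → ℝ) (x y : S j)
    (w v : ∀ i : {i // i ≠ j}, S i) :
    ∏ i, f i (combine j x w i) (combine j y v i) =
      f j x y * ∏ i : {i // i ≠ j}, f i (w i) (v i) := by
  rw [Fintype.prod_eq_mul_prod_subtype_ne _ j]
  simp only [combine_self]
  congr 1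
  exact Finset.prod_congr rfl fun i _ => by rw [combine_of_ne i.2, combine_of_ne i.2]

/-- The `ℓ¹`-distance of a joint law from the one with an independent coordinate `j` of law `μ`. -/
def dependenceOn (j : ι) (μ : S j → ℝ) (θ : (∀ i, S i) → ℝ) : ℝ :=
  dependence μ fun x w => θ (combine j x w)

/-- The probability that the batch ends `t + 1` time instances after the end of the previous batch,
in the joint state `y`. The players are independent, and the batch ends when all of them are
done. -/
def batchEndAt (K : ∀ i, Matrix (S i) (S i) ℝ) (d : ℕ) (κ : ∀ i, S i → ℝ) (t : ℕ)
    (y : ∀ i, S i) : ℝ :=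
  ∏ i, departureLaw (K i) d (κ i) t ∅ (y i) - ∏ i, arrivalLaw (K i) d (κ i) t ∅ (y i)

/-- The probability that the batch ends in the joint state `y`. -/
def batchEnd (K : ∀ i, Matrix (S i) (S i) ℝ) (d : ℕ) (κ : ∀ i, S i → ℝ) (y : ∀ i, S i) : ℝ :=
  ∑' t, batchEndAt K d κ t y

variable {K : ∀ i, Matrix (S i) (S i) ℝ} {d : ℕ} {κ : ∀ i, S i → ℝ} {c : ℝ}

lemma batchEndAt_nonneg (hK : ∀ i, IsContractingChain (K i) c) (hκ : ∀ i x, 0 ≤ κ i x) (t : ℕ)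
    (y : ∀ i, S i) : 0 ≤ batchEndAt K d κ t y :=
  sub_nonneg.2 <| Finset.prod_le_prod
    (fun i _ => arrivalLaw_nonneg (hK i).nonneg (hκ i) t ∅ (y i))
    fun i _ => arrivalLaw_empty_le_departureLaw (hK i).nonneg (hκ i) t (y i)

lemma sum_batchEndAt (hK : ∀ i, IsContractingChain (K i) c) (t : ℕ) :
    ∑ y, batchEndAt K d κ t y =
      ∏ i, coverProb (K i) d (κ i) (t + 1) - ∏ i, coverProb (K i) d (κ i) t := by
  simp only [batchEndAt, Finset.sum_sub_distrib]
  rw [sum_prod_pi fun i y => departureLaw (K i) d (κ i) t ∅ y,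
    sum_prod_pi fun i y => arrivalLaw (K i) d (κ i) t ∅ y]
  simp only [sum_departureLaw_empty (hK _).row_sum]
  rfl

lemma sum_range_sum_batchEndAt [Nonempty ι] [∀ i, Nonempty (S i)]
    (hK : ∀ i, IsContractingChain (K i) c) (N : ℕ) :
    ∑ t ∈ Finset.range N, ∑ y, batchEndAt K d κ t y = ∏ i, coverProb (K i) d (κ i) N := by
  simp only [sum_batchEndAt hK]
  rw [Finset.sum_range_sub fun t => ∏ i, coverProb (K i) d (κ i) t]
  simp [coverProb_zero]

lemma summable_batchEndAt [Nonempty ι] [∀ i, Nonempty (S i)]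
    (hK : ∀ i, IsContractingChain (K i) c)
    (hκ0 : ∀ i x, 0 ≤ κ i x) (hκ : ∀ i, ∑ x, κ i x = 1) (y : ∀ i, S i) :
    Summable fun t => batchEndAt K d κ t y := by
  refine summable_of_sum_range_le (c := 1) (fun t => batchEndAt_nonneg hK hκ0 t y) fun N => ?_
  calc ∑ t ∈ Finset.range N, batchEndAt K d κ t y
      ≤ ∑ t ∈ Finset.range N, ∑ y, batchEndAt K d κ t y :=
        Finset.sum_le_sum fun t _ => Finset.single_le_sum
          (fun y _ => batchEndAt_nonneg hK hκ0 t y) (Finset.mem_univ y)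
    _ = ∏ i, coverProb (K i) d (κ i) N := sum_range_sum_batchEndAt hK N
    _ ≤ 1 := Finset.prod_le_one
        (fun i _ => coverProb_nonneg (hK i).nonneg (hκ0 i) N)
        fun i _ => coverProb_le_one (hK i).nonneg (hK i).row_sum (hκ0 i) (hκ i) N

lemma batchEnd_nonneg (hK : ∀ i, IsContractingChain (K i) c) (hκ0 : ∀ i x, 0 ≤ κ i x)
    (y : ∀ i, S i) : 0 ≤ batchEnd K d κ y :=
  tsum_nonneg fun t => batchEndAt_nonneg hK hκ0 t y

lemma tendsto_prod_coverProb [∀ i, Nonempty (S i)] (hK : ∀ i, IsContractingChain (K i) c)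
    (hprim : ∀ i, (K i).IsPrimitive) (hκ0 : ∀ i x, 0 ≤ κ i x) (hκ : ∀ i, ∑ x, κ i x = 1) :
    Tendsto (fun N => ∏ i, coverProb (K i) d (κ i) N) atTop (𝓝 1) := by
  simpa using tendsto_finsetProd Finset.univ fun i _ =>
    tendsto_coverProb (d := d) (hK i).row_sum (hprim i) (hκ0 i) (hκ i)

lemma tendsto_sum_batchEndAt [Nonempty ι] [∀ i, Nonempty (S i)]
    (hK : ∀ i, IsContractingChain (K i) c)
    (hκ0 : ∀ i x, 0 ≤ κ i x) (hκ : ∀ i, ∑ x, κ i x = 1) (y : ∀ i, S i) :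
    Tendsto (fun N => ∑ t ∈ Finset.range N, batchEndAt K d κ t y) atTop
      (𝓝 (batchEnd K d κ y)) :=
  (summable_batchEndAt hK hκ0 hκ y).hasSum.tendsto_sum_nat

lemma sum_batchEnd [Nonempty ι] [∀ i, Nonempty (S i)] (hK : ∀ i, IsContractingChain (K i) c)
    (hprim : ∀ i, (K i).IsPrimitive) (hκ0 : ∀ i x, 0 ≤ κ i x) (hκ : ∀ i, ∑ x, κ i x = 1) :
    ∑ y, batchEnd K d κ y = 1 := by
  refine tendsto_nhds_unique (tendsto_finsetSum Finset.univ fun y _ =>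
    tendsto_sum_batchEndAt (d := d) hK hκ0 hκ y) ?_
  refine (tendsto_prod_coverProb (d := d) hK hprim hκ0 hκ).congr fun N => ?_
  rw [← sum_range_sum_batchEndAt hK, Finset.sum_comm]

/-- The bound of `sum_dependenceOn_le` for batches that last at most `N` time instances. -/
lemma sum_dependenceOn_truncated_le [∀ i, Nonempty (S i)]
    (hK : ∀ i, IsContractingChain (K i) c) (hc0 : 0 ≤ c)
    (hc1 : c ≤ 1) {μ : ∀ i, S i → ℝ} (hμ0 : ∀ i x, 0 ≤ μ i x) (hμ1 : ∀ i, ∑ x, μ i x = 1)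
    (hμ : ∀ i, μ i ᵥ* K i = μ i) {θ : (∀ i, S i) → ℝ} (hθ : ∀ x, 0 ≤ θ x) (N : ℕ) :
    ∑ j, dependenceOn j (μ j) (fun y => ∑ x, θ x *
        ∑ t ∈ Finset.range N, batchEndAt K d (fun i => K i (x i)) t y) ≤
      c ^ d * ∑ j, dependenceOn j (μ j) θ + 4 * ∑ x, θ x := by
  set Q : ∀ i, ℕ → S i → S i → ℝ := fun i t x y => departureLaw (K i) d (K i x) t ∅ y with hQ
  set P : ∀ i, ℕ → S i → S i → ℝ := fun i t x y => arrivalLaw (K i) d (K i x) t ∅ y with hP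
  have hκ0 : ∀ i x y, 0 ≤ K i x y := fun i => (hK i).nonneg
  have hκ1 : ∀ i x, ∑ y, K i x y = 1 := fun i => (hK i).row_sum
  have hP0 : ∀ i t x y, 0 ≤ P i t x y := fun i t x y =>
    arrivalLaw_nonneg (hκ0 i) (hκ0 i x) t ∅ y
  have hPQ : ∀ i t x y, P i t x y ≤ Q i t x y := fun i t x y =>
    arrivalLaw_empty_le_departureLaw (hκ0 i) (hκ0 i x) t y
  have hPsum : ∀ i t x, ∑ y, P i t x y = coverProb (K i) d (K i x) t := fun i t x => rfl
  have hQsum : ∀ i t x, ∑ y, Q i t x y = coverProb (K i) d (K i x) (t + 1) := fun i t x =>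
    sum_departureLaw_empty (hκ1 i) t
  have hg0 : ∀ i x t, 0 ≤ coverProb (K i) d (K i x) t := fun i x t =>
    coverProb_nonneg (hκ0 i) (hκ0 i x) t
  have hg1 : ∀ i x t, coverProb (K i) d (K i x) t ≤ 1 := fun i x t =>
    coverProb_le_one (hκ0 i) (hκ1 i) (hκ0 i x) (hκ1 i x) t
  have hmono : ∀ i x t, coverProb (K i) d (K i x) t ≤ coverProb (K i) d (K i x) (t + 1) :=
    fun i x t => coverProb_le_succ (hκ0 i) (hκ1 i) (hκ0 i x) t
  have hpow : ∀ i t (x y : S i), (K i x ᵥ* K i ^ t) y = (K i ^ (t + 1)) x y := by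
    intro i t x y
    rw [pow_succ', Matrix.mul_apply]
    rfl
  have key : ∀ j, dependenceOn j (μ j) (fun y => ∑ x, θ x *
        ∑ t ∈ Finset.range N, batchEndAt K d (fun i => K i (x i)) t y) ≤
      c ^ d * dependenceOn j (μ j) θ + 2 * ∑ x, θ x * ∑ t ∈ Finset.range N,
        ((1 - coverProb (K j) d (K j (x j)) (t + 1)) *
          (∏ i ∈ Finset.univ.erase j, coverProb (K i) d (K i (x i)) (t + 1) -
            ∏ i ∈ Finset.univ.erase j, coverProb (K i) d (K i (x i)) t) +
        (coverProb (K j) d (K j (x j)) (t + 1) - coverProb (K j) d (K j (x j)) t) *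
          ∏ i ∈ Finset.univ.erase j, coverProb (K i) d (K i (x i)) t) := by
    intro j
    set Q' : ℕ → (∀ i : {i // i ≠ j}, S i) → (∀ i : {i // i ≠ j}, S i) → ℝ :=
      fun t w v => ∏ i : {i // i ≠ j}, Q i t (w i) (v i) with hQ'
    set P' : ℕ → (∀ i : {i // i ≠ j}, S i) → (∀ i : {i // i ≠ j}, S i) → ℝ :=
      fun t w v => ∏ i : {i // i ≠ j}, P i t (w i) (v i) with hP'
    have hQ's : ∀ t w, ∑ v, Q' t w v = ∏ i : {i // i ≠ j},
        coverProb (K i) d (K i (w i)) (t + 1) := by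
      intro t w
      rw [hQ', sum_prod_pi fun (i : {i // i ≠ j}) y => Q i t (w i) y]
      exact Finset.prod_congr rfl fun i _ => hQsum i t (w i)
    have hP's : ∀ t w, ∑ v, P' t w v = ∏ i : {i // i ≠ j}, coverProb (K i) d (K i (w i)) t := by
      intro t w
      rw [hP', sum_prod_pi fun (i : {i // i ≠ j}) y => P i t (w i) y]
      rfl
    have herase : ∀ (g : ι → ℝ), ∏ i ∈ Finset.univ.erase j, g i = ∏ i : {i // i ≠ j}, g i := by
      intro g
      rw [← Finset.prod_subtype (p := fun i => i ≠ j) (Finset.univ.erase j) (by simp) g]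
    have h := dependence_stopped_le (N := N) (μ := μ j) (M := fun t => K j ^ (t + 1)) (P := P j)
      (Q := Q j) (P' := P') (Q' := Q') (q := c ^ d) (hμ0 j) (hμ1 j) (pow_nonneg hc0 d)
      (fun t => (hK j).pow_row_sum (t + 1))
      (fun t => IsContractingChain.vecMul_pow_of_fixed (hμ j) (t + 1)) (fun t => ?_)
      (hPQ j) (fun t x y => ?_)
      (fun t w v => Finset.prod_nonneg fun i _ => hP0 i t (w i) (v i))
      (fun t w v => Finset.prod_le_prod (fun i _ => hP0 i t (w i) (v i))
        fun i _ => hPQ i t (w i) (v i))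
      (fun w => ?_) (θ := fun x w => θ (combine j x w)) (fun x w => hθ _)
    · have h1 : (fun (y : S j) (v : ∀ i : {i // i ≠ j}, S i) => ∑ x, θ x *
          ∑ t ∈ Finset.range N, batchEndAt K d (fun i => K i (x i)) t (combine j y v)) =
          fun y v => ∑ t ∈ Finset.range N,
            (pushProd (fun x w => θ (combine j x w)) (Q j t) (Q' t) y v -
              pushProd (fun x w => θ (combine j x w)) (P j t) (P' t) y v) := by
        ext y v
        rw [sum_combine j]
        simp only [pushProd, ← Finset.sum_sub_distrib]
        conv_rhs => rw [Finset.sum_comm]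
        refine Finset.sum_congr rfl fun w _ => ?_
        conv_rhs => rw [Finset.sum_comm]
        refine Finset.sum_congr rfl fun x _ => ?_
        rw [Finset.mul_sum]
        refine Finset.sum_congr rfl fun t _ => ?_
        have e1 := prod_combine j (fun i => Q i t) x y w v
        have e2 := prod_combine j (fun i => P i t) x y w v
        simp only [hQ] at e1
        simp only [hP] at e2
        rw [batchEndAt, e1, e2, mul_sub]
      rw [dependenceOn, h1]
      refine h.trans (le_of_eq ?_)
      rw [dependenceOn, sum_combine j]
      congr 2
      refine Finset.sum_congr rfl fun w _ => Finset.sum_congr rfl fun x _ => ?_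
      congr 1
      refine Finset.sum_congr rfl fun t _ => ?_
      have e3 : ∀ t, ∏ i : {i // i ≠ j}, coverProb (K i) d (K i (combine j x w i)) t =
          ∏ i : {i // i ≠ j}, coverProb (K i) d (K i (w i)) t := fun t =>
        Finset.prod_congr rfl fun i _ => by rw [combine_of_ne i.2]
      rw [hQ's, hP's, hQsum, hPsum, herase, herase, combine_self, e3, e3]
    -- before the sampling begins no batch ends; from then on `K j ^ (t + 1)` contracts by `c ^ d`
    · by_cases ht : d ≤ t + 1
      · right
        intro ν hν
        refine ((hK j).contract_pow hc0 (t + 1) ν hν).trans ?_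
        exact mul_le_mul_of_nonneg_right (pow_le_pow_of_le_one hc0 hc1 ht)
          (Finset.sum_nonneg fun _ _ => abs_nonneg _)
      · left
        ext w v
        refine Finset.prod_congr rfl fun i _ => ?_
        simp only [hQ, hP]
        rw [departureLaw_empty_eq_zero (by omega), arrivalLaw_empty_eq_zero (by omega)]
    · rw [← hpow]
      exact departureLaw_le (hκ0 j) (hκ0 j x) t ∅ y
    · simp only [Finset.sum_sub_distrib, hQ's, hP's]
      rw [← Finset.sum_sub_distrib,
        Finset.sum_range_sub fun t => ∏ i : {i // i ≠ j}, coverProb (K i) d (K i (w i)) t]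
      have h2 : ∏ i : {i // i ≠ j}, coverProb (K i) d (K i (w i)) N ≤ 1 :=
        Finset.prod_le_one (fun i _ => hg0 i (w i) N) fun i _ => hg1 i (w i) N
      have h3 : 0 ≤ ∏ i : {i // i ≠ j}, coverProb (K i) d (K i (w i)) 0 :=
        Finset.prod_nonneg fun i _ => hg0 i (w i) 0
      linarith
  refine (Finset.sum_le_sum fun j _ => key j).trans ?_
  rw [Finset.sum_add_distrib, ← Finset.mul_sum, ← Finset.mul_sum]
  refine add_le_add le_rfl ?_
  rw [Finset.sum_comm]
  have h4 : ∀ x, ∑ j, θ x * ∑ t ∈ Finset.range N,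
        ((1 - coverProb (K j) d (K j (x j)) (t + 1)) *
          (∏ i ∈ Finset.univ.erase j, coverProb (K i) d (K i (x i)) (t + 1) -
            ∏ i ∈ Finset.univ.erase j, coverProb (K i) d (K i (x i)) t) +
        (coverProb (K j) d (K j (x j)) (t + 1) - coverProb (K j) d (K j (x j)) t) *
          ∏ i ∈ Finset.univ.erase j, coverProb (K i) d (K i (x i)) t) ≤ θ x * 2 := by
    intro x
    rw [← Finset.mul_sum]
    exact mul_le_mul_of_nonneg_left (sum_unique_last_le
      (g := fun i t => coverProb (K i) d (K i (x i)) t) (fun i t => hg0 i (x i) t)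
      (fun i t => hg1 i (x i) t) (fun i t => hmono i (x i) t) N) (hθ x)
  have h5 := Finset.sum_le_sum fun x (_ : x ∈ Finset.univ) => h4 x
  rw [← Finset.sum_mul] at h5
  linarith

lemma dependenceOn_nonneg (j : ι) (μ : S j → ℝ) (θ : (∀ i, S i) → ℝ) : 0 ≤ dependenceOn j μ θ :=
  dependence_nonneg _ _

lemma dependenceOn_le {j : ι} {μ : S j → ℝ} (hμ0 : ∀ x, 0 ≤ μ x) (hμ1 : ∑ x, μ x = 1)
    {θ : (∀ i, S i) → ℝ} (hθ : ∀ x, 0 ≤ θ x) : dependenceOn j μ θ ≤ 2 * ∑ x, θ x := by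
  rw [sum_combine j]
  exact dependence_le_of_nonneg hμ0 hμ1 fun _ _ => hθ _

lemma continuous_dependenceOn (j : ι) (μ : S j → ℝ) : Continuous (dependenceOn (S := S) j μ) := by
  unfold dependenceOn dependence
  fun_prop

/-- The dependence of the joint state on its coordinates contracts from the end of one batch to the
end of the next one, up to a term that does not grow with the number of players. -/
lemma sum_dependenceOn_le [Nonempty ι] [∀ i, Nonempty (S i)]
    (hK : ∀ i, IsContractingChain (K i) c) (hc0 : 0 ≤ c)
    (hc1 : c ≤ 1) {μ : ∀ i, S i → ℝ} (hμ0 : ∀ i x, 0 ≤ μ i x) (hμ1 : ∀ i, ∑ x, μ i x = 1)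
    (hμ : ∀ i, μ i ᵥ* K i = μ i) {θ : (∀ i, S i) → ℝ} (hθ : ∀ x, 0 ≤ θ x) :
    ∑ j, dependenceOn j (μ j) (fun y => ∑ x, θ x * batchEnd K d (fun i => K i (x i)) y) ≤
      c ^ d * ∑ j, dependenceOn j (μ j) θ + 4 * ∑ x, θ x := by
  refine le_of_tendsto' (f := fun N => ∑ j, dependenceOn j (μ j) (fun y => ∑ x, θ x *
      ∑ t ∈ Finset.range N, batchEndAt K d (fun i => K i (x i)) t y)) (x := atTop)
    (tendsto_finsetSum Finset.univ fun j _ => ?_)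
    fun N => sum_dependenceOn_truncated_le hK hc0 hc1 hμ0 hμ1 hμ hθ N
  refine ((continuous_dependenceOn j (μ j)).tendsto _).comp (tendsto_pi_nhds.2 fun y => ?_)
  exact tendsto_finsetSum Finset.univ fun x _ => (tendsto_sum_batchEndAt hK
    (fun i => (hK i).nonneg (x i)) (fun i => (hK i).row_sum (x i)) y).const_mul (θ x)

end Joint

/-! ### Linearity of the sampling laws in the initial law -/

section Linear

variable {X B : Type*} [Fintype X] [DecidableEq X] [Fintype B]

lemma arrivalLaw_sum_mul (K : Matrix X X ℝ) (d : ℕ) (w : B → ℝ) (κ : B → X → ℝ) (t : ℕ)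
    (V : Finset X) (y : X) : arrivalLaw K d (fun x => ∑ b, w b * κ b x) t V y =
      ∑ b, w b * arrivalLaw K d (κ b) t V y := by
  induction t generalizing V y with
  | zero => simp only [arrivalLaw]; split_ifs <;> simp
  | succ t ih =>
    simp only [arrivalLaw, ih]
    simp only [Finset.mul_sum, Finset.sum_mul]
    conv_rhs => rw [Finset.sum_comm]
    refine Finset.sum_congr rfl fun x _ => ?_
    conv_rhs => rw [Finset.sum_comm]
    refine Finset.sum_congr rfl fun W _ => ?_
    split_ifs
    · rw [Finset.sum_mul]
      exact Finset.sum_congr rfl fun b _ => by ring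
    · simp

lemma departureLaw_sum_mul (K : Matrix X X ℝ) (d : ℕ) (w : B → ℝ) (κ : B → X → ℝ) (t : ℕ)
    (V : Finset X) (y : X) : departureLaw K d (fun x => ∑ b, w b * κ b x) t V y =
      ∑ b, w b * departureLaw K d (κ b) t V y := by
  simp only [departureLaw, arrivalLaw_sum_mul, Finset.mul_sum]
  rw [Finset.sum_comm]
  refine Finset.sum_congr rfl fun W _ => ?_
  split_ifs <;> simp

lemma firstVisitProb_sum_mul (K : Matrix X X ℝ) (d : ℕ) (w : B → ℝ) (κ : B → X → ℝ) (s : X)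
    (t : ℕ) : firstVisitProb K d (fun x => ∑ b, w b * κ b x) s t =
      ∑ b, w b * firstVisitProb K d (κ b) s t := by
  simp only [firstVisitProb, arrivalLaw_sum_mul]
  split_ifs
  · simp only [Finset.mul_sum]
    rw [Finset.sum_comm]
  · simp

end Linear

/-! ### Expected rewards under independent laws -/

section AvgValue

variable {ι : Type*} [Fintype ι] [DecidableEq ι] {S A : ι → Type*}
  [∀ i, Fintype (S i)] [∀ i, DecidableEq (S i)]
  [∀ i, Fintype (A i)] [∀ i, DecidableEq (A i)]

/-- Joint steps as families of state-action pairs of the players. -/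
def jointStepEquiv : JointStep S A ≃ ∀ i, S i × A i where
  toFun z i := (z.1 i, z.2 i)
  invFun u := (fun i => (u i).1, fun i => (u i).2)
  left_inv _ := rfl
  right_inv _ := rfl

/-- The joint step with joint state `x` and joint action `a`. -/
def JointStep.mk (x : ∀ i, S i) (a : ∀ i, A i) : JointStep S A := (x, a)

/-- The expectation of `r` when the state-action pairs of the players are independent with the
laws `lam i`. -/
def avgValue (r : JointStep S A → ℝ) (lam : ∀ i, S i × A i → ℝ) : ℝ :=
  ∑ z : JointStep S A, r z * ∏ i, lam i (z.1 i, z.2 i)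

lemma sum_jointStep_prod (f : ∀ i, S i × A i → ℝ) :
    ∑ z : JointStep S A, ∏ i, f i (z.1 i, z.2 i) = ∏ i, ∑ u, f i u := by
  rw [← sum_prod_pi f, ← Equiv.sum_comp jointStepEquiv]
  rfl

lemma sum_jointStep (f : JointStep S A → ℝ) :
    ∑ z : JointStep S A, f z = ∑ x : ∀ i, S i, ∑ a : ∀ i, A i, f (JointStep.mk x a) :=
  Fintype.sum_prod_type (f := (f : (∀ i, S i) × (∀ i, A i) → ℝ))

lemma prod_update_apply (lam : ∀ i, S i × A i → ℝ) (j : ι) (m : S j × A j → ℝ)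
    (z : JointStep S A) : ∏ i, Function.update lam j m i (z.1 i, z.2 i) =
      m (z.1 j, z.2 j) * ∏ i ∈ Finset.univ.erase j, lam i (z.1 i, z.2 i) := by
  rw [← Finset.mul_prod_erase _ _ (Finset.mem_univ j), Function.update_self]
  congr 1
  exact Finset.prod_congr rfl fun i hi => by rw [Function.update_of_ne (Finset.ne_of_mem_erase hi)]

/-- Expected rewards are linear in the law of each player. -/
lemma avgValue_update_eq_sum (r : JointStep S A → ℝ) (lam : ∀ i, S i × A i → ℝ) (j : ι)
    (m : S j × A j → ℝ) : avgValue r (Function.update lam j m) =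
      ∑ u, m u * avgValue r (Function.update lam j (Pi.single u 1)) := by
  simp only [avgValue, prod_update_apply, Finset.mul_sum]
  rw [Finset.sum_comm]
  refine Finset.sum_congr rfl fun z _ => ?_
  rw [Finset.sum_eq_single (z.1 j, z.2 j)]
  · rw [Pi.single_eq_same]; ring
  · intro u _ hu
    rw [Pi.single_eq_of_ne hu.symm]; ring
  · simp

lemma mul_avgValue_update (r : JointStep S A → ℝ) (lam : ∀ i, S i × A i → ℝ) (j : ι)
    (m : S j × A j → ℝ) (b : ℝ) : b * avgValue r (Function.update lam j m) =
      avgValue r (Function.update lam j fun u => b * m u) := by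
  simp only [avgValue, prod_update_apply, Finset.mul_sum]
  exact Finset.sum_congr rfl fun z _ => by ring

lemma avgValue_nonneg {r : JointStep S A → ℝ} (hr : ∀ z, 0 ≤ r z) {lam : ∀ i, S i × A i → ℝ}
    (hlam : ∀ i u, 0 ≤ lam i u) : 0 ≤ avgValue r lam :=
  Finset.sum_nonneg fun z _ => mul_nonneg (hr z) (Finset.prod_nonneg fun i _ => hlam i _)

lemma avgValue_le_one {r : JointStep S A → ℝ} (hr : ∀ z, r z ≤ 1) {lam : ∀ i, S i × A i → ℝ}
    (hlam : ∀ i u, 0 ≤ lam i u) (hlam1 : ∀ i, ∑ u, lam i u = 1) : avgValue r lam ≤ 1 := by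
  have h : ∑ z : JointStep S A, ∏ i, lam i (z.1 i, z.2 i) = 1 := by
    rw [sum_jointStep_prod]; simp [hlam1]
  rw [← h]
  exact Finset.sum_le_sum fun z _ =>
    mul_le_of_le_one_left (Finset.prod_nonneg fun i _ => hlam i _) (hr z)

lemma isLaw_update_single {lam : ∀ i, S i × A i → ℝ} (j : ι) (w : S j × A j)
    (h0 : ∀ i u, 0 ≤ lam i u) (h1 : ∀ i, ∑ u, lam i u = 1) :
    (∀ i u, 0 ≤ Function.update lam j (Pi.single w 1) i u) ∧
      ∀ i, ∑ u, Function.update lam j (Pi.single w 1) i u = 1 := by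
  constructor
  · intro i u
    by_cases hi : i = j
    · subst hi
      rw [Function.update_self, Pi.single_apply]
      split_ifs <;> norm_num
    · rw [Function.update_of_ne hi]; exact h0 i u
  · intro i
    by_cases hi : i = j
    · subst hi; rw [Function.update_self]; simp
    · rw [Function.update_of_ne hi]; exact h1 i

lemma sum_jointProb_mul_avgValue (r : JointStep S A → ℝ) (q : ∀ i, stdSimplex ℝ (A i))
    (h : ∀ i, A i → S i × A i → ℝ) : ∑ a, jointProb q a * avgValue r (fun i => h i (a i)) =
      avgValue r fun i u => ∑ b, q i b * h i b u := by
  simp only [avgValue, Finset.mul_sum]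
  rw [Finset.sum_comm]
  refine Finset.sum_congr rfl fun z _ => ?_
  rw [← sum_prod_pi fun i b => q i b * h i b (z.1 i, z.2 i), Finset.mul_sum]
  refine Finset.sum_congr rfl fun a _ => ?_
  rw [Finset.prod_mul_distrib, jointProb]
  ring

end AvgValue

/-! ### The kernel from the end of one batch to the end of the next one -/

section BatchKernel

open Matrix

variable {ι : Type*} [Fintype ι] [DecidableEq ι] {S A : ι → Type*}
  [∀ i, Fintype (S i)] [∀ i, DecidableEq (S i)]
  [∀ i, Fintype (A i)] [∀ i, DecidableEq (A i)]

/-- The transition matrices of the players under the policies `π`. -/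
def chains (P : ∀ i, TransitionModel (S i) (A i)) (π : ∀ i, StationaryPolicy (S i) (A i)) (i : ι) :
    Matrix (S i) (S i) ℝ := inducedChain (P i) (π i)

/-- The laws of the states immediately after the joint step `z`. -/
def nextLaw (P : ∀ i, TransitionModel (S i) (A i)) (z : JointStep S A) (i : ι) (x : S i) : ℝ :=
  P i (z.1 i) (z.2 i) x

/-- The laws of the state-action pairs `t` time instances after the states have the laws `κ`. -/
def pairLaw (P : ∀ i, TransitionModel (S i) (A i)) (π : ∀ i, StationaryPolicy (S i) (A i))
    (κ : ∀ i, S i → ℝ) (t : ℕ) (i : ι) (u : S i × A i) : ℝ :=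
  (κ i ᵥ* chains P π i ^ t) u.1 * π i u.1 u.2

/-- The law of the last joint step of a batch that is played with `π` when `z` is the last joint
step of the previous batch. -/
def batchKernel (P : ∀ i, TransitionModel (S i) (A i)) (π : ∀ i, StationaryPolicy (S i) (A i))
    (d : ℕ) (z z' : JointStep S A) : ℝ :=
  batchEnd (chains P π) d (nextLaw P z) z'.1 * jointProb (fun i => π i (z'.1 i)) z'.2

/-- The expected contribution of the time `t + 1` to the coordinate `u` of the reward vector of
player `i`: the state of `u` has to be sampled at that time; the weights `1 / π` compensate for the
probability of the action. -/
def rewardAt (P : ∀ i, TransitionModel (S i) (A i)) (π : ∀ i, StationaryPolicy (S i) (A i))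
    (d : ℕ) (r : JointStep S A → ℝ) (i : ι) (u : S i × A i) (κ : ∀ i, S i → ℝ) (t : ℕ) : ℝ :=
  firstVisitProb (chains P π i) d (κ i) u.1 t *
    avgValue r (Function.update (pairLaw P π κ t) i (Pi.single u 1))

/-- The expected coordinate `u` of the reward vector of player `i`, when `z` is the last joint step
of the previous batch. -/
def expectedReward (P : ∀ i, TransitionModel (S i) (A i)) (π : ∀ i, StationaryPolicy (S i) (A i))
    (d : ℕ) (r : JointStep S A → ℝ) (i : ι) (u : S i × A i) (z : JointStep S A) : ℝ :=
  ∑' t, rewardAt P π d r i u (nextLaw P z) t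

/-- The action of a kernel on functions. -/
def applyKernel {Z : Type*} [Fintype Z] (B : Z → Z → ℝ) (φ : Z → ℝ) (z : Z) : ℝ :=
  ∑ z', B z z' * φ z'

variable {P : ∀ i, TransitionModel (S i) (A i)} {π : ∀ i, StationaryPolicy (S i) (A i)} {d : ℕ}
  {r : JointStep S A → ℝ}

lemma nextLaw_nonneg (z : JointStep S A) (i : ι) (x : S i) : 0 ≤ nextLaw P z i x :=
  (P i (z.1 i) (z.2 i)).2.1 x

lemma sum_nextLaw (z : JointStep S A) (i : ι) : ∑ x, nextLaw P z i x = 1 :=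
  (P i (z.1 i) (z.2 i)).2.2

lemma chains_apply (i : ι) (x y : S i) :
    chains P π i x y = ∑ b, π i x b * (P i x b : S i → ℝ) y := by
  simp only [chains, inducedChain_apply]
  exact Finset.sum_congr rfl fun b _ => mul_comm _ _

lemma sum_jointProb_mul_batchEndAt (x y : ∀ i, S i) (t : ℕ) :
    ∑ a, jointProb (fun i => π i (x i)) a *
        batchEndAt (chains P π) d (nextLaw P (JointStep.mk x a)) t y =
      batchEndAt (chains P π) d (fun i => chains P π i (x i)) t y := by
  have h : ∀ i, chains P π i (x i) = fun y => ∑ b, π i (x i) b * (P i (x i) b : S i → ℝ) y :=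
    fun i => funext (chains_apply i (x i))
  have h1 : ∀ i, departureLaw (chains P π i) d (chains P π i (x i)) t ∅ (y i) =
      ∑ b, π i (x i) b * departureLaw (chains P π i) d (P i (x i) b) t ∅ (y i) := fun i => by
    conv_lhs => rw [h i]
    rw [departureLaw_sum_mul]
  have h2 : ∀ i, arrivalLaw (chains P π i) d (chains P π i (x i)) t ∅ (y i) =
      ∑ b, π i (x i) b * arrivalLaw (chains P π i) d (P i (x i) b) t ∅ (y i) := fun i => by
    conv_lhs => rw [h i]
    rw [arrivalLaw_sum_mul]
  simp only [batchEndAt, h1, h2, mul_sub, Finset.sum_sub_distrib, ← sum_prod_pi,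
    Finset.prod_mul_distrib]
  rfl

lemma sum_jointProb_mul_rewardAt (x : ∀ i, S i) (i : ι) (u : S i × A i) (t : ℕ) :
    ∑ a, jointProb (fun i => π i (x i)) a * rewardAt P π d r i u (nextLaw P (JointStep.mk x a)) t =
      rewardAt P π d r i u (fun i => chains P π i (x i)) t := by
  have hx : ∀ i, chains P π i (x i) = fun y => ∑ b, π i (x i) b * (P i (x i) b : S i → ℝ) y :=
    fun i => funext (chains_apply i (x i))
  let h : ∀ j, A j → S j × A j → ℝ := Function.update
    (fun j b v => ((P j (x j) b : S j → ℝ) ᵥ* chains P π j ^ t) v.1 * π j v.1 v.2) i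
    (fun b v => firstVisitProb (chains P π i) d (P i (x i) b) u.1 t *
      Pi.single (M := fun _ => ℝ) u 1 v)
  have h1 : ∀ a : ∀ i, A i, rewardAt P π d r i u (nextLaw P (JointStep.mk x a)) t =
      avgValue r fun j => h j (a j) := by
    intro a
    rw [rewardAt, mul_avgValue_update]
    congr 1
    ext j v
    by_cases hj : j = i
    · subst hj
      simp only [h, Function.update_self]
      rfl
    · simp only [h, Function.update_of_ne hj]
      rfl
  simp only [h1]
  rw [sum_jointProb_mul_avgValue, rewardAt, mul_avgValue_update]
  congr 1
  ext j v
  by_cases hj : j = i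
  · subst hj
    simp only [h, Function.update_self]
    conv_rhs => rw [hx j]
    rw [firstVisitProb_sum_mul, Finset.sum_mul]
    exact Finset.sum_congr rfl fun b _ => by ring
  · simp only [h, Function.update_of_ne hj, pairLaw]
    have h2 : (chains P π j (x j) ᵥ* chains P π j ^ t) v.1 =
        ∑ b, π j (x j) b * ((P j (x j) b : S j → ℝ) ᵥ* chains P π j ^ t) v.1 := by
      simp only [Matrix.vecMul, dotProduct, Finset.mul_sum]
      rw [Finset.sum_comm]
      refine Finset.sum_congr rfl fun s _ => ?_
      rw [chains_apply, Finset.sum_mul]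
      exact Finset.sum_congr rfl fun b _ => by ring
    rw [h2, Finset.sum_mul]
    exact Finset.sum_congr rfl fun b _ => by ring

set_option maxHeartbeats 400000 in
/-- The error of the expected reward vector, in terms of the dependence of the law `θ` of the joint
state at the end of the previous batch: the laws of the opponents at the sampling time are
replaced by the stationary ones, one opponent at a time. -/
lemma abs_sum_reward_sub_le {c : ℝ} (hc0 : 0 ≤ c) (hc1 : c ≤ 1)
    (hK : ∀ i, IsContractingChain (chains P π i) c) [∀ i, Nonempty (S i)]
    {μ : ∀ i, S i → ℝ} (hμ0 : ∀ i x, 0 ≤ μ i x) (hμ1 : ∀ i, ∑ x, μ i x = 1)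
    (hμ : ∀ i, μ i ᵥ* chains P π i = μ i) (hr0 : ∀ z, 0 ≤ r z) (hr1 : ∀ z, r z ≤ 1)
    (i : ι) (u : S i × A i) (θ : (∀ i, S i) → ℝ) (N : ℕ) :
    |∑ x, θ x * ∑ t ∈ Finset.range N,
        firstVisitProb (chains P π i) d (chains P π i (x i)) u.1 t *
          (avgValue r (Function.update (pairLaw P π (fun i => chains P π i (x i)) t) i
            (Pi.single u 1)) -
          avgValue r (Function.update (fun j v => μ j v.1 * π j v.1 v.2) i (Pi.single u 1)))| ≤
      c ^ d / 2 * ∑ j, dependenceOn j (μ j) θ := by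
  set ρ : ∀ j, S j × A j → ℝ := fun j v => μ j v.1 * π j v.1 v.2 with hρ
  set L : (∀ i, S i) → ℕ → ∀ j, S j × A j → ℝ :=
    fun x t => pairLaw P π (fun i => chains P π i (x i)) t with hL
  -- the laws at the sampling time for the players in `J`, the stationary laws for the others
  set hyb : Finset ι → (∀ i, S i) → ℕ → ∀ j, S j × A j → ℝ :=
    fun J x t j => if j ∈ J then L x t j else ρ j with hhyb
  have hπ0 : ∀ j (y : S j) a, 0 ≤ π j y a := fun j y a => (π j y).2.1 a
  have hπ1 : ∀ j (y : S j), ∑ a, π j y a = 1 := fun j y => (π j y).2.2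
  have hpow : ∀ j t (x y : S j),
      (chains P π j x ᵥ* chains P π j ^ t) y = (chains P π j ^ (t + 1)) x y := by
    intro i t x y
    rw [pow_succ', Matrix.mul_apply]
    rfl
  have hpair : ∀ (j) (m : S j → ℝ), ∑ v : S j × A j, m v.1 * π j v.1 v.2 = ∑ y, m y := by
    intro j m
    rw [Fintype.sum_prod_type]
    refine Finset.sum_congr rfl fun y _ => ?_
    change ∑ a, m y * π j y a = m y
    rw [← Finset.mul_sum, hπ1, mul_one]
  have hρ0 : ∀ j v, 0 ≤ ρ j v := fun j v => mul_nonneg (hμ0 j _) (hπ0 j _ _)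
  have hρ1 : ∀ j, ∑ v, ρ j v = 1 := fun j => by rw [hpair, hμ1]
  have hL0 : ∀ x t j v, 0 ≤ L x t j v := fun x t j v => by
    refine mul_nonneg ?_ (hπ0 j _ _)
    rw [hpow]
    exact (hK j).pow_nonneg _ _ _
  have hL1 : ∀ x t j, ∑ v, L x t j v = 1 := fun x t j => by
    simp only [hL, pairLaw]
    rw [hpair j fun y => (chains P π j (x j) ᵥ* chains P π j ^ t) y]
    simp only [hpow]
    exact (hK j).pow_row_sum _ _
  have hhyb0 : ∀ J x t j v, 0 ≤ hyb J x t j v := fun J x t j v => by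
    simp only [hhyb]; split_ifs; exacts [hL0 x t j v, hρ0 j v]
  have hhyb1 : ∀ J x t j, ∑ v, hyb J x t j v = 1 := fun J x t j => by
    simp only [hhyb]; split_ifs; exacts [hL1 x t j, hρ1 j]
  have main : ∀ J : Finset ι, i ∉ J →
      |∑ x, θ x * ∑ t ∈ Finset.range N,
        firstVisitProb (chains P π i) d (chains P π i (x i)) u.1 t *
          (avgValue r (Function.update (hyb J x t) i (Pi.single u 1)) -
          avgValue r (Function.update ρ i (Pi.single u 1)))| ≤
      c ^ d / 2 * ∑ j ∈ J, dependenceOn j (μ j) θ := by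
    intro J
    induction J using Finset.induction_on with
    | empty =>
      intro _
      have : ∀ x t, hyb ∅ x t = ρ := fun x t => by ext j v; simp [hhyb]
      simp [this]
    | insert j J hjJ ih =>
      intro hi
      have hij : i ≠ j := fun h => hi (h ▸ Finset.mem_insert_self _ _)
      have ih' := ih fun h => hi (Finset.mem_insert_of_mem h)
      rw [Finset.sum_insert hjJ, mul_add]
      -- the value given the state of `j`; it does not depend on the previous state of `j`
      set C : (∀ i, S i) → ℕ → S j → ℝ := fun x t y => ∑ a, π j y a *
        avgValue r (Function.update (Function.update (hyb J x t) i (Pi.single u 1)) j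
          (Pi.single (y, a) 1)) with hC
      have hstep : ∀ x t, avgValue r (Function.update (hyb (insert j J) x t) i (Pi.single u 1)) -
          avgValue r (Function.update (hyb J x t) i (Pi.single u 1)) =
          ∑ y, ((chains P π j ^ (t + 1)) (x j) y - μ j y) * C x t y := by
        intro x t
        have e1 : Function.update (hyb (insert j J) x t) i (Pi.single u 1) =
            Function.update (Function.update (hyb J x t) i (Pi.single u 1)) j (L x t j) := by
          rw [Function.update_comm hij]
          congr 1
          ext k v
          by_cases hk : k = j
          · subst hk; simp [hhyb]
          · simp [hhyb, hk]
        have e2 : Function.update (hyb J x t) i (Pi.single u 1) =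
            Function.update (Function.update (hyb J x t) i (Pi.single u 1)) j (ρ j) := by
          rw [Function.update_comm hij]
          congr 1
          ext k v
          by_cases hk : k = j
          · subst hk; simp [hhyb, hjJ]
          · simp [hk]
        rw [e1, avgValue_update_eq_sum]
        conv_lhs => rw [e2]
        rw [avgValue_update_eq_sum, ← Finset.sum_sub_distrib, Fintype.sum_prod_type]
        refine Finset.sum_congr rfl fun y _ => ?_
        rw [hC, Finset.mul_sum]
        refine Finset.sum_congr rfl fun a _ => ?_
        simp only [hL, pairLaw, hρ, hpow]
        simp only [Function.update_comm hij, Function.update_idem]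
        ring
      have hsplit : ∑ x, θ x * ∑ t ∈ Finset.range N,
          firstVisitProb (chains P π i) d (chains P π i (x i)) u.1 t *
          (avgValue r (Function.update (hyb (insert j J) x t) i (Pi.single u 1)) -
          avgValue r (Function.update ρ i (Pi.single u 1))) =
        ∑ x, θ x * ∑ t ∈ Finset.range N,
          firstVisitProb (chains P π i) d (chains P π i (x i)) u.1 t *
          ∑ y, ((chains P π j ^ (t + 1)) (x j) y - μ j y) * C x t y +
        ∑ x, θ x * ∑ t ∈ Finset.range N,
          firstVisitProb (chains P π i) d (chains P π i (x i)) u.1 t *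
          (avgValue r (Function.update (hyb J x t) i (Pi.single u 1)) -
          avgValue r (Function.update ρ i (Pi.single u 1))) := by
        simp only [← hstep, ← Finset.sum_add_distrib, ← mul_add]
        simp only [sub_add_sub_cancel]
      rw [hsplit]
      refine (abs_add_le _ _).trans (add_le_add ?_ ih')
      have x₀ : S j := Classical.arbitrary _
      have hCeq : ∀ t x w y, C (combine j x w) t y = C (combine j x₀ w) t y := by
        intro t x w y
        have : Function.update (Function.update (hyb J (combine j x w) t) i (Pi.single u 1)) j =
            Function.update (Function.update (hyb J (combine j x₀ w) t) i (Pi.single u 1)) j := by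
          ext m k v
          by_cases hk : k = j
          · subst hk; simp
          · simp only [Function.update_of_ne hk]
            by_cases hki : k = i
            · subst hki; simp
            · have hL' : L (combine j x w) t k = L (combine j x₀ w) t k := by
                funext v
                simp only [hL, pairLaw, combine_of_ne hk]
              simp only [Function.update_of_ne hki, hhyb, hL']
        simp only [hC, this]
      have hf0 : ∀ (t : ℕ) (w : ∀ k : {k // k ≠ j}, S k),
          0 ≤ firstVisitProb (chains P π i) d (chains P π i (w ⟨i, hij⟩)) u.1 t := fun t w =>
        firstVisitProb_nonneg (hK i).nonneg ((hK i).nonneg (w ⟨i, hij⟩)) u.1 t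
      have hf1 : ∀ w : ∀ k : {k // k ≠ j}, S k, ∑ t ∈ Finset.range N,
          firstVisitProb (chains P π i) d (chains P π i (w ⟨i, hij⟩)) u.1 t ≤ 1 := fun w =>
        sum_firstVisitProb_le (hK i).nonneg (hK i).row_sum ((hK i).nonneg (w ⟨i, hij⟩))
          ((hK i).row_sum (w ⟨i, hij⟩)) u.1 N
      rw [sum_combine j]
      simp only [combine_self, hCeq, combine_of_ne hij]
      have hq : ∀ t, (∀ w : ∀ k : {k // k ≠ j}, S k,
            firstVisitProb (chains P π i) d (chains P π i (w ⟨i, hij⟩)) u.1 t = 0) ∨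
          ∀ ν : S j → ℝ, ∑ x, ν x = 0 →
            ∑ y, |(ν ᵥ* chains P π j ^ (t + 1)) y| ≤ c ^ d * ∑ x, |ν x| := by
        intro t
        by_cases ht : d ≤ t + 1
        · right
          intro ν hν
          refine ((hK j).contract_pow hc0 (t + 1) ν hν).trans ?_
          exact mul_le_mul_of_nonneg_right (pow_le_pow_of_le_one hc0 hc1 ht)
            (Finset.sum_nonneg fun _ _ => abs_nonneg _)
        · left
          intro w
          rw [firstVisitProb, if_neg ht]
      have hC01 : ∀ x t y, 0 ≤ C x t y ∧ C x t y ≤ 1 := by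
        intro x t y
        have h1 := isLaw_update_single i u (hhyb0 J x t) (hhyb1 J x t)
        have h2 := fun a => isLaw_update_single j (y, a) h1.1 h1.2
        refine ⟨Finset.sum_nonneg fun a _ => mul_nonneg (hπ0 j y a)
          (avgValue_nonneg hr0 (h2 a).1), ?_⟩
        rw [← hπ1 j y]
        exact Finset.sum_le_sum fun a _ => mul_le_of_le_one_right (hπ0 j y a)
          (avgValue_le_one hr1 (h2 a).1 (h2 a).2)
      clear_value C
      exact abs_sum_moved_sub_le (hμ1 j) (pow_nonneg hc0 d)
        (fun t => (hK j).pow_row_sum (t + 1))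
        (fun t => IsContractingChain.vecMul_pow_of_fixed (hμ j) (t + 1))
        hf0 hf1 hq (c := fun t w y => C (combine j x₀ w) t y)
        (fun t w y => (hC01 _ t y).1) (fun t w y => (hC01 _ t y).2)
        (fun x w => θ (combine j x w))
  have h1 := main (Finset.univ.erase i) (by simp)
  have h2 : ∀ x t, Function.update (hyb (Finset.univ.erase i) x t) i (Pi.single u 1) =
      Function.update (L x t) i (Pi.single u 1) := by
    intro x t
    ext k v
    by_cases hk : k = i
    · subst hk; simp
    · simp [hk, hhyb]
  simp only [h2] at h1
  refine h1.trans (mul_le_mul_of_nonneg_left ?_ (by positivity))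
  exact Finset.sum_le_sum_of_subset_of_nonneg (Finset.subset_univ _)
    fun j _ _ => dependenceOn_nonneg j _ _

end BatchKernel

/-! ### Mean rewards after many batches with the same policies -/

section BatchKernel

open Matrix

variable {ι : Type*} [Fintype ι] [DecidableEq ι] {S A : ι → Type*}
  [∀ i, Fintype (S i)] [∀ i, DecidableEq (S i)] [∀ i, Nonempty (S i)]
  [∀ i, Fintype (A i)] [∀ i, DecidableEq (A i)]
  {P : ∀ i, TransitionModel (S i) (A i)} {π : ∀ i, StationaryPolicy (S i) (A i)} {d : ℕ}
  {r : JointStep S A → ℝ} {c : ℝ}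

lemma pairLaw_nonneg (hK : ∀ i, IsContractingChain (chains P π i) c) {κ : ∀ i, S i → ℝ}
    (hκ : ∀ i x, 0 ≤ κ i x) (t : ℕ) (i : ι) (u : S i × A i) : 0 ≤ pairLaw P π κ t i u :=
  mul_nonneg (vecMul_nonneg_of_nonneg ((hK i).pow_nonneg t) (hκ i) u.1) ((π i u.1).2.1 u.2)

lemma sum_mul_policy {X Y : Type*} [Fintype X] [Fintype Y] (π : StationaryPolicy X Y)
    (m : X → ℝ) : ∑ v : X × Y, m v.1 * π v.1 v.2 = ∑ y, m y := by
  rw [Fintype.sum_prod_type]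
  refine Finset.sum_congr rfl fun y _ => ?_
  change ∑ a, m y * π y a = m y
  have h : ∑ a, π y a = 1 := (π y).2.2
  rw [← Finset.mul_sum, h, mul_one]

lemma sum_pairLaw (hK : ∀ i, IsContractingChain (chains P π i) c) {κ : ∀ i, S i → ℝ}
    (hκ : ∀ i, ∑ x, κ i x = 1) (t : ℕ) (i : ι) : ∑ u, pairLaw P π κ t i u = 1 := by
  simp only [pairLaw]
  rw [sum_mul_policy (π i) fun y => (κ i ᵥ* chains P π i ^ t) y, (hK i).sum_vecMul_pow, hκ]

lemma rewardAt_nonneg (hK : ∀ i, IsContractingChain (chains P π i) c) {κ : ∀ i, S i → ℝ}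
    (hκ0 : ∀ i x, 0 ≤ κ i x) (hκ : ∀ i, ∑ x, κ i x = 1) (hr0 : ∀ z, 0 ≤ r z)
    (i : ι) (u : S i × A i) (t : ℕ) : 0 ≤ rewardAt P π d r i u κ t :=
  mul_nonneg (firstVisitProb_nonneg (hK i).nonneg (hκ0 i) u.1 t) (avgValue_nonneg hr0
    (isLaw_update_single i u (pairLaw_nonneg hK hκ0 t) (sum_pairLaw hK hκ t)).1)

lemma rewardAt_le (hK : ∀ i, IsContractingChain (chains P π i) c) {κ : ∀ i, S i → ℝ}
    (hκ0 : ∀ i x, 0 ≤ κ i x) (hκ : ∀ i, ∑ x, κ i x = 1) (hr1 : ∀ z, r z ≤ 1)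
    (i : ι) (u : S i × A i) (t : ℕ) :
    rewardAt P π d r i u κ t ≤ firstVisitProb (chains P π i) d (κ i) u.1 t :=
  have h := isLaw_update_single i u (pairLaw_nonneg (P := P) (π := π) hK hκ0 t)
    (sum_pairLaw hK hκ t)
  mul_le_of_le_one_right (firstVisitProb_nonneg (hK i).nonneg (hκ0 i) u.1 t)
    (avgValue_le_one hr1 h.1 h.2)

lemma summable_rewardAt (hK : ∀ i, IsContractingChain (chains P π i) c) {κ : ∀ i, S i → ℝ}
    (hκ0 : ∀ i x, 0 ≤ κ i x) (hκ : ∀ i, ∑ x, κ i x = 1) (hr0 : ∀ z, 0 ≤ r z)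
    (hr1 : ∀ z, r z ≤ 1) (i : ι) (u : S i × A i) : Summable (rewardAt P π d r i u κ) :=
  summable_of_sum_range_le (rewardAt_nonneg hK hκ0 hκ hr0 i u) fun N =>
    (Finset.sum_le_sum fun t _ => rewardAt_le hK hκ0 hκ hr1 i u t).trans
      (sum_firstVisitProb_le (hK i).nonneg (hK i).row_sum (hκ0 i) (hκ i) u.1 N)

lemma tendsto_sum_firstVisitProb {X : Type*} [Fintype X] [DecidableEq X] [Nonempty X]
    {K : Matrix X X ℝ} {κ : X → ℝ} (hK1 : ∀ x, ∑ y, K x y = 1) (hprim : K.IsPrimitive)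
    (hκ0 : ∀ x, 0 ≤ κ x) (hκ : ∑ x, κ x = 1) (s : X) :
    Tendsto (fun N => ∑ t ∈ Finset.range N, firstVisitProb K d κ s t) atTop (𝓝 1) :=
  tendsto_of_tendsto_of_tendsto_of_le_of_le (tendsto_coverProb hK1 hprim hκ0 hκ)
    tendsto_const_nhds
    (coverProb_le_sum_firstVisitProb hprim.nonneg hK1 hκ0 hκ s)
    (sum_firstVisitProb_le hprim.nonneg hK1 hκ0 hκ s)

/-- The law of the joint state at the end of the `m`-th next batch. -/
def endLaw (P : ∀ i, TransitionModel (S i) (A i)) (π : ∀ i, StationaryPolicy (S i) (A i))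
    (d : ℕ) (z : JointStep S A) : ℕ → (∀ i, S i) → ℝ
  | 0, y => batchEnd (chains P π) d (nextLaw P z) y
  | m + 1, y => ∑ x, endLaw P π d z m x * batchEnd (chains P π) d (fun i => chains P π i (x i)) y

/-- The average of a function of the joint step over the actions drawn from `π`. -/
def actionAverage (π : ∀ i, StationaryPolicy (S i) (A i)) (φ : JointStep S A → ℝ)
    (x : ∀ i, S i) : ℝ :=
  ∑ a, jointProb (fun i => π i (x i)) a * φ (JointStep.mk x a)

section

variable [Nonempty ι]

lemma endLaw_nonneg (hK : ∀ i, IsContractingChain (chains P π i) c) (z : JointStep S A) (m : ℕ)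
    (y : ∀ i, S i) : 0 ≤ endLaw P π d z m y := by
  induction m generalizing y with
  | zero => exact batchEnd_nonneg hK (nextLaw_nonneg z) y
  | succ m ih =>
    exact Finset.sum_nonneg fun x _ => mul_nonneg (ih x)
      (batchEnd_nonneg hK (fun i => (hK i).nonneg (x i)) y)

lemma sum_endLaw (hK : ∀ i, IsContractingChain (chains P π i) c)
    (hprim : ∀ i, (chains P π i).IsPrimitive) (z : JointStep S A) (m : ℕ) :
    ∑ y, endLaw P π d z m y = 1 := by
  induction m with
  | zero => exact sum_batchEnd hK hprim (nextLaw_nonneg z) (sum_nextLaw z)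
  | succ m ih =>
    simp only [endLaw]
    rw [Finset.sum_comm]
    simp only [← Finset.mul_sum, sum_batchEnd hK hprim (fun i => (hK i).nonneg _)
      (fun i => (hK i).row_sum _), mul_one, ih]

lemma applyKernel_batchKernel (φ : JointStep S A → ℝ) (z : JointStep S A) :
    applyKernel (batchKernel P π d) φ z =
      ∑ y, batchEnd (chains P π) d (nextLaw P z) y * actionAverage π φ y := by
  rw [applyKernel, sum_jointStep]
  refine Finset.sum_congr rfl fun y _ => ?_
  rw [actionAverage, Finset.mul_sum]
  refine Finset.sum_congr rfl fun a _ => ?_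
  change batchEnd (chains P π) d (nextLaw P z) y * jointProb (fun i => π i (y i)) a * _ = _
  ring

lemma actionAverage_applyKernel (hK : ∀ i, IsContractingChain (chains P π i) c)
    (φ : JointStep S A → ℝ) (x : ∀ i, S i) :
    actionAverage π (applyKernel (batchKernel P π d) φ) x =
      ∑ y, batchEnd (chains P π) d (fun i => chains P π i (x i)) y * actionAverage π φ y := by
  rw [actionAverage]
  simp only [applyKernel_batchKernel, Finset.mul_sum]
  rw [Finset.sum_comm]
  refine Finset.sum_congr rfl fun y _ => ?_
  simp only [← mul_assoc]
  rw [← Finset.sum_mul]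
  congr 1
  simp only [batchEnd, ← sum_jointProb_mul_batchEndAt, ← tsum_mul_left]
  rw [Summable.tsum_finsetSum]
  intro a _
  exact (summable_batchEndAt hK (nextLaw_nonneg _) (sum_nextLaw _) y).mul_left _

lemma iterate_applyKernel (hK : ∀ i, IsContractingChain (chains P π i) c) (m : ℕ)
    (φ : JointStep S A → ℝ) (z : JointStep S A) :
    (applyKernel (batchKernel P π d))^[m + 1] φ z =
      ∑ y, endLaw P π d z m y * actionAverage π φ y := by
  induction m generalizing φ with
  | zero => exact applyKernel_batchKernel φ z
  | succ m ih =>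
    rw [Function.iterate_succ_apply, ih]
    simp only [actionAverage_applyKernel hK, endLaw, Finset.mul_sum, Finset.sum_mul]
    rw [Finset.sum_comm]
    exact Finset.sum_congr rfl fun y _ => Finset.sum_congr rfl fun x _ => by ring

/-- The fixed point `4 / (1 - q)` of the recursion `x ↦ q * x + 4` is approached geometrically; only
the initial value depends on the number of players. -/
lemma sum_dependenceOn_endLaw_le (hK : ∀ i, IsContractingChain (chains P π i) c) (hc0 : 0 ≤ c)
    (hc1 : c ≤ 1) (hq : c ^ d < 1) (hprim : ∀ i, (chains P π i).IsPrimitive)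
    {μ : ∀ i, S i → ℝ} (hμ0 : ∀ i x, 0 ≤ μ i x) (hμ1 : ∀ i, ∑ x, μ i x = 1)
    (hμ : ∀ i, μ i ᵥ* chains P π i = μ i) (z : JointStep S A) (m : ℕ) :
    ∑ j, dependenceOn j (μ j) (endLaw P π d z m) ≤
      (c ^ d) ^ m * (2 * Fintype.card ι) + 4 / (1 - c ^ d) := by
  have h1 : 0 < 1 - c ^ d := by linarith
  induction m with
  | zero =>
    have h2 : ∑ j, dependenceOn j (μ j) (endLaw P π d z 0) ≤ ∑ _j : ι, (2 : ℝ) := by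
      refine Finset.sum_le_sum fun j _ => ?_
      have := dependenceOn_le (hμ0 j) (hμ1 j) (endLaw_nonneg (d := d) hK z 0)
      rwa [sum_endLaw hK hprim, mul_one] at this
    have h3 : 0 ≤ 4 / (1 - c ^ d) := by positivity
    simp only [Finset.sum_const, Finset.card_univ, nsmul_eq_mul] at h2
    rw [pow_zero, one_mul]
    linarith
  | succ m ih =>
    have h2 := sum_dependenceOn_le (d := d) hK hc0 hc1 hμ0 hμ1 hμ (endLaw_nonneg (d := d) hK z m)
    rw [sum_endLaw hK hprim] at h2
    have h3 := mul_le_mul_of_nonneg_left ih (pow_nonneg hc0 d)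
    have h4 : 4 / (1 - c ^ d) = c ^ d * (4 / (1 - c ^ d)) + 4 := by field_simp; ring
    calc _ ≤ _ := h2
      _ ≤ c ^ d * ((c ^ d) ^ m * (2 * Fintype.card ι) + 4 / (1 - c ^ d)) + 4 * 1 := by gcongr
      _ = _ := by linear_combination (-1 : ℝ) * h4

lemma actionAverage_expectedReward (hK : ∀ i, IsContractingChain (chains P π i) c)
    (hr0 : ∀ z, 0 ≤ r z) (hr1 : ∀ z, r z ≤ 1) (i : ι) (u : S i × A i) (x : ∀ i, S i) :
    actionAverage π (expectedReward P π d r i u) x =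
      ∑' t, rewardAt P π d r i u (fun i => chains P π i (x i)) t := by
  simp only [actionAverage, expectedReward, ← sum_jointProb_mul_rewardAt, ← tsum_mul_left]
  rw [Summable.tsum_finsetSum]
  intro a _
  exact (summable_rewardAt hK (nextLaw_nonneg _) (sum_nextLaw _) hr0 hr1 i u).mul_left _

/-- After sufficiently many batches played with the same stationary policies, the expected
reward vector is up to about `2 q / (1 - q)` the gradient of the payoff, whatever the number of
players. -/
theorem exists_iterate_expectedReward_close (hK : ∀ i, IsContractingChain (chains P π i) c)
    (hc0 : 0 ≤ c) (hc1 : c ≤ 1) (hq : c ^ d < 1) (hprim : ∀ i, (chains P π i).IsPrimitive)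
    {μ : ∀ i, S i → ℝ} (hμ0 : ∀ i x, 0 ≤ μ i x) (hμ1 : ∀ i, ∑ x, μ i x = 1)
    (hμ : ∀ i, μ i ᵥ* chains P π i = μ i) (hr0 : ∀ z, 0 ≤ r z) (hr1 : ∀ z, r z ≤ 1)
    (i : ι) (u : S i × A i) {γ : ℝ} (hγ : 0 < γ) :
    ∃ m, ∀ z, |(applyKernel (batchKernel P π d))^[m] (expectedReward P π d r i u) z -
      avgValue r (Function.update (fun j v => μ j v.1 * π j v.1 v.2) i (Pi.single u 1))| ≤
      2 * c ^ d / (1 - c ^ d) + γ := by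
  have h1 : 0 < 1 - c ^ d := by linarith
  have hq0 : 0 ≤ c ^ d := pow_nonneg hc0 d
  obtain ⟨m, hm⟩ : ∃ m : ℕ, (c ^ d) ^ m * Fintype.card ι ≤ γ := by
    have h2 : Tendsto (fun m : ℕ => (c ^ d) ^ m * (Fintype.card ι : ℝ)) atTop (𝓝 0) := by
      simpa using (tendsto_pow_atTop_nhds_zero_of_lt_one hq0 hq).mul_const (Fintype.card ι : ℝ)
    exact (h2.eventually (ge_mem_nhds hγ)).exists
  refine ⟨m + 1, fun z => ?_⟩
  set v := avgValue r (Function.update (fun j v => μ j v.1 * π j v.1 v.2) i (Pi.single u 1))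
  rw [iterate_applyKernel hK]
  simp only [actionAverage_expectedReward hK hr0 hr1]
  have hlim : Tendsto (fun N => ∑ x, endLaw P π d z m x * ∑ t ∈ Finset.range N,
        firstVisitProb (chains P π i) d (chains P π i (x i)) u.1 t *
          (avgValue r (Function.update (pairLaw P π (fun i => chains P π i (x i)) t) i
            (Pi.single u 1)) - v)) atTop
      (𝓝 (∑ y, endLaw P π d z m y *
        ∑' t, rewardAt P π d r i u (fun i => chains P π i (y i)) t - v)) := by
    have h3 : v = ∑ y, endLaw P π d z m y * (1 * v) := by
      rw [← Finset.sum_mul, sum_endLaw hK hprim, one_mul, one_mul]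
    conv in (𝓝 _) => rw [h3, ← Finset.sum_sub_distrib]
    refine tendsto_finsetSum _ fun x _ => ?_
    rw [← mul_sub]
    refine Tendsto.const_mul _ ?_
    simp only [mul_sub, Finset.sum_sub_distrib, ← Finset.sum_mul]
    refine Tendsto.sub ?_ (Tendsto.mul_const _ ?_)
    · exact (summable_rewardAt hK (fun i => (hK i).nonneg (x i)) (fun i => (hK i).row_sum (x i))
        hr0 hr1 i u).hasSum.tendsto_sum_nat
    · exact tendsto_sum_firstVisitProb (hK i).row_sum (hprim i) ((hK i).nonneg (x i))
        ((hK i).row_sum (x i)) u.1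
  refine le_of_tendsto' hlim.abs fun N => ?_
  refine (abs_sum_reward_sub_le hc0 hc1 hK hμ0 hμ1 hμ hr0 hr1 i u (endLaw P π d z m) N).trans ?_
  calc c ^ d / 2 * ∑ j, dependenceOn j (μ j) (endLaw P π d z m)
      ≤ c ^ d / 2 * ((c ^ d) ^ m * (2 * Fintype.card ι) + 4 / (1 - c ^ d)) := by
        gcongr
        exact sum_dependenceOn_endLaw_le hK hc0 hc1 hq hprim hμ0 hμ1 hμ z m
    _ = 2 * c ^ d / (1 - c ^ d) + c ^ d * ((c ^ d) ^ m * Fintype.card ι) := by ring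
    _ ≤ 2 * c ^ d / (1 - c ^ d) + 1 * ((c ^ d) ^ m * Fintype.card ι) := by gcongr
    _ ≤ _ := by rw [one_mul]; gcongr

end

end BatchKernel

/-! ### Weighted averages -/

section WeightedAverage

/-- The weighted average of the first `n` terms of a sequence. -/
def wAvg (η x : ℕ → ℝ) (n : ℕ) : ℝ :=
  (∑ k ∈ Finset.range n, η k * x k) / ∑ k ∈ Finset.range n, η k

variable {η : ℕ → ℝ}

lemma tendsto_sum_weights (hη : ∀ k, 0 < η k) (hdiv : ¬ Summable η) :
    Tendsto (fun n => ∑ k ∈ Finset.range n, η k) atTop atTop :=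
  (not_summable_iff_tendsto_nat_atTop_of_nonneg fun k => (hη k).le).1 hdiv

lemma wAvg_add (x y : ℕ → ℝ) (n : ℕ) :
    wAvg η (fun k => x k + y k) n = wAvg η x n + wAvg η y n := by
  simp only [wAvg, mul_add, Finset.sum_add_distrib, add_div]

lemma wAvg_sub (x y : ℕ → ℝ) (n : ℕ) :
    wAvg η (fun k => x k - y k) n = wAvg η x n - wAvg η y n := by
  simp only [wAvg, mul_sub, Finset.sum_sub_distrib, sub_div]

lemma wAvg_mul_const (x : ℕ → ℝ) (b : ℝ) (n : ℕ) :
    wAvg η (fun k => x k * b) n = wAvg η x n * b := by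
  simp only [wAvg, ← mul_assoc, ← Finset.sum_mul, div_mul_eq_mul_div]

lemma wAvg_sum {κ : Type*} (s : Finset κ) (x : κ → ℕ → ℝ) (n : ℕ) :
    wAvg η (fun k => ∑ j ∈ s, x j k) n = ∑ j ∈ s, wAvg η (x j) n := by
  simp only [wAvg, Finset.mul_sum]
  rw [Finset.sum_comm, Finset.sum_div]

lemma tendsto_wAvg_zero (hη : ∀ k, 0 < η k) (hdiv : ¬ Summable η) {x : ℕ → ℝ}
    (hx : Tendsto x atTop (𝓝 0)) : Tendsto (wAvg η x) atTop (𝓝 0) := by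
  have h1 : (fun k => η k * x k) =o[atTop] η := by
    have := (Asymptotics.isBigO_refl η atTop).mul_isLittleO
      ((Asymptotics.isLittleO_one_iff ℝ).2 hx)
    simpa using this
  exact (h1.sum_range (fun k => (hη k).le) (tendsto_sum_weights hη hdiv)).tendsto_div_nhds_zero

lemma tendsto_wAvg (hη : ∀ k, 0 < η k) (hdiv : ¬ Summable η) {x : ℕ → ℝ} {l : ℝ}
    (hx : Tendsto x atTop (𝓝 l)) : Tendsto (wAvg η x) atTop (𝓝 l) := by
  have h1 : Tendsto (wAvg η fun k => x k - l) atTop (𝓝 0) :=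
    tendsto_wAvg_zero hη hdiv (by simpa using hx.sub_const l)
  have h2 : Tendsto (fun n => wAvg η (fun k => x k - l) n + l) atTop (𝓝 l) := by
    simpa using h1.add_const l
  refine h2.congr' ?_
  filter_upwards [(tendsto_sum_weights hη hdiv).eventually_gt_atTop 0] with n hn
  rw [wAvg_sub, sub_add_eq_add_sub, sub_eq_iff_eq_add]
  simp only [wAvg, ← Finset.sum_mul]
  field_simp

lemma eventually_abs_wAvg_sub_le (hη : ∀ k, 0 < η k) (hdiv : ¬ Summable η) {x : ℕ → ℝ}
    {v β β' : ℝ} (hx : ∀ᶠ k in atTop, |x k - v| ≤ β) (hβ : β < β') :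
    ∀ᶠ n in atTop, |wAvg η x n - v| ≤ β' := by
  classical
  have h0 : 0 ≤ β := by
    obtain ⟨k, hk⟩ := hx.exists
    exact (abs_nonneg _).trans hk
  set y : ℕ → ℝ := fun k => if |x k - v| ≤ β then x k else v with hy
  have hy1 : ∀ k, |y k - v| ≤ β := fun k => by
    simp only [hy]; split_ifs with h; exacts [h, by simpa using h0]
  have h1 : Tendsto (wAvg η fun k => x k - y k) atTop (𝓝 0) := by
    refine tendsto_wAvg_zero hη hdiv (tendsto_const_nhds.congr' ?_)
    filter_upwards [hx] with k hk
    simp [hy, hk]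
  have h2 := h1.abs
  rw [abs_zero] at h2
  filter_upwards [h2.eventually (ge_mem_nhds (sub_pos.2 hβ)),
    (tendsto_sum_weights hη hdiv).eventually_gt_atTop 0] with n hn hpos
  have h3 : |wAvg η y n - v| ≤ β := by
    have h4 : wAvg η y n - v = (∑ k ∈ Finset.range n, η k * (y k - v)) /
        ∑ k ∈ Finset.range n, η k := by
      simp only [mul_sub, Finset.sum_sub_distrib, ← Finset.sum_mul, wAvg, sub_div]
      congr 1
      field_simp
    rw [h4, abs_div, abs_of_pos hpos, div_le_iff₀ hpos, Finset.mul_sum]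
    refine (Finset.abs_sum_le_sum_abs _ _).trans (Finset.sum_le_sum fun k _ => ?_)
    rw [abs_mul, abs_of_pos (hη k), mul_comm]
    exact mul_le_mul_of_nonneg_right (hy1 k) (hη k).le
  rw [wAvg_sub] at hn
  calc |wAvg η x n - v| = |(wAvg η x n - wAvg η y n) + (wAvg η y n - v)| := by ring_nf
    _ ≤ _ := abs_add_le _ _
    _ ≤ (β' - β) + β := add_le_add hn h3
    _ = β' := by ring

/-- Kronecker's lemma. -/
lemma tendsto_wAvg_of_summable (hη : ∀ k, 0 < η k) (hdiv : ¬ Summable η) {x : ℕ → ℝ} {l : ℝ}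
    (hx : Tendsto (fun n => ∑ k ∈ Finset.range n,
      η k / (∑ j ∈ Finset.range (k + 1), η j) * x k) atTop (𝓝 l)) :
    Tendsto (wAvg η x) atTop (𝓝 0) := by
  set s : ℕ → ℝ := fun n => ∑ k ∈ Finset.range n,
      η k / (∑ j ∈ Finset.range (k + 1), η j) * x k with hs
  have h1 : Tendsto (fun n => s n - wAvg η s n) atTop (𝓝 0) := by
    simpa using hx.sub (tendsto_wAvg hη hdiv hx)
  refine h1.congr' ?_
  filter_upwards [(tendsto_sum_weights hη hdiv).eventually_gt_atTop 0] with n hn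
  -- summation by parts
  have h2 : ∀ n, (∑ j ∈ Finset.range n, η j) * s n - ∑ k ∈ Finset.range n, η k * s k =
      ∑ k ∈ Finset.range n, η k * x k := by
    intro n
    induction n with
    | zero => simp
    | succ n ih =>
      have hpos : 0 < ∑ j ∈ Finset.range (n + 1), η j :=
        Finset.sum_pos (fun k _ => hη k) (by simp)
      have h3 : s (n + 1) = s n + η n / (∑ j ∈ Finset.range (n + 1), η j) * x n := by
        simp only [hs]; rw [Finset.sum_range_succ]
      rw [Finset.sum_range_succ (fun k => η k * s k), Finset.sum_range_succ (fun k => η k * x k),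
        ← ih, h3, mul_add, ← mul_assoc, mul_div_cancel₀ _ hpos.ne', Finset.sum_range_succ]
      ring
  rw [wAvg, wAvg, ← h2 n, sub_div, mul_div_cancel_left₀ _ hn.ne']

end WeightedAverage

/-! ### Martingale differences with respect to countable partitions -/

section Partition

variable {Ω : Type*} [MeasurableSpace Ω] {P : Measure Ω} [IsProbabilityMeasure P]

/-- A function that is constant on the cells of a countable measurable partition is measurable. -/
lemma measurable_of_cells {C : Type*} [Countable C] {H : Ω → C}
    (hH : ∀ c, MeasurableSet (H ⁻¹' {c})) {G : Ω → ℝ}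
    (hG : ∀ ω ω', H ω = H ω' → G ω = G ω') : Measurable G := by
  intro s _
  have : G ⁻¹' s = ⋃ c ∈ {c | ∃ ω, H ω = c ∧ G ω ∈ s}, H ⁻¹' {c} := by
    ext ω
    simp only [Set.mem_preimage, Set.mem_ofPred_eq, Set.mem_iUnion, Set.mem_singleton_iff]
    constructor
    · exact fun h => ⟨H ω, ⟨ω, rfl, h⟩, rfl⟩
    · rintro ⟨c, ⟨ω', h1, h2⟩, h3⟩
      rwa [hG ω ω' (h3.trans h1.symm)]
  rw [this]
  exact MeasurableSet.biUnion (Set.to_countable _) fun c _ => hH c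

/-- If `ξ` has mean zero on each cell of a countable partition, then it is orthogonal to the
functions that are constant on the cells. -/
lemma integral_mul_eq_zero_of_cells {C : Type*} [Countable C] {H : Ω → C}
    (hH : ∀ c, MeasurableSet (H ⁻¹' {c})) {ξ G : Ω → ℝ} {b : ℝ} (hξ : Integrable ξ P)
    (hG : ∀ ω ω', H ω = H ω' → G ω = G ω') (hGb : ∀ ω, |G ω| ≤ b)
    (h0 : ∀ ω₀, ∫ ω in H ⁻¹' {H ω₀}, ξ ω ∂P = 0) : ∫ ω, G ω * ξ ω ∂P = 0 := by
  have hmeas : Measurable G := measurable_of_cells hH hG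
  have hint : Integrable (fun ω => G ω * ξ ω) P :=
    hξ.bdd_mul hmeas.aestronglyMeasurable (Eventually.of_forall hGb)
  have huniv : (Set.univ : Set Ω) = ⋃ c, H ⁻¹' {c} := by
    ext ω; simp
  rw [← setIntegral_univ, huniv, integral_iUnion hH ?_ (by rw [← huniv]; exact hint.integrableOn)]
  · rw [← tsum_zero]
    congr 1
    ext c
    by_cases hc : ∃ ω₀, H ω₀ = c
    · obtain ⟨ω₀, rfl⟩ := hc
      rw [setIntegral_congr_fun (g := fun ω => G ω₀ * ξ ω) (hH _)
        fun ω hω => by simp only; rw [hG ω ω₀ hω], integral_const_mul, h0, mul_zero]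
    · have : H ⁻¹' {c} = ∅ := by
        ext ω; simp only [Set.mem_preimage, Set.mem_singleton_iff, Set.mem_empty_iff_false]
        exact iff_of_false (fun h => hc ⟨ω, h⟩) not_false
      rw [this, setIntegral_empty]
  · intro c c' hcc
    exact Disjoint.preimage H (Set.disjoint_singleton.2 hcc)

/-- The filtration generated by refining partitions. -/
def cellFiltration {C : ℕ → Type*} [∀ k, Countable (C k)] (H : ∀ k, Ω → C k)
    (hH : ∀ k c, MeasurableSet (H k ⁻¹' {c}))
    (href : ∀ k ω ω', H (k + 1) ω = H (k + 1) ω' → H k ω = H k ω') :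
    Filtration ℕ (inferInstance : MeasurableSpace Ω) where
  seq k := MeasurableSpace.comap (H k) ⊤
  mono' := by
    refine monotone_nat_of_le_succ fun k => ?_
    rintro s ⟨B, -, rfl⟩
    refine ⟨H (k + 1) '' (H k ⁻¹' B), trivial, ?_⟩
    ext ω
    constructor
    · rintro ⟨ω', h1, h2⟩
      rw [Set.mem_preimage, ← href k ω' ω h2]
      exact h1
    · exact fun h => ⟨ω, h, rfl⟩
  le' k := by
    rintro s ⟨B, -, rfl⟩
    have : H k ⁻¹' B = ⋃ c ∈ B, H k ⁻¹' {c} := by ext ω; simp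
    rw [this]
    exact MeasurableSet.biUnion (Set.to_countable _) fun c _ => hH k c

/-- Bounded martingale differences with square summable coefficients form an almost surely
convergent series. -/
lemma ae_exists_tendsto_sum_of_cells {C : ℕ → Type*} [∀ k, Countable (C k)] {H : ∀ k, Ω → C k}
    (hH : ∀ k c, MeasurableSet (H k ⁻¹' {c}))
    (href : ∀ k ω ω', H (k + 1) ω = H (k + 1) ω' → H k ω = H k ω')
    {ξ : ℕ → Ω → ℝ} {b : ℝ} (hξb : ∀ k ω, |ξ k ω| ≤ b)
    (hξ : ∀ k ω ω', H (k + 1) ω = H (k + 1) ω' → ξ k ω = ξ k ω')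
    (h0 : ∀ k ω₀, ∫ ω in H k ⁻¹' {H k ω₀}, ξ k ω ∂P = 0)
    {c : ℕ → ℝ} (hc : Summable fun k => c k ^ 2) :
    ∀ᵐ ω ∂P, ∃ l, Tendsto (fun n => ∑ k ∈ Finset.range n, c k * ξ k ω) atTop (𝓝 l) := by
  set F := cellFiltration H hH href with hF
  set X : ℕ → Ω → ℝ := fun n ω => ∑ k ∈ Finset.range n, c k * ξ k ω with hX
  have hrefle : ∀ k l, k ≤ l → ∀ ω ω', H l ω = H l ω' → H k ω = H k ω' := by
    intro k l hkl
    induction l, hkl using Nat.le_induction with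
    | base => exact fun _ _ h => h
    | succ l _ ih => exact fun ω ω' h => ih ω ω' (href l ω ω' h)
  have hXconst : ∀ n ω ω', H n ω = H n ω' → X n ω = X n ω' := by
    intro n ω ω' h
    refine Finset.sum_congr rfl fun k hk => ?_
    rw [hξ k ω ω' (hrefle (k + 1) n (Finset.mem_range.1 hk) ω ω' h)]
  have hadapt : ∀ n (f : Ω → ℝ), (∀ ω ω', H n ω = H n ω' → f ω = f ω') →
      Measurable[F n] f := by
    intro n f hf s _
    refine ⟨H n '' (f ⁻¹' s), trivial, ?_⟩
    ext ω
    constructor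
    · rintro ⟨ω', h1, h2⟩
      rw [Set.mem_preimage, ← hf ω' ω h2]
      exact h1
    · exact fun h => ⟨ω, h, rfl⟩
  have hmeasξ : ∀ k, Measurable (ξ k) := fun k => (hadapt (k + 1) (ξ k) (hξ k)).mono (F.le _) le_rfl
  have hintξ : ∀ k, Integrable (ξ k) P := fun k =>
    Integrable.of_bound (hmeasξ k).aestronglyMeasurable b (Eventually.of_forall (hξb k))
  have hXb : ∀ n ω, |X n ω| ≤ ∑ k ∈ Finset.range n, |c k| * b := fun n ω =>
    (Finset.abs_sum_le_sum_abs _ _).trans (Finset.sum_le_sum fun k _ => by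
      rw [abs_mul]; exact mul_le_mul_of_nonneg_left (hξb k ω) (abs_nonneg _))
  have hmeasX : ∀ n, Measurable (X n) := fun n => (hadapt n (X n) (hXconst n)).mono (F.le _) le_rfl
  have hintX : ∀ n, Integrable (X n) P := fun n =>
    Integrable.of_bound (hmeasX n).aestronglyMeasurable _ (Eventually.of_forall (hXb n))
  have hmart : Martingale X F P := by
    refine martingale_of_setIntegral_eq_succ
      (fun n => (hadapt n (X n) (hXconst n)).stronglyMeasurable) hintX fun n s hs => ?_
    have h1 : ∀ ω, X (n + 1) ω = X n ω + c n * ξ n ω := fun ω => Finset.sum_range_succ _ _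
    simp only [h1]
    rw [integral_add (hintX n).integrableOn ((hintξ n).const_mul _).integrableOn,
      integral_const_mul]
    have h2 : ∫ ω in s, ξ n ω ∂P = 0 := by
      rw [← integral_indicator (F.le n s hs)]
      have h3 : ∀ ω, s.indicator (ξ n) ω = s.indicator (fun _ => (1 : ℝ)) ω * ξ n ω := by
        intro ω; by_cases h : ω ∈ s <;> simp [h]
      simp only [h3]
      refine integral_mul_eq_zero_of_cells (hH n) (hintξ n) (b := 1) ?_ ?_ (h0 n)
      · intro ω ω' h
        obtain ⟨B, -, rfl⟩ := hs
        have h4 : (ω ∈ H n ⁻¹' B) ↔ (ω' ∈ H n ⁻¹' B) := by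
          rw [Set.mem_preimage, Set.mem_preimage, h]
        by_cases h5 : ω ∈ H n ⁻¹' B
        · rw [Set.indicator_of_mem h5, Set.indicator_of_mem (h4.1 h5)]
        · rw [Set.indicator_of_notMem h5, Set.indicator_of_notMem fun h6 => h5 (h4.2 h6)]
      · intro ω
        by_cases h : ω ∈ s <;> simp [h]
    rw [h2, mul_zero, add_zero]
  -- the martingale is bounded in `L²`, since its increments are orthogonal
  have hL2 : ∀ n, ∫ ω, X n ω ^ 2 ∂P ≤ b ^ 2 * ∑ k ∈ Finset.range n, c k ^ 2 := by
    intro n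
    induction n with
    | zero => simp [hX]
    | succ n ih =>
      have h1 : ∀ ω, X (n + 1) ω ^ 2 =
          X n ω ^ 2 + (2 * c n) * (X n ω * ξ n ω) + c n ^ 2 * ξ n ω ^ 2 := fun ω => by
        have : X (n + 1) ω = X n ω + c n * ξ n ω := Finset.sum_range_succ _ _
        rw [this]; ring
      have hi1 : Integrable (fun ω => X n ω ^ 2) P := by
        refine Integrable.of_bound ((hmeasX n).pow_const 2).aestronglyMeasurable
          ((∑ k ∈ Finset.range n, |c k| * b) ^ 2) (Eventually.of_forall fun ω => ?_)
        rw [Real.norm_eq_abs, abs_pow]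
        exact pow_le_pow_left₀ (abs_nonneg _) (hXb n ω) 2
      have hi2 : Integrable (fun ω => X n ω * ξ n ω) P :=
        (hintξ n).bdd_mul (hmeasX n).aestronglyMeasurable (Eventually.of_forall (hXb n))
      have hle : ∀ ω, ξ n ω ^ 2 ≤ b ^ 2 := fun ω => by
        rw [← sq_abs]; exact pow_le_pow_left₀ (abs_nonneg _) (hξb n ω) 2
      have hi3 : Integrable (fun ω => ξ n ω ^ 2) P := by
        refine Integrable.of_bound ((hmeasξ n).pow_const 2).aestronglyMeasurable
          (b ^ 2) (Eventually.of_forall fun ω => ?_)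
        rw [Real.norm_eq_abs, abs_of_nonneg (sq_nonneg _)]
        exact hle ω
      simp only [h1]
      have hi12 : Integrable (fun ω => X n ω ^ 2 + (2 * c n) * (X n ω * ξ n ω)) P :=
        hi1.add (hi2.const_mul _)
      rw [integral_add hi12 (hi3.const_mul _),
        integral_add hi1 (hi2.const_mul _), integral_const_mul, integral_const_mul,
        integral_mul_eq_zero_of_cells (hH n) (hintξ n) (hXconst n) (hXb n) (h0 n),
        Finset.sum_range_succ, mul_add]
      have h2 : ∫ ω, ξ n ω ^ 2 ∂P ≤ b ^ 2 := by
        have := integral_mono hi3 (integrable_const (b ^ 2)) hle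
        simpa using this
      nlinarith [mul_le_mul_of_nonneg_left h2 (sq_nonneg (c n))]
  refine hmart.submartingale.exists_ae_tendsto_of_bdd
    (R := (1 + b ^ 2 * ∑' k, c k ^ 2).toNNReal) fun n => ?_
  rw [eLpNorm_one_eq_lintegral_enorm, ← ofReal_integral_norm_eq_lintegral_enorm (hintX n)]
  refine ENNReal.ofReal_le_ofReal ?_
  have hi1 : Integrable (fun ω => X n ω ^ 2) P := by
    refine Integrable.of_bound ((hmeasX n).pow_const 2).aestronglyMeasurable
      ((∑ k ∈ Finset.range n, |c k| * b) ^ 2) (Eventually.of_forall fun ω => ?_)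
    rw [Real.norm_eq_abs, abs_pow]
    exact pow_le_pow_left₀ (abs_nonneg _) (hXb n ω) 2
  calc ∫ ω, ‖X n ω‖ ∂P ≤ ∫ ω, (1 + X n ω ^ 2) ∂P := by
        refine integral_mono (hintX n).norm ((integrable_const _).add hi1) fun ω => ?_
        simp only [Real.norm_eq_abs]
        nlinarith [sq_nonneg (|X n ω| - 1), sq_abs (X n ω), abs_nonneg (X n ω)]
    _ = 1 + ∫ ω, X n ω ^ 2 ∂P := by rw [integral_add (integrable_const _) hi1]; simp
    _ ≤ _ := by
        gcongr
        refine (hL2 n).trans (mul_le_mul_of_nonneg_left ?_ (sq_nonneg b))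
        exact hc.sum_le_tsum _ fun k _ => sq_nonneg _

/-- The mean of `X` over the cell of `ω`. -/
def cellMean {C : Type*} (P : Measure Ω) (H : Ω → C) (X : Ω → ℝ) (ω : Ω) : ℝ :=
  (∫ ω' in H ⁻¹' {H ω}, X ω' ∂P) / P.real (H ⁻¹' {H ω})

lemma abs_cellMean_le {C : Type*} {H : Ω → C} {X : Ω → ℝ} {b : ℝ} (hb0 : 0 ≤ b)
    (hb : ∀ ω, |X ω| ≤ b) (ω : Ω) : |cellMean P H X ω| ≤ b := by
  rw [cellMean, abs_div, abs_of_nonneg measureReal_nonneg]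
  refine div_le_of_le_mul₀ measureReal_nonneg hb0 ?_
  exact norm_setIntegral_le_of_norm_le_const (f := X) (measure_lt_top P _) (fun ω _ => hb ω)

/-- The law of large numbers for weighted averages, with conditioning `l` steps back. -/
lemma ae_tendsto_wAvg_sub_cellMean {C : ℕ → Type*} [∀ k, Countable (C k)] {H : ∀ k, Ω → C k}
    (hH : ∀ k c, MeasurableSet (H k ⁻¹' {c}))
    (href : ∀ k ω ω', H (k + 1) ω = H (k + 1) ω' → H k ω = H k ω')
    {X : ℕ → Ω → ℝ} {b : ℝ} (hXb : ∀ k ω, |X k ω| ≤ b)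
    (hX : ∀ k ω ω', H (k + 1) ω = H (k + 1) ω' → X k ω = X k ω')
    {η : ℕ → ℝ} (hη : ∀ k, 0 < η k) (hdiv : ¬ Summable η)
    (hsq : Summable fun k => (η k / ∑ l ∈ Finset.range (k + 1), η l) ^ 2) (l : ℕ) :
    ∀ᵐ ω ∂P, Tendsto (wAvg η fun k => X (k - l) ω - cellMean P (H (k - l)) (X (k - l)) ω)
      atTop (𝓝 0) := by
  have hb0 : 0 ≤ b := by
    obtain ⟨ω⟩ := P.nonempty_of_neZero
    exact (abs_nonneg _).trans (hXb 0 ω)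
  have hmeasX : ∀ k, Measurable (X k) := fun k => measurable_of_cells (hH (k + 1)) (hX k)
  have hintX : ∀ k, Integrable (X k) P := fun k =>
    Integrable.of_bound (hmeasX k).aestronglyMeasurable b (Eventually.of_forall (hXb k))
  have hcell : ∀ k ω ω', H k ω = H k ω' →
      cellMean P (H k) (X k) ω = cellMean P (H k) (X k) ω' := fun k ω ω' h => by
    simp only [cellMean, h]
  have h1 := ae_exists_tendsto_sum_of_cells (P := P) hH href
    (ξ := fun k ω => X k ω - cellMean P (H k) (X k) ω) (b := b + b)
    (fun k ω => (abs_sub _ _).trans (add_le_add (hXb k ω) (abs_cellMean_le hb0 (hXb k) ω)))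
    (fun k ω ω' h => by rw [hX k ω ω' h, hcell k ω ω' (href k ω ω' h)])
    (fun k ω₀ => ?_) (c := fun k => η (k + l) / ∑ j ∈ Finset.range (k + l + 1), η j)
    ((summable_nat_add_iff l).2 hsq)
  · filter_upwards [h1] with ω ⟨a, ha⟩
    set x : ℕ → ℝ := fun k => X (k - l) ω - cellMean P (H (k - l)) (X (k - l)) ω with hx
    have h2 : Tendsto (fun n => ∑ k ∈ Finset.range n,
        η k / (∑ j ∈ Finset.range (k + 1), η j) * x k) atTop
        (𝓝 ((∑ k ∈ Finset.range l, η k / (∑ j ∈ Finset.range (k + 1), η j) * x k) + a)) := by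
      rw [← tendsto_add_atTop_iff_nat l]
      refine (ha.const_add _).congr fun n => ?_
      rw [add_comm n l, Finset.sum_range_add]
      congr 1
      refine Finset.sum_congr rfl fun k _ => ?_
      simp only [hx, add_comm l k]
      rw [Nat.add_sub_cancel]
    exact tendsto_wAvg_of_summable hη hdiv h2
  · have h3 : ∀ ω ∈ H k ⁻¹' {H k ω₀}, X k ω - cellMean P (H k) (X k) ω =
        X k ω - cellMean P (H k) (X k) ω₀ := fun ω hω => by rw [hcell k ω ω₀ hω]
    rw [setIntegral_congr_fun (hH k _) h3, integral_sub (hintX k).integrableOn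
      (integrable_const _).integrableOn, setIntegral_const, smul_eq_mul]
    rcases eq_or_ne (P.real (H k ⁻¹' {H k ω₀})) 0 with h | h
    · have : P (H k ⁻¹' {H k ω₀}) = 0 := (measureReal_eq_zero_iff).1 h
      rw [h, zero_mul, sub_zero, Measure.restrict_eq_zero.2 this, integral_zero_measure]
    · rw [cellMean, mul_div_cancel₀ _ h, sub_self]

/-- The cells of measure zero of a countable partition are irrelevant. -/
lemma ae_cell_pos {C : Type*} [Countable C] {H : Ω → C} :
    ∀ᵐ ω ∂P, 0 < P.real (H ⁻¹' {H ω}) := by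
  have h : ∀ c, ∀ᵐ ω ∂P, H ω = c → 0 < P.real (H ⁻¹' {c}) := by
    intro c
    by_cases hc : P (H ⁻¹' {c}) = 0
    · have : ∀ᵐ ω ∂P, ω ∉ H ⁻¹' {c} := measure_eq_zero_iff_ae_notMem.1 hc
      filter_upwards [this] with ω hω h1
      exact absurd h1 hω
    · exact Eventually.of_forall fun ω _ => ENNReal.toReal_pos hc (measure_ne_top _ _)
  filter_upwards [ae_all_iff.2 h] with ω hω
  exact hω _ rfl

end Partition

/-! ### Averages along a process with asymptotically known transitions -/

section Ergodic

variable {E : Type*} [Fintype E] [DecidableEq E] {η : ℕ → ℝ}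

/-- The average of `ψ` along a process `Z` can be replaced by that of the iterates of `ψ` under the
kernel `B`, however the weights vary: conditioning goes back `m` steps, and the weights stay where
they are. -/
theorem eventually_abs_wAvg_sub_le_of_iterate (hη : ∀ k, 0 < η k) (hdiv : ¬ Summable η)
    {Z : ℕ → E} {e : ℕ → E → ℝ} {B : E → E → ℝ}
    (h1 : ∀ l z, Tendsto (wAvg η fun k => (if Z (k - l + 1) = z then 1 else 0) - e (k - l) z)
      atTop (𝓝 0))
    (h2 : ∀ z, Tendsto (fun k => e k z - B (Z k) z) atTop (𝓝 0))
    {ψ : E → ℝ} {m : ℕ} {v β β' : ℝ} (hβ : ∀ z, |(applyKernel B)^[m] ψ z - v| ≤ β)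
    (hβ' : β < β') : ∀ᶠ n in atTop, |wAvg η (fun k => ψ (Z k)) n - v| ≤ β' := by
  have hstep : ∀ (φ : E → ℝ) l, Tendsto (wAvg η fun k =>
      φ (Z (k - l + 1)) - applyKernel B φ (Z (k - l))) atTop (𝓝 0) := by
    intro φ l
    have h3 : Tendsto (fun n => ∑ z, (wAvg η (fun k => (if Z (k - l + 1) = z then 1 else 0) -
        e (k - l) z) n + wAvg η (fun k => e (k - l) z - B (Z (k - l)) z) n) * φ z) atTop
        (𝓝 (∑ z : E, (0 + 0) * φ z)) := by
      refine tendsto_finsetSum _ fun z _ => ((h1 l z).add ?_).mul_const _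
      exact tendsto_wAvg_zero hη hdiv ((h2 z).comp (tendsto_sub_atTop_nat l))
    simp only [add_zero, zero_mul, Finset.sum_const_zero] at h3
    refine h3.congr fun n => ?_
    simp only [← wAvg_add, ← wAvg_mul_const, ← wAvg_sum, sub_add_sub_cancel]
    congr 1
    ext k
    simp [sub_mul, Finset.sum_sub_distrib, applyKernel]
  have hiter : ∀ m, Tendsto (wAvg η fun k =>
      ψ (Z k) - (applyKernel B)^[m] ψ (Z (k - m))) atTop (𝓝 0) := by
    intro m
    induction m with
    | zero => exact tendsto_wAvg_zero hη hdiv (by simp)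
    | succ m ih =>
      have h3 : Tendsto (wAvg η fun k => (applyKernel B)^[m] ψ (Z (k - m)) -
          (applyKernel B)^[m] ψ (Z (k - (m + 1) + 1))) atTop (𝓝 0) := by
        refine tendsto_wAvg_zero hη hdiv (tendsto_const_nhds.congr' ?_)
        filter_upwards [eventually_ge_atTop (m + 1)] with k hk
        rw [show k - (m + 1) + 1 = k - m by omega, sub_self]
      have h4 := (ih.add h3).add (hstep ((applyKernel B)^[m] ψ) (m + 1))
      simp only [← wAvg_add, sub_add_sub_cancel, add_zero] at h4
      simpa only [Function.iterate_succ_apply'] using h4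
  have h5 : ∀ᶠ n in atTop,
      |wAvg η (fun k => (applyKernel B)^[m] ψ (Z (k - m))) n - v| ≤ (β + β') / 2 :=
    eventually_abs_wAvg_sub_le hη hdiv (Eventually.of_forall fun k => hβ _) (by linarith)
  have h6 := (hiter m).abs
  rw [abs_zero] at h6
  filter_upwards [h5, h6.eventually (ge_mem_nhds (show 0 < (β' - β) / 2 by linarith))]
    with n hn1 hn2
  rw [wAvg_sub] at hn2
  calc |wAvg η (fun k => ψ (Z k)) n - v| ≤ _ := abs_sub_le _ _ _
    _ ≤ (β' - β) / 2 + (β + β') / 2 := add_le_add hn2 hn1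
    _ = β' := by ring

end Ergodic

/-! ### The Markov property of the play -/

section Play

variable {ι : Type*} [Fintype ι] [DecidableEq ι] {S A : ι → Type*}
  [∀ i, Fintype (S i)] [∀ i, DecidableEq (S i)] [∀ i, Nonempty (S i)]
  [∀ i, Fintype (A i)] [∀ i, DecidableEq (A i)] [∀ i, Nonempty (A i)]

/-- The probability that the joint step `z` is followed by `z'` when the policies `π` are used. -/
def stepProb (P : ∀ i, TransitionModel (S i) (A i)) (π : ∀ i, StationaryPolicy (S i) (A i))
    (z z' : JointStep S A) : ℝ :=
  ∏ i, nextLaw P z i (z'.1 i) * π i (z'.1 i) (z'.2 i)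

lemma stepLaw_singleton (q : ∀ i, stdSimplex ℝ (S i)) (π : ∀ i, StationaryPolicy (S i) (A i))
    (z : JointStep S A) :
    stepLaw q π {z} = ENNReal.ofReal (∏ i, q i (z.1 i) * π i (z.1 i) (z.2 i)) := by
  classical
  simp only [stepLaw, Measure.finsetSum_apply, Measure.smul_apply, smul_eq_mul]
  rw [Finset.sum_eq_single z]
  · simp [jointProb, Finset.prod_mul_distrib]
  · intro y _ hy
    simp [hy]
  · simp

/-- The event `E` depends only on the steps before time `n`. -/
def DependsBefore (n : ℕ) (E : Set (ℕ → JointStep S A)) : Prop :=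
  ∀ ω ω', (∀ t < n, ω t = ω' t) → ω ∈ E → ω' ∈ E

lemma DependsBefore.eq_preimage {n : ℕ} {E : Set (ℕ → JointStep S A)}
    (hE : DependsBefore (n + 1) E) :
    E = Preorder.frestrictLe n ⁻¹' (Preorder.frestrictLe (π := fun _ => JointStep S A) n '' E) := by
  ext ω
  constructor
  · exact fun h => ⟨ω, h, rfl⟩
  · rintro ⟨ω', h1, h2⟩
    refine hE ω' ω (fun t ht => ?_) h1
    exact congrFun h2 ⟨t, Finset.mem_Iic.2 (Nat.lt_succ_iff.1 ht)⟩

lemma DependsBefore.mono {m n : ℕ} {E : Set (ℕ → JointStep S A)} (hE : DependsBefore m E)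
    (hmn : m ≤ n) : DependsBefore n E :=
  fun ω ω' h => hE ω ω' fun t ht => h t (ht.trans_le hmn)

lemma DependsBefore.measurableSet {n : ℕ} {E : Set (ℕ → JointStep S A)}
    (hE : DependsBefore n E) : MeasurableSet E := by
  rw [(hE.mono n.le_succ).eq_preimage]
  exact (Preorder.measurable_frestrictLe n) (Set.to_countable _).measurableSet

lemma measurableSet_apply_eq (n : ℕ) (z : JointStep S A) :
    MeasurableSet {ω : ℕ → JointStep S A | ω n = z} :=
  DependsBefore.measurableSet (n := n + 1) fun ω ω' h hω => by
    rw [Set.mem_ofPred_eq] at hω ⊢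
    rw [← h n n.lt_succ_self, hω]

variable {G : StochasticGame S A} {s₀ : ∀ i, S i}
  {σ : ℕ → (ℕ → JointStep S A) → ∀ i, StationaryPolicy (S i) (A i)}

instance : IsProbabilityMeasure (playLaw G s₀ σ) := by
  unfold playLaw; infer_instance

/-- The Markov property of the play. -/
lemma playLaw_real_inter_next (hσ : ∀ t ω ω', (∀ u < t, ω u = ω' u) → σ t ω = σ t ω') {n : ℕ}
    {E : Set (ℕ → JointStep S A)} (hE : DependsBefore (n + 1) E) {z : JointStep S A}
    {π : ∀ i, StationaryPolicy (S i) (A i)} (hz : ∀ ω ∈ E, ω n = z)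
    (hπ : ∀ ω ∈ E, σ (n + 1) ω = π) (z' : JointStep S A) :
    (playLaw G s₀ σ).real (E ∩ {ω | ω (n + 1) = z'}) =
      (playLaw G s₀ σ).real E * stepProb G.P π z z' := by
  set E' := Preorder.frestrictLe (π := fun _ => JointStep S A) n '' E with hE'
  have hEE : E = Preorder.frestrictLe n ⁻¹' E' := hE.eq_preimage
  have hmE' : MeasurableSet E' := (Set.to_countable _).measurableSet
  have h1 := Kernel.map_frestrictLe_trajMeasure_compProd_eq_map_trajMeasure
    (X := fun _ => JointStep S A)
    (μ₀ := stepLaw (fun i => ⟨Pi.single (s₀ i) 1, single_mem_stdSimplex ℝ _⟩)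
      (σ 0 fun _ => (s₀, fun _ => Classical.arbitrary _)))
    (κ := stepKernel G σ) (a := n)
  have h2 := congrArg (fun m => m (E' ×ˢ {z'})) h1
  have hms : MeasurableSet (E' ×ˢ ({z'} : Set (JointStep S A))) :=
    hmE'.prod (measurableSet_singleton z')
  rw [Measure.compProd_apply_prod hmE' (measurableSet_singleton z'),
    Measure.map_apply (by fun_prop) hms] at h2
  have h3 : ∀ h ∈ E', stepKernel G σ n h {z'} = ENNReal.ofReal (stepProb G.P π z z') := by
    rintro h ⟨ω, hω, rfl⟩
    have hext : ∀ u < n + 1, extendHistory (Preorder.frestrictLe n ω) u = ω u := fun u hu => by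
      rw [extendHistory, dif_pos (Finset.mem_Iic.2 (Nat.lt_succ_iff.1 hu))]
      rfl
    have h4 : extendHistory (Preorder.frestrictLe n ω) n = z := by
      rw [hext n (Nat.lt_succ_self n), hz ω hω]
    have h5 : σ (n + 1) (extendHistory (Preorder.frestrictLe n ω)) = π := by
      rw [hσ (n + 1) _ ω hext, hπ ω hω]
    change stepLaw _ _ {z'} = _
    rw [h4, h5, stepLaw_singleton]
    rfl
  rw [setLIntegral_congr_fun hmE' h3, setLIntegral_const,
    Measure.map_apply (by fun_prop) hmE', ← hEE] at h2
  have h6 : (fun x : ℕ → JointStep S A => (Preorder.frestrictLe n x, x (n + 1))) ⁻¹' E' ×ˢ {z'} =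
      E ∩ {ω | ω (n + 1) = z'} := by
    rw [hEE]; rfl
  rw [h6] at h2
  have h7 : 0 ≤ stepProb G.P π z z' := Finset.prod_nonneg fun i _ =>
    mul_nonneg (nextLaw_nonneg z i _) ((π i _).2.1 _)
  rw [measureReal_def, measureReal_def]
  change (playLaw G s₀ σ _).toReal = _
  unfold playLaw
  rw [← h2, ENNReal.toReal_mul, ENNReal.toReal_ofReal h7, mul_comm]

end Play

/-! ### The payoff of stationary policies -/

section Payoff

open Matrix

variable {ι : Type*} [Fintype ι] [DecidableEq ι] {S A : ι → Type*}
  [∀ i, Fintype (S i)] [∀ i, DecidableEq (S i)] [∀ i, Nonempty (S i)]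
  [∀ i, Fintype (A i)] [∀ i, DecidableEq (A i)] [∀ i, Nonempty (A i)]
  {P : ∀ i, TransitionModel (S i) (A i)} {π : ∀ i, StationaryPolicy (S i) (A i)}

lemma applyKernel_stepProb (φ : JointStep S A → ℝ) (z : JointStep S A) :
    applyKernel (stepProb P π) φ z = avgValue φ (pairLaw P π (nextLaw P z) 0) := by
  simp only [applyKernel, avgValue, pairLaw, pow_zero, Matrix.vecMul_one, stepProb]
  exact Finset.sum_congr rfl fun z' _ => mul_comm _ _

lemma avgValue_applyKernel_stepProb (φ : JointStep S A → ℝ) (κ : ∀ i, S i → ℝ) (t : ℕ) :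
    avgValue (applyKernel (stepProb P π) φ) (pairLaw P π κ t) =
      avgValue φ (pairLaw P π κ (t + 1)) := by
  simp only [applyKernel, avgValue, Finset.sum_mul]
  rw [Finset.sum_comm]
  refine Finset.sum_congr rfl fun z' _ => ?_
  have h1 : ∀ i, ∑ u : S i × A i, pairLaw P π κ t i u *
      ((P i u.1 u.2 : S i → ℝ) (z'.1 i) * π i (z'.1 i) (z'.2 i)) =
      pairLaw P π κ (t + 1) i (z'.1 i, z'.2 i) := by
    intro i
    rw [pairLaw, pow_succ, ← Matrix.vecMul_vecMul, Matrix.vecMul, dotProduct, Finset.sum_mul,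
      Fintype.sum_prod_type]
    refine Finset.sum_congr rfl fun x _ => ?_
    rw [chains_apply, Finset.mul_sum, Finset.sum_mul]
    refine Finset.sum_congr rfl fun b _ => ?_
    simp only [pairLaw]
    ring
  simp only [← h1, ← sum_jointStep_prod, Finset.mul_sum]
  refine Finset.sum_congr rfl fun z _ => ?_
  rw [Finset.prod_mul_distrib, stepProb]
  simp only [nextLaw]
  ring

lemma iterate_applyKernel_stepProb (φ : JointStep S A → ℝ) (z : JointStep S A) (m : ℕ) :
    (applyKernel (stepProb P π))^[m + 1] φ z = avgValue φ (pairLaw P π (nextLaw P z) m) := by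
  induction m generalizing φ with
  | zero => exact applyKernel_stepProb φ z
  | succ m ih => rw [Function.iterate_succ_apply, ih, avgValue_applyKernel_stepProb]

/-- After many steps the joint law is close to the stationary one, from any initial step. -/
lemma exists_iterate_stepProb_close {c : ℝ} (hc0 : 0 ≤ c) (hc1 : c < 1)
    (hK : ∀ i, IsContractingChain (chains P π i) c) {μ : ∀ i, S i → ℝ}
    (hμ1 : ∀ i, ∑ x, μ i x = 1) (hμ : ∀ i, μ i ᵥ* chains P π i = μ i)
    (φ : JointStep S A → ℝ) {γ : ℝ} (hγ : 0 < γ) :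
    ∃ m, ∀ z, |(applyKernel (stepProb P π))^[m] φ z -
      avgValue φ (fun j v => μ j v.1 * π j v.1 v.2)| ≤ γ := by
  have h1 : ∀ z, Tendsto (fun m => avgValue φ (pairLaw P π (nextLaw P z) m)) atTop
      (𝓝 (avgValue φ fun j v => μ j v.1 * π j v.1 v.2)) := fun z =>
    tendsto_finsetSum _ fun z' _ => tendsto_const_nhds.mul <| tendsto_finsetProd _ fun i _ =>
      ((hK i).tendsto_vecMul_pow hc0 hc1 (sum_nextLaw z i) (hμ1 i) (hμ i) _).mul_const _
  have h2 : ∀ z, ∀ᶠ m in atTop, |avgValue φ (pairLaw P π (nextLaw P z) m) -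
      avgValue φ (fun j v => μ j v.1 * π j v.1 v.2)| ≤ γ := fun z => by
    have := ((h1 z).sub_const (avgValue φ fun j v => μ j v.1 * π j v.1 v.2)).abs
    rw [sub_self, abs_zero] at this
    exact this.eventually (ge_mem_nhds hγ)
  obtain ⟨m, hm⟩ := (eventually_all.2 h2).exists
  exact ⟨m + 1, fun z => by rw [iterate_applyKernel_stepProb]; exact hm z⟩

lemma wAvg_one (x : ℕ → ℝ) (n : ℕ) :
    wAvg (fun _ => 1) x n = 1 / (n : ℝ) * ∑ k ∈ Finset.range n, x k := by
  simp [wAvg, div_eq_inv_mul]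

lemma not_summable_one : ¬ Summable fun _ : ℕ => (1 : ℝ) := fun h => by
  simpa using h.tendsto_atTop_zero

lemma summable_one_div_sq :
    Summable fun k : ℕ => ((1 : ℝ) / ∑ _l ∈ Finset.range (k + 1), (1 : ℝ)) ^ 2 := by
  have h : Summable fun k : ℕ => (1 : ℝ) / ((k : ℝ)) ^ 2 :=
    Real.summable_one_div_nat_pow.2 one_lt_two
  refine ((summable_nat_add_iff 1).2 h).congr fun k => ?_
  simp

/-- In a uniformly ergodic game the payoff is the expected reward of one time instance under the
stationary laws. -/
theorem payoff_eq_avgValue (G : StochasticGame S A) (s₀ : ∀ i, S i) {τ : ℝ} (hτ : 0 < τ)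
    (hG : ∀ i, UniformlyErgodic (G.P i) τ) (i : ι) (π : ∀ i, StationaryPolicy (S i) (A i))
    {μ : ∀ i, S i → ℝ} (hμ1 : ∀ i, ∑ x, μ i x = 1)
    (hμ : ∀ i, μ i ᵥ* chains G.P π i = μ i) :
    payoff G s₀ i π =
      avgValue (fun z => G.r i z.1 z.2) (fun j v => μ j v.1 * π j v.1 v.2) := by
  classical
  set v := avgValue (fun z => G.r i z.1 z.2) (fun j v => μ j v.1 * π j v.1 v.2) with hv
  set Q := playLaw G s₀ fun _ _ => π with hQ
  have hc1 : Real.exp (-1 / τ) < 1 := Real.exp_lt_one_iff.2 (div_neg_of_neg_of_pos (by norm_num) hτ)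
  have hK : ∀ j, IsContractingChain (chains G.P π j) (Real.exp (-1 / τ)) :=
    fun j => (hG j).isContractingChain (π j)
  set H : ∀ k : ℕ, (ℕ → JointStep S A) → (Finset.Iic k → JointStep S A) :=
    fun k => Preorder.frestrictLe k
  have hcell : ∀ k (ω : ℕ → JointStep S A), DependsBefore (k + 1) (H k ⁻¹' {H k ω}) := by
    intro k ω ω₁ ω₂ h12 h1
    rw [Set.mem_preimage, Set.mem_singleton_iff] at h1 ⊢
    rw [← h1]
    ext ⟨t, ht⟩
    exact (h12 t (Nat.lt_succ_iff.2 (Finset.mem_Iic.1 ht))).symm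
  have heq : ∀ k (ω ω' : ℕ → JointStep S A), H k ω = H k ω' → ∀ t ≤ k, ω t = ω' t :=
    fun k ω ω' h t ht => congrFun h ⟨t, Finset.mem_Iic.2 ht⟩
  have hH : ∀ k c, MeasurableSet (H k ⁻¹' {c}) := fun k c =>
    Preorder.measurable_frestrictLe k (Set.to_countable _).measurableSet
  have h1 : ∀ z l, ∀ᵐ ω ∂Q, Tendsto (wAvg (fun _ => 1) fun k =>
      (if ω (k - l + 1) = z then (1 : ℝ) else 0) - cellMean Q (H (k - l))
        (fun ω => if ω (k - l + 1) = z then (1 : ℝ) else 0) ω) atTop (𝓝 0) := by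
    intro z l
    refine ae_tendsto_wAvg_sub_cellMean (P := Q) (H := H) hH ?_
      (X := fun k ω => if ω (k + 1) = z then (1 : ℝ) else 0) (b := 1) ?_ ?_
      (fun _ => one_pos) not_summable_one summable_one_div_sq l
    · intro k ω ω' h
      ext ⟨t, ht⟩
      exact heq (k + 1) ω ω' h t ((Finset.mem_Iic.1 ht).trans k.le_succ)
    · intro k ω
      split_ifs <;> simp
    · intro k ω ω' h
      rw [heq (k + 1) ω ω' h (k + 1) le_rfl]
  have h2 : ∀ k, ∀ᵐ ω ∂Q, 0 < Q.real (H k ⁻¹' {H k ω}) := fun k => ae_cell_pos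
  -- the payoff is defined by an upper limit, which is a limit almost surely
  have hlim : ∀ᵐ ω ∂Q, limsup (fun T : ℕ => 1 / (T : ℝ) *
      ∑ t ∈ Finset.range (T + 1), G.r i (ω t).1 (ω t).2) atTop = v := by
    filter_upwards [ae_all_iff.2 h2, ae_all_iff.2 fun z => ae_all_iff.2 (h1 z)] with ω hω1 hω2
    have h3 : ∀ k z, cellMean Q (H k) (fun ω => if ω (k + 1) = z then (1 : ℝ) else 0) ω =
        stepProb G.P π (ω k) z := by
      intro k z
      have h4 := playLaw_real_inter_next (G := G) (s₀ := s₀) (σ := fun _ _ => π)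
        (fun _ _ _ _ => rfl) (hcell k ω) (z := ω k) (π := π)
        (fun ω' hω' => heq k ω' ω hω' k le_rfl) (fun _ _ => rfl) z
      have h5 : (fun ω : ℕ → JointStep S A => if ω (k + 1) = z then (1 : ℝ) else 0) =
          Set.indicator {ω | ω (k + 1) = z} fun _ => 1 := by
        ext ω'; simp [Set.indicator_apply]
      have hm : MeasurableSet {ω : ℕ → JointStep S A | ω (k + 1) = z} :=
        measurableSet_apply_eq (k + 1) z
      rw [cellMean, h5, setIntegral_indicator hm, setIntegral_const, smul_eq_mul, mul_one, h4,
        mul_div_cancel_left₀ _ (hω1 k).ne']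
    have h6 : Tendsto (wAvg (fun _ => 1) fun k => G.r i (ω k).1 (ω k).2) atTop (𝓝 v) := by
      rw [Metric.tendsto_atTop]
      intro γ hγ
      obtain ⟨m, hm⟩ := exists_iterate_stepProb_close (Real.exp_pos _).le hc1 hK hμ1 hμ
        (fun z => G.r i z.1 z.2) (show 0 < γ / 3 by positivity)
      have h7 := eventually_abs_wAvg_sub_le_of_iterate (fun _ => one_pos) not_summable_one
        (Z := ω) (e := fun k z => cellMean Q (H k)
          (fun ω => if ω (k + 1) = z then (1 : ℝ) else 0) ω) (B := stepProb G.P π)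
        (fun l z => hω2 z l) (fun z => by simp [h3]) (ψ := fun z => G.r i z.1 z.2) hm
        (show γ / 3 < γ / 2 by linarith)
      obtain ⟨N, hN⟩ := eventually_atTop.1 h7
      refine ⟨N, fun n hn => ?_⟩
      rw [Real.dist_eq]
      exact (hN n hn).trans_lt (by linarith)
    -- the average over `T` has `T + 1` terms, the last of which is negligible
    have h8 : Tendsto (fun T : ℕ => 1 / (T : ℝ) * G.r i (ω T).1 (ω T).2) atTop (𝓝 0) := by
      refine squeeze_zero (fun T => mul_nonneg (by positivity) (G.r_mem i _ _).1) (fun T =>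
        mul_le_of_le_one_right (by positivity) (G.r_mem i _ _).2)
        tendsto_one_div_atTop_nhds_zero_nat
    have h9 := h6.add h8
    rw [add_zero] at h9
    refine (h9.congr fun T => ?_).limsup_eq
    rw [wAvg_one, Finset.sum_range_succ, mul_add]
  rw [payoff, integral_congr_ae hlim]
  simp

end Payoff

/-! ### The batches of the algorithm -/

section Batches

variable {ι : Type*} [Fintype ι] [DecidableEq ι] {S A : ι → Type*}
  [∀ i, Fintype (S i)] [∀ i, DecidableEq (S i)] [∀ i, Nonempty (S i)]
  [∀ i, Fintype (A i)] [∀ i, DecidableEq (A i)] [∀ i, Nonempty (A i)]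
  {G : StochasticGame S A} {I : AlgInput S A} {ω ω' : ℕ → JointStep S A}

/-- All states of all players have been sampled after the step of time `n`. -/
def BatchEnds (G : StochasticGame S A) (I : AlgInput S A) (ω : ℕ → JointStep S A) (n : ℕ) : Prop :=
  ∀ i, (algState G I ω n).stillUnvisited I (ω n) i = ∅

lemma algState_succ_of_ends {n : ℕ} (h : BatchEnds G I ω n) : algState G I ω (n + 1) =
    { batch := (algState G I ω n).batch + 1
      elapsed := 1
      ρ := fun i => dualArgmax (shrunkPolytope (G.P i) (I.δ i)) (I.h i) ((algState G I ω n).Y i +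
        I.η i (algState G I ω n).batch • (algState G I ω n).sampledR G I (ω n) i)
      Y := fun i => (algState G I ω n).Y i +
        I.η i (algState G I ω n).batch • (algState G I ω n).sampledR G I (ω n) i
      R := 0
      unvisited := fun _ => Finset.univ } := by
  rw [algState, AlgState.next]
  exact if_pos h

lemma algState_succ_of_not_ends {n : ℕ} (h : ¬ BatchEnds G I ω n) : algState G I ω (n + 1) =
    { algState G I ω n with
      elapsed := (algState G I ω n).elapsed + 1
      R := (algState G I ω n).sampledR G I (ω n)
      unvisited := (algState G I ω n).stillUnvisited I (ω n) } := by
  rw [algState, AlgState.next]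
  exact if_neg h

lemma algState_congr {n : ℕ} (h : ∀ t < n, ω t = ω' t) :
    algState G I ω n = algState G I ω' n := by
  induction n with
  | zero => rfl
  | succ n ih =>
    rw [algState, algState, ih fun t ht => h t (ht.trans n.lt_succ_self), h n n.lt_succ_self]

lemma batch_succ_of_not_ends {n : ℕ} (h : ¬ BatchEnds G I ω n) :
    (algState G I ω (n + 1)).batch = (algState G I ω n).batch := by
  rw [algState_succ_of_not_ends h]

lemma batch_succ_of_ends {n : ℕ} (h : BatchEnds G I ω n) :
    (algState G I ω (n + 1)).batch = (algState G I ω n).batch + 1 := by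
  rw [algState_succ_of_ends h]

lemma batch_mono : Monotone fun n => (algState G I ω n).batch := by
  refine monotone_nat_of_le_succ fun n => ?_
  by_cases h : BatchEnds G I ω n
  · simp only [batch_succ_of_ends h, Nat.le_succ]
  · simp only [batch_succ_of_not_ends h, le_rfl]

lemma not_ends_of_batch_eq {n t : ℕ}
    (h : (algState G I ω (n + t + 1)).batch = (algState G I ω n).batch) :
    ¬ BatchEnds G I ω (n + t) ∧ (algState G I ω (n + t)).batch = (algState G I ω n).batch := by
  have h1 : (algState G I ω n).batch ≤ (algState G I ω (n + t)).batch :=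
    batch_mono (Nat.le_add_right n t)
  have h2 : ¬ BatchEnds G I ω (n + t) := fun h3 => by
    rw [batch_succ_of_ends h3] at h
    omega
  exact ⟨h2, by rwa [batch_succ_of_not_ends h2] at h⟩

/-- Within a batch the policies and the dual scores do not change. -/
lemma algState_within_batch {n t : ℕ}
    (h : (algState G I ω (n + t)).batch = (algState G I ω n).batch) :
    (algState G I ω (n + t)).ρ = (algState G I ω n).ρ ∧
      (algState G I ω (n + t)).Y = (algState G I ω n).Y ∧
      (algState G I ω (n + t)).elapsed = (algState G I ω n).elapsed + t := by
  induction t with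
  | zero => exact ⟨rfl, rfl, rfl⟩
  | succ t ih =>
    obtain ⟨h1, h2⟩ := not_ends_of_batch_eq h
    obtain ⟨h3, h4, h5⟩ := ih h2
    rw [← add_assoc, algState_succ_of_not_ends h1]
    exact ⟨h3, h4, by simp only [h5, add_assoc]⟩

/-- Batch `k` starts at time `n` (up to the time `0`, which is not counted as the start of
batch `0`). -/
def IsStart (G : StochasticGame S A) (I : AlgInput S A) (ω : ℕ → JointStep S A) (k n : ℕ) : Prop :=
  (algState G I ω n).batch = k ∧ (algState G I ω n).elapsed = 1

lemma IsStart.congr {k n : ℕ} (h : IsStart G I ω k n) (hω : ∀ t < n, ω t = ω' t) :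
    IsStart G I ω' k n := by
  rwa [IsStart, ← algState_congr hω]

lemma IsStart.unique {k m n : ℕ} (hm : IsStart G I ω k m) (hn : IsStart G I ω k n) : m = n := by
  wlog hmn : m ≤ n generalizing m n
  · exact (this hn hm (le_of_not_ge hmn)).symm
  obtain ⟨t, rfl⟩ := Nat.exists_eq_add_of_le hmn
  have h := (algState_within_batch (hn.1.trans hm.1.symm)).2.2
  rw [hn.2, hm.2] at h
  omega

lemma IsStart.pos {k n : ℕ} (h : IsStart G I ω k n) : 0 < n := by
  rcases n with _ | n
  · exact absurd h.2 (by simp [algState, AlgState.init])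
  · exact n.succ_pos

lemma one_le_elapsed (n : ℕ) : 1 ≤ (algState G I ω (n + 1)).elapsed := by
  by_cases h : BatchEnds G I ω n
  · rw [algState_succ_of_ends h]
  · rw [algState_succ_of_not_ends h]
    exact Nat.le_add_left 1 _

lemma BatchEnds.isStart {n : ℕ} (h : BatchEnds G I ω n) :
    IsStart G I ω ((algState G I ω n).batch + 1) (n + 1) := by
  rw [IsStart, algState_succ_of_ends h]
  exact ⟨rfl, rfl⟩

lemma IsStart.batchEnds {k n : ℕ} (h : IsStart G I ω (k + 1) n) :
    ∃ m, n = m + 1 ∧ BatchEnds G I ω m ∧ (algState G I ω m).batch = k := by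
  obtain ⟨m, rfl⟩ : ∃ m, n = m + 1 := ⟨n - 1, by have := h.pos; omega⟩
  refine ⟨m, rfl, ?_⟩
  by_cases hm : BatchEnds G I ω m
  · exact ⟨hm, by have := h.1; rw [batch_succ_of_ends hm] at this; omega⟩
  · exfalso
    have h1 := h.2
    rw [algState_succ_of_not_ends hm] at h1
    have h2 : (algState G I ω m).elapsed = 0 := by simpa using h1
    rcases m with _ | m
    · have h3 := h.1
      rw [batch_succ_of_not_ends hm] at h3
      simp [algState, AlgState.init] at h3
    · have := one_le_elapsed (G := G) (I := I) (ω := ω) m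
      omega

section

variable [Nonempty ι] (hd : 1 ≤ I.d)

include hd in
lemma not_batchEnds_zero : ¬ BatchEnds G I ω 0 := fun h => by
  have h1 := h (Classical.arbitrary ι)
  have h2 : ¬ I.d ≤ (algState G I ω 0).elapsed := by
    change ¬ I.d ≤ 0
    omega
  rw [AlgState.stillUnvisited, if_neg h2] at h1
  exact Finset.univ_nonempty.ne_empty h1

include hd in
/-- As `1 ≤ d`, nothing is sampled at time `0`, and the first batch can be considered to start at
time `1`, like the others immediately after a joint step of the previous policies. -/
lemma algState_one : algState G I ω 1 = { AlgState.init I with elapsed := 1 } := by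
  rw [algState_succ_of_not_ends (not_batchEnds_zero hd)]
  have h1 : ¬ I.d ≤ 0 := by omega
  simp only [algState, AlgState.init]
  congr 1
  · ext i : 1
    simp [AlgState.sampledR, h1]
  · ext i : 1
    simp [AlgState.stillUnvisited, h1]

include hd in
/-- No state is sampled at the start of a batch. -/
lemma IsStart.fresh {k n : ℕ} (h : IsStart G I ω k n) :
    (algState G I ω n).R = 0 ∧ (algState G I ω n).unvisited = fun _ => Finset.univ := by
  rcases k with _ | k
  · have h1 : IsStart G I ω 0 1 := by rw [IsStart, algState_one hd]; exact ⟨rfl, rfl⟩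
    rw [h.unique h1, algState_one hd]
    exact ⟨rfl, rfl⟩
  · obtain ⟨m, rfl, h1, -⟩ := h.batchEnds
    rw [algState_succ_of_ends h1]
    exact ⟨rfl, rfl⟩

include hd in
lemma exists_isStart (n : ℕ) {j : ℕ} (hj : j ≤ (algState G I ω (n + 1)).batch) :
    ∃ m ≤ n + 1, IsStart G I ω j m := by
  induction n with
  | zero =>
    refine ⟨1, le_rfl, ?_⟩
    rw [algState_one hd] at hj
    have : j = 0 := by simpa [AlgState.init] using hj
    subst this
    rw [IsStart, algState_one hd]
    exact ⟨rfl, rfl⟩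
  | succ n ih =>
    by_cases h : BatchEnds G I ω (n + 1)
    · rw [batch_succ_of_ends h] at hj
      rcases hj.lt_or_eq with h1 | rfl
      · obtain ⟨m, hm, h2⟩ := ih (Nat.lt_succ_iff.1 h1)
        exact ⟨m, hm.trans (Nat.le_succ _), h2⟩
      · exact ⟨_, le_rfl, h.isStart⟩
    · rw [batch_succ_of_not_ends h] at hj
      obtain ⟨m, hm, h2⟩ := ih hj
      exact ⟨m, hm.trans (Nat.le_succ _), h2⟩

end

/-- The time at which batch `k` starts, and `0` if there is no such time. -/
def startTime (G : StochasticGame S A) (I : AlgInput S A) (k : ℕ) (ω : ℕ → JointStep S A) : ℕ :=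
  sInf {n | IsStart G I ω k n}

lemma IsStart.startTime_eq {k n : ℕ} (h : IsStart G I ω k n) : startTime G I k ω = n :=
  (show IsStart G I ω k (startTime G I k ω) from
    Nat.sInf_mem (s := {n | IsStart G I ω k n}) ⟨n, h⟩).unique h

lemma isStart_startTime {k : ℕ} (h : startTime G I k ω ≠ 0) :
    IsStart G I ω k (startTime G I k ω) :=
  Nat.sInf_mem (Nat.nonempty_of_sInf_eq_succ (Nat.succ_pred_eq_of_ne_zero h).symm)

/-- The steps before the start of batch `k`. -/
def startPrefix (G : StochasticGame S A) (I : AlgInput S A) (k : ℕ) (ω : ℕ → JointStep S A) :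
    List (JointStep S A) :=
  (List.range (startTime G I k ω)).map ω

/-- The information at the start of batch `k`. It is a tuple of all earlier prefixes in order that
it is finer than the previous one also where batch `k` is never reached. -/
def startHistory (G : StochasticGame S A) (I : AlgInput S A) (k : ℕ) (ω : ℕ → JointStep S A) :
    List (List (JointStep S A)) :=
  (List.range (k + 1)).map fun j => startPrefix G I j ω

lemma startTime_eq_of_prefix_eq {k : ℕ} (h : startPrefix G I k ω = startPrefix G I k ω') :
    startTime G I k ω = startTime G I k ω' := by
  simpa [startPrefix] using congrArg List.length h

lemma eq_of_prefix_eq {k : ℕ} (h : startPrefix G I k ω = startPrefix G I k ω') {t : ℕ}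
    (ht : t < startTime G I k ω) : ω t = ω' t := by
  have h1 := startTime_eq_of_prefix_eq h
  rw [startPrefix, startPrefix, ← h1, List.map_inj_left] at h
  exact h t (List.mem_range.2 ht)

lemma prefix_eq_of_history_eq {k j : ℕ} (h : startHistory G I k ω = startHistory G I k ω')
    (hj : j ≤ k) : startPrefix G I j ω = startPrefix G I j ω' := by
  rw [startHistory, startHistory, List.map_inj_left] at h
  exact h j (List.mem_range.2 (Nat.lt_succ_iff.2 hj))

lemma startHistory_refines (k : ℕ) (h : startHistory G I (k + 1) ω = startHistory G I (k + 1) ω') :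
    startHistory G I k ω = startHistory G I k ω' := by
  rw [startHistory, startHistory, List.map_inj_left]
  exact fun j hj => prefix_eq_of_history_eq h ((Nat.lt_succ_iff.1 (List.mem_range.1 hj)).trans
    k.le_succ)

/-- On a play that reaches batch `k`, the history at its start is that of another play if and only
if the two agree until this start. -/
lemma startHistory_eq_iff [Nonempty ι] (hd : 1 ≤ I.d) {k n : ℕ} (h : IsStart G I ω k n) :
    startHistory G I k ω' = startHistory G I k ω ↔ ∀ t < n, ω' t = ω t := by
  constructor
  · intro h1 t ht
    refine (eq_of_prefix_eq (prefix_eq_of_history_eq h1 le_rfl).symm ?_).symm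
    rwa [h.startTime_eq]
  · intro h1
    rw [startHistory, startHistory, List.map_inj_left]
    intro j hj
    obtain ⟨n, rfl⟩ : ∃ m, n = m + 1 := ⟨n - 1, by have := h.pos; omega⟩
    obtain ⟨m, hm, h2⟩ := exists_isStart (G := G) (I := I) (ω := ω) hd n (j := j) (by
      rw [h.1]; exact Nat.lt_succ_iff.1 (List.mem_range.1 hj))
    have h3 : IsStart G I ω' j m := h2.congr fun t ht => (h1 t (ht.trans_le hm)).symm
    rw [startPrefix, startPrefix, h2.startTime_eq, h3.startTime_eq, List.map_inj_left]
    exact fun t ht => h1 t ((List.mem_range.1 ht).trans_le hm)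

lemma measurableSet_isStart (k n : ℕ) : MeasurableSet {ω | IsStart G I ω k n} :=
  DependsBefore.measurableSet (n := n) fun _ _ h h1 => IsStart.congr h1 h

lemma measurableSet_startTime (k : ℕ) (n : ℕ) : MeasurableSet {ω | startTime G I k ω = n} := by
  rcases Nat.eq_zero_or_pos n with rfl | hn
  · have : {ω | startTime G I k ω = 0} = ⋂ n, {ω | IsStart G I ω k n}ᶜ := by
      ext ω
      simp only [Set.mem_ofPred_eq, Set.mem_iInter, Set.mem_compl_iff]
      constructor
      · intro h n hn
        rw [hn.startTime_eq] at h
        exact hn.pos.ne' h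
      · intro h
        by_contra h1
        exact h _ (isStart_startTime h1)
    rw [this]
    exact MeasurableSet.iInter fun n => (measurableSet_isStart k n).compl
  · have : {ω | startTime G I k ω = n} = {ω | IsStart G I ω k n} := by
      ext ω
      constructor
      · rintro rfl
        exact isStart_startTime hn.ne'
      · exact fun h => h.startTime_eq
    rw [this]
    exact measurableSet_isStart k n

lemma measurableSet_startPrefix (k : ℕ) (c : List (JointStep S A)) :
    MeasurableSet {ω | startPrefix G I k ω = c} := by
  have : {ω | startPrefix G I k ω = c} = {ω | startTime G I k ω = c.length} ∩
      {ω | (List.range c.length).map ω = c} := by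
    ext ω
    simp only [Set.mem_ofPred_eq, Set.mem_inter_iff]
    constructor
    · intro h
      have h1 : startTime G I k ω = c.length := by simpa [startPrefix] using congrArg List.length h
      refine ⟨h1, ?_⟩
      rwa [startPrefix, h1] at h
    · rintro ⟨h1, h2⟩
      rwa [startPrefix, h1]
  rw [this]
  refine (measurableSet_startTime k _).inter (DependsBefore.measurableSet (n := c.length) ?_)
  intro ω ω' h h1
  rw [Set.mem_ofPred_eq] at h1 ⊢
  rw [← h1]
  simp only [List.length_map, List.length_range]
  rw [List.map_inj_left]
  exact fun t ht => (h t (List.mem_range.1 ht)).symm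

lemma measurableSet_startHistory (k : ℕ) (c : List (List (JointStep S A))) :
    MeasurableSet (startHistory G I k ⁻¹' {c}) := by
  by_cases hc : c.length = k + 1
  · have : startHistory G I k ⁻¹' {c} =
        ⋂ j : Fin c.length, {ω | startPrefix G I j ω = c.get j} := by
      ext ω
      simp only [Set.mem_preimage, Set.mem_singleton_iff, Set.mem_iInter, Set.mem_ofPred_eq]
      constructor
      · intro h j
        simp [← h, startHistory]
      · intro h
        refine List.ext_get (by simp [startHistory, hc]) fun j h1 h2 => ?_
        have := h ⟨j, h2⟩
        simpa [startHistory] using this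
    rw [this]
    exact MeasurableSet.iInter fun j => measurableSet_startPrefix _ _
  · have : startHistory G I k ⁻¹' {c} = ∅ := by
      ext ω
      simp only [Set.mem_preimage, Set.mem_singleton_iff, Set.mem_empty_iff_false, iff_false]
      rintro rfl
      exact hc (by simp [startHistory])
    rw [this]
    exact MeasurableSet.empty

/-! ### The reward vectors and the dual scores -/

/-- The last joint step before the start of batch `k`. -/
def lastStep (G : StochasticGame S A) (I : AlgInput S A) (k : ℕ) (ω : ℕ → JointStep S A) :
    JointStep S A :=
  if startTime G I k ω = 0 then
    JointStep.mk (fun _ => Classical.arbitrary _) (fun _ => Classical.arbitrary _)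
  else ω (startTime G I k ω - 1)

/-- The complete reward vectors of batch `k` (`0` if it never ends). -/
def batchReward (G : StochasticGame S A) (I : AlgInput S A) (k : ℕ) (ω : ℕ → JointStep S A) :
    ∀ i, S i × A i → ℝ :=
  if startTime G I (k + 1) ω = 0 then 0
  else (algState G I ω (startTime G I (k + 1) ω - 1)).sampledR G I
    (ω (startTime G I (k + 1) ω - 1))

lemma lastStep_congr {k : ℕ} (h : startHistory G I k ω = startHistory G I k ω') :
    lastStep G I k ω = lastStep G I k ω' := by
  have h1 := prefix_eq_of_history_eq h le_rfl
  rw [lastStep, lastStep, ← startTime_eq_of_prefix_eq h1]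
  by_cases h2 : startTime G I k ω = 0
  · rw [if_pos h2, if_pos h2]
  · rw [if_neg h2, if_neg h2]
    exact eq_of_prefix_eq h1 (Nat.sub_one_lt h2)

lemma batchReward_congr {k : ℕ} (h : startHistory G I (k + 1) ω = startHistory G I (k + 1) ω') :
    batchReward G I k ω = batchReward G I k ω' := by
  have h1 := prefix_eq_of_history_eq h le_rfl
  rw [batchReward, batchReward, ← startTime_eq_of_prefix_eq h1]
  split_ifs with h2
  · rfl
  · have h3 : ∀ t < startTime G I (k + 1) ω, ω t = ω' t := fun t ht => eq_of_prefix_eq h1 ht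
    rw [h3 _ (by omega), algState_congr fun t ht => h3 t (by omega)]

lemma IsStart.lastStep_eq {k n : ℕ} (h : IsStart G I ω k (n + 1)) : lastStep G I k ω = ω n := by
  rw [lastStep, h.startTime_eq, if_neg (Nat.add_one_ne_zero n), Nat.add_sub_cancel]

lemma IsStart.batchReward_eq {k n : ℕ} (h : IsStart G I ω (k + 1) (n + 1)) :
    batchReward G I k ω = (algState G I ω n).sampledR G I (ω n) := by
  rw [batchReward, h.startTime_eq, if_neg (Nat.add_one_ne_zero n), Nat.add_sub_cancel]

section

variable [Nonempty ι] (hd : 1 ≤ I.d)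

include hd in
lemma IsStart.iterate_eq {k n : ℕ} (h : IsStart G I ω k n) :
    iterate G I ω k = (algState G I ω n).ρ := by
  have h1 : (algState G I ω (sInf {t | (algState G I ω t).batch = k})).batch = k :=
    Nat.sInf_mem (s := {t | (algState G I ω t).batch = k}) ⟨n, h.1⟩
  obtain ⟨t, ht⟩ := Nat.exists_eq_add_of_le (Nat.sInf_le (s := {t | (algState G I ω t).batch = k})
    h.1)
  rw [iterate]
  conv_rhs => rw [ht]
  refine (algState_within_batch ?_).1.symm
  rw [← ht, h.1, h1]

/-- The update of the dual scores and of the occupation measures at the end of batch `k`. -/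
lemma IsStart.score_eq {k n m : ℕ} (hn : IsStart G I ω k n) (hm : IsStart G I ω (k + 1) m) :
    (∀ i, (algState G I ω m).Y i = (algState G I ω n).Y i + I.η i k • batchReward G I k ω i) ∧
      ∀ i, (algState G I ω m).ρ i =
        dualArgmax (shrunkPolytope (G.P i) (I.δ i)) (I.h i) ((algState G I ω m).Y i) := by
  obtain ⟨l, rfl, h1, h2⟩ := hm.batchEnds
  have hnl : n ≤ l := by
    by_contra h3
    have : (algState G I ω (l + 1)).batch ≤ (algState G I ω n).batch := batch_mono (by omega)
    rw [hn.1, hm.1] at this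
    omega
  obtain ⟨t, rfl⟩ := Nat.exists_eq_add_of_le hnl
  have h3 := (algState_within_batch (h2.trans hn.1.symm)).2.1
  rw [hm.batchReward_eq, algState_succ_of_ends h1, h2, h3]
  exact ⟨fun i => rfl, fun i => rfl⟩

/-- Dual averaging: `ρᵏ⁺¹` maximizes the objective for the sum of the weighted reward vectors. -/
lemma iterate_succ_eq (hd : 1 ≤ I.d) (h : ∀ k, startTime G I k ω ≠ 0) (k : ℕ) (i : ι) :
    iterate G I ω (k + 1) i = dualArgmax (shrunkPolytope (G.P i) (I.δ i)) (I.h i)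
      (∑ l ∈ Finset.range (k + 1), I.η i l • batchReward G I l ω i) := by
  have hs := fun k => isStart_startTime (h k)
  have hY : ∀ k, (algState G I ω (startTime G I k ω)).Y i =
      ∑ l ∈ Finset.range k, I.η i l • batchReward G I l ω i := by
    intro k
    induction k with
    | zero =>
      have h1 : IsStart G I ω 0 1 := by rw [IsStart, algState_one hd]; exact ⟨rfl, rfl⟩
      rw [h1.startTime_eq, algState_one hd]
      rfl
    | succ k ih => rw [((hs k).score_eq (hs (k + 1))).1, ih, Finset.sum_range_succ]
  rw [(hs (k + 1)).iterate_eq hd, ((hs k).score_eq (hs (k + 1))).2, hY]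

end

lemma dualArgmax_mem {X Y : Type*} {K : Set (X × Y → ℝ)} [Fintype X] [Fintype Y]
    {h : (X × Y → ℝ) → ℝ} {y : X × Y → ℝ} (hex : ∃ ρ ∈ K, IsMaxOn (dualObjective h y) K ρ) :
    dualArgmax K h y ∈ K ∧ IsMaxOn (dualObjective h y) K (dualArgmax K h y) := by
  rw [dualArgmax, dif_pos hex]
  exact hex.choose_spec

/-- The occupation measures of the algorithm stay in the shrunk polytopes. -/
lemma algState_mem (hρ : ∀ i, I.ρ₀ i ∈ shrunkPolytope (G.P i) (I.δ i))
    (hmax : ∀ i y, ∃ ρ ∈ shrunkPolytope (G.P i) (I.δ i),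
      IsMaxOn (dualObjective (I.h i) y) (shrunkPolytope (G.P i) (I.δ i)) ρ) (n : ℕ) (i : ι) :
    (algState G I ω n).ρ i ∈ shrunkPolytope (G.P i) (I.δ i) := by
  induction n with
  | zero => exact hρ i
  | succ n ih =>
    by_cases h : BatchEnds G I ω n
    · rw [algState_succ_of_ends h]
      exact (dualArgmax_mem (hmax i _)).1
    · rw [algState_succ_of_not_ends h]
      exact ih

end Batches

/-! ### The policies induced by occupation measures -/

section Policy

variable {X Y : Type*} [Fintype X] [DecidableEq X] [Fintype Y] [Nonempty Y]
  {p : TransitionModel X Y} {δ : ℝ} {ρ : X × Y → ℝ}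

lemma sum_pos_of_mem_shrunk (hδ : 0 < δ) (hρ : ρ ∈ shrunkPolytope p δ) (s : X) :
    0 < ∑ a, ρ (s, a) :=
  Finset.sum_pos (fun _ _ => hδ.trans_le (hρ.2 _)) Finset.univ_nonempty

lemma inducedPolicy_apply (hρ : ∀ z, 0 ≤ ρ z) {s : X} (hs : 0 < ∑ a, ρ (s, a)) (a : Y) :
    inducedPolicy ρ s a = ρ (s, a) / ∑ a', ρ (s, a') := by
  have h : (fun a => ρ (s, a) / ∑ a', ρ (s, a')) ∈ stdSimplex ℝ Y :=
    ⟨fun a => div_nonneg (hρ _) hs.le, by rw [← Finset.sum_div, div_self hs.ne']⟩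
  rw [inducedPolicy, dif_pos h]
  rfl

lemma le_one_of_mem (hρ : ρ ∈ occupationPolytope p) (s : X) : ∑ a, ρ (s, a) ≤ 1 := by
  rw [← hρ.2.2, Fintype.sum_prod_type]
  exact Finset.single_le_sum (f := fun s => ∑ a, ρ (s, a))
    (fun s _ => Finset.sum_nonneg fun a _ => hρ.1 _) (Finset.mem_univ s)

lemma le_inducedPolicy (hδ : 0 < δ) (hρ : ρ ∈ shrunkPolytope p δ) (s : X) (a : Y) :
    δ ≤ inducedPolicy ρ s a := by
  have h := sum_pos_of_mem_shrunk hδ hρ s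
  rw [inducedPolicy_apply hρ.1.1 h, le_div_iff₀ h]
  exact (mul_le_of_le_one_right hδ.le (le_one_of_mem hρ.1 s)).trans (hρ.2 _)

end Policy

/-! ### Bounds for the reward vectors -/

section RewardBounds

variable {ι : Type*} [Fintype ι] [DecidableEq ι] {S A : ι → Type*}
  [∀ i, Fintype (S i)] [∀ i, DecidableEq (S i)] [∀ i, Nonempty (S i)]
  [∀ i, Fintype (A i)] [∀ i, DecidableEq (A i)] [∀ i, Nonempty (A i)]
  {G : StochasticGame S A} {I : AlgInput S A} {ω ω' : ℕ → JointStep S A}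

/-- The contribution of a joint step to the coordinate `u` of the reward vector of player `i`. -/
def increment (G : StochasticGame S A) (I : AlgInput S A) (x : AlgState S A) (i : ι)
    (u : S i × A i) (z : JointStep S A) : ℝ :=
  if I.d ≤ x.elapsed ∧ z.1 i ∈ x.unvisited i ∧ (z.1 i, z.2 i) = u then
    G.r i z.1 z.2 / x.policy i u.1 u.2 else 0

lemma sampledR_eq (x : AlgState S A) (i : ι) (u : S i × A i) (z : JointStep S A) :
    x.sampledR G I z i u = x.R i u + increment G I x i u z := by
  rw [AlgState.sampledR, increment]
  by_cases h1 : I.d ≤ x.elapsed ∧ z.1 i ∈ x.unvisited i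
  · rw [if_pos h1, Pi.add_apply]
    congr 1
    by_cases h2 : (z.1 i, z.2 i) = u
    · subst h2
      rw [Pi.single_eq_same, if_pos ⟨h1.1, h1.2, rfl⟩]
    · rw [Pi.single_eq_of_ne (Ne.symm h2), if_neg fun h => h2 h.2.2]
  · rw [if_neg h1, if_neg fun h => h1 ⟨h.1, h.2.1⟩, add_zero]

lemma increment_mem (hδ : ∀ i, 0 < I.δ i) {x : AlgState S A}
    (hx : ∀ i, x.ρ i ∈ shrunkPolytope (G.P i) (I.δ i)) (i : ι) (u : S i × A i)
    (z : JointStep S A) : increment G I x i u z ∈ Set.Icc 0 (1 / I.δ i) := by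
  rw [increment]
  have h1 : I.δ i ≤ x.policy i u.1 u.2 := le_inducedPolicy (hδ i) (hx i) _ _
  have h2 := G.r_mem i z.1 z.2
  split_ifs
  · exact ⟨div_nonneg h2.1 ((hδ i).le.trans h1), div_le_div₀ zero_le_one h2.2 (hδ i) h1⟩
  · exact ⟨le_rfl, (one_div_pos.2 (hδ i)).le⟩

/-- Each coordinate of the reward vectors is sampled at most once. -/
lemma reward_mem (hδ : ∀ i, 0 < I.δ i) (hρ : ∀ i, I.ρ₀ i ∈ shrunkPolytope (G.P i) (I.δ i))
    (hmax : ∀ i y, ∃ ρ ∈ shrunkPolytope (G.P i) (I.δ i),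
      IsMaxOn (dualObjective (I.h i) y) (shrunkPolytope (G.P i) (I.δ i)) ρ) (n : ℕ) (i : ι)
    (u : S i × A i) :
    ((u.1 ∈ (algState G I ω n).unvisited i → (algState G I ω n).R i u = 0) ∧
      (algState G I ω n).R i u ∈ Set.Icc 0 (1 / I.δ i)) ∧
    (algState G I ω n).sampledR G I (ω n) i u ∈ Set.Icc 0 (1 / I.δ i) := by
  have hb : (0 : ℝ) ∈ Set.Icc 0 (1 / I.δ i) := ⟨le_rfl, (one_div_pos.2 (hδ i)).le⟩
  have hsample : ∀ n, ((u.1 ∈ (algState G I ω n).unvisited i → (algState G I ω n).R i u = 0) ∧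
      (algState G I ω n).R i u ∈ Set.Icc 0 (1 / I.δ i)) →
      (algState G I ω n).sampledR G I (ω n) i u ∈ Set.Icc 0 (1 / I.δ i) := by
    intro n h
    rw [sampledR_eq]
    by_cases h1 : (ω n).1 i ∈ (algState G I ω n).unvisited i ∧ ((ω n).1 i, (ω n).2 i) = u
    · rw [h.1 (h1.2 ▸ h1.1), zero_add]
      exact increment_mem hδ (algState_mem hρ hmax n) i u (ω n)
    · rw [increment, if_neg fun h2 => h1 h2.2, add_zero]
      exact h.2
  have hmain : ∀ n, (u.1 ∈ (algState G I ω n).unvisited i → (algState G I ω n).R i u = 0) ∧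
      (algState G I ω n).R i u ∈ Set.Icc 0 (1 / I.δ i) := by
    intro n
    induction n with
    | zero => exact ⟨fun _ => rfl, hb⟩
    | succ n ih =>
      by_cases h : BatchEnds G I ω n
      · rw [algState_succ_of_ends h]
        exact ⟨fun _ => rfl, hb⟩
      · have h1 := hsample n ih
        rw [algState_succ_of_not_ends h]
        refine ⟨fun h2 => ?_, h1⟩
        change _ ∈ (algState G I ω n).stillUnvisited I (ω n) i at h2
        change (algState G I ω n).sampledR G I (ω n) i u = 0
        rw [sampledR_eq, increment]
        rw [AlgState.stillUnvisited] at h2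
        by_cases h3 : I.d ≤ (algState G I ω n).elapsed
        · rw [if_pos h3, Finset.mem_erase] at h2
          rw [ih.1 h2.2, if_neg fun h4 => h2.1 (congrArg Prod.fst h4.2.2).symm, add_zero]
        · rw [if_neg h3] at h2
          rw [ih.1 h2, if_neg fun h4 => h3 h4.1, add_zero]
  exact ⟨hmain n, hsample n (hmain n)⟩

lemma batchReward_mem (hδ : ∀ i, 0 < I.δ i) (hρ : ∀ i, I.ρ₀ i ∈ shrunkPolytope (G.P i) (I.δ i))
    (hmax : ∀ i y, ∃ ρ ∈ shrunkPolytope (G.P i) (I.δ i),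
      IsMaxOn (dualObjective (I.h i) y) (shrunkPolytope (G.P i) (I.δ i)) ρ) (k : ℕ) (i : ι)
    (u : S i × A i) : batchReward G I k ω i u ∈ Set.Icc 0 (1 / I.δ i) := by
  rw [batchReward]
  split_ifs
  · exact ⟨le_rfl, (one_div_pos.2 (hδ i)).le⟩
  · exact (reward_mem hδ hρ hmax _ i u).2

end RewardBounds

/-! ### The law of a batch -/

section Fiber

variable {Ω C : Type*} [MeasurableSpace Ω] [Fintype C] (P : Measure Ω) [IsFiniteMeasure P]

lemma sum_real_inter_fiber {f : Ω → C} (hf : ∀ c, MeasurableSet {ω | f ω = c}) (E : Set Ω) :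
    ∑ c, P.real (E ∩ {ω | f ω = c}) = P.real E := by
  have h := sum_measureReal_preimage_singleton (μ := P.restrict E) (Finset.univ : Finset C)
    (f := f) (fun c _ => hf c)
  simp only [Finset.coe_univ, Set.preimage_univ, measureReal_restrict_apply_univ] at h
  rw [← h]
  refine Finset.sum_congr rfl fun c _ => ?_
  have h1 : (P.restrict E).real {ω | f ω = c} = P.real ({ω | f ω = c} ∩ E) :=
    measureReal_restrict_apply (hf c)
  rw [Set.inter_comm, ← h1]
  rfl

end Fiber

section BatchLaw

open Matrix

variable {ι : Type*} [Fintype ι] [DecidableEq ι] {S A : ι → Type*}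
  [∀ i, Fintype (S i)] [∀ i, DecidableEq (S i)] [∀ i, Nonempty (S i)]
  [∀ i, Fintype (A i)] [∀ i, DecidableEq (A i)] [∀ i, Nonempty (A i)]
  {G : StochasticGame S A} {s₀ : ∀ i, S i} {I : AlgInput S A} {ω ω₀ : ℕ → JointStep S A}
  {k n : ℕ}

/-- The plays that agree with `ω₀` before time `m`. -/
def playsAgreeing (ω₀ : ℕ → JointStep S A) (m : ℕ) : Set (ℕ → JointStep S A) :=
  {ω | ∀ t < m, ω t = ω₀ t}

lemma dependsBefore_playsAgreeing (ω₀ : ℕ → JointStep S A) (m : ℕ) :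
    DependsBefore m (playsAgreeing ω₀ m) :=
  fun _ _ h h1 t ht => (h t ht).symm.trans (h1 t ht)

lemma IsStart.of_mem_playsAgreeing {m : ℕ} (h : IsStart G I ω₀ k m) (hω : ω ∈ playsAgreeing ω₀ m) :
    IsStart G I ω k m := h.congr fun t ht => (hω t ht).symm

lemma algState_of_mem_playsAgreeing {m : ℕ} (hω : ω ∈ playsAgreeing ω₀ m) :
    algState G I ω m = algState G I ω₀ m := algState_congr hω

/-- `t` time instances after its start batch `k` has not ended, `U` are the unsampled states, and
the joint step is `z`. -/
def arrivalEvent (G : StochasticGame S A) (I : AlgInput S A) (ω₀ : ℕ → JointStep S A) (k n t : ℕ)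
    (U : ∀ i, Finset (S i)) (z : JointStep S A) : Set (ℕ → JointStep S A) :=
  {ω | ω ∈ playsAgreeing ω₀ (n + 1) ∧ (algState G I ω (n + 1 + t)).batch = k ∧
    (algState G I ω (n + 1 + t)).unvisited = U ∧ ω (n + 1 + t) = z}

lemma dependsBefore_arrivalEvent (t : ℕ) (U : ∀ i, Finset (S i)) (z : JointStep S A) :
    DependsBefore (n + 1 + t + 1) (arrivalEvent G I ω₀ k n t U z) := by
  rintro ω ω' h ⟨h1, h2, h3, h4⟩
  have h5 : algState G I ω' (n + 1 + t) = algState G I ω (n + 1 + t) :=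
    algState_congr fun u hu => (h u (by omega)).symm
  refine ⟨dependsBefore_playsAgreeing ω₀ (n + 1) ω ω' (fun u hu => h u (by omega)) h1, ?_, ?_, ?_⟩
  · rw [h5, h2]
  · rw [h5, h3]
  · rw [← h _ (Nat.lt_succ_self _), h4]

lemma batch_in_playsAgreeing (hω₀ : IsStart G I ω₀ k (n + 1))
    (hω : ω ∈ playsAgreeing ω₀ (n + 1)) {t : ℕ} (ht : (algState G I ω (n + 1 + t)).batch = k) :
    (algState G I ω (n + 1 + t)).elapsed = t + 1 ∧
      (algState G I ω (n + 1 + t)).policy = (algState G I ω₀ (n + 1)).policy := by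
  have h1 := hω₀.of_mem_playsAgreeing hω
  obtain ⟨h2, -, h3⟩ := algState_within_batch (ht.trans h1.1.symm)
  refine ⟨by rw [h3, h1.2, add_comm], funext fun i => ?_⟩
  rw [AlgState.policy, AlgState.policy, h2, algState_of_mem_playsAgreeing hω]

lemma stillUnvisited_in_playsAgreeing (hω₀ : IsStart G I ω₀ k (n + 1))
    (hω : ω ∈ playsAgreeing ω₀ (n + 1)) {t : ℕ} (ht : (algState G I ω (n + 1 + t)).batch = k) (i : ι) :
    (algState G I ω (n + 1 + t)).stillUnvisited I (ω (n + 1 + t)) i =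
      remaining I.d (t + 1) ((algState G I ω (n + 1 + t)).unvisited i) ((ω (n + 1 + t)).1 i) := by
  rw [AlgState.stillUnvisited, remaining, (batch_in_playsAgreeing hω₀ hω ht).1]

variable [Nonempty ι]

lemma unvisited_ne_empty (hd : 1 ≤ I.d) (h : IsStart G I ω k (n + 1)) {t : ℕ}
    (ht : (algState G I ω (n + 1 + t)).batch = k) :
    (algState G I ω (n + 1 + t)).unvisited ≠ fun _ => ∅ := by
  rcases t with _ | t
  · rw [add_zero, (h.fresh hd).2]
    intro h1
    exact Finset.univ_nonempty.ne_empty (congrFun h1 (Classical.arbitrary ι))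
  · have h1 := (not_ends_of_batch_eq (ht.trans h.1.symm)).1
    rw [← add_assoc, algState_succ_of_not_ends h1]
    exact fun h2 => h1 fun i => congrFun h2 i

lemma sum_ite_forall_prod {X : ι → Type*} [∀ i, Fintype (X i)] (p : ∀ i, X i → Prop)
    [∀ i, DecidablePred (p i)] (a : ∀ i, X i → ℝ) :
    ∑ W : ∀ i, X i, (if ∀ i, p i (W i) then ∏ i, a i (W i) else 0) =
      ∏ i, ∑ V, if p i V then a i V else 0 := by
  rw [← sum_prod_pi fun i V => if p i V then a i V else 0]
  refine Finset.sum_congr rfl fun W _ => ?_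
  rw [Fintype.prod_ite_zero]

lemma algLaw_policy_congr (t : ℕ) (ω ω' : ℕ → JointStep S A) (h : ∀ u < t, ω u = ω' u) :
    (algState G I ω t).policy = (algState G I ω' t).policy := by
  rw [algState_congr h]

instance : IsProbabilityMeasure (algLaw G s₀ I) := by
  unfold algLaw; infer_instance

/-- The players are independent within a batch as long as it lasts. The case that no unsampled
states are left is excluded, as the batch has ended then. -/
lemma real_arrivalEvent (hd : 1 ≤ I.d) (hω₀ : IsStart G I ω₀ k (n + 1)) (t : ℕ)
    {U : ∀ i, Finset (S i)} (hU : U ≠ fun _ => ∅) (z : JointStep S A) :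
    (algLaw G s₀ I).real (arrivalEvent G I ω₀ k n t U z) =
      (algLaw G s₀ I).real (playsAgreeing ω₀ (n + 1)) *
        ∏ i, arrivalLaw (chains G.P (algState G I ω₀ (n + 1)).policy i) I.d
          (nextLaw G.P (ω₀ n) i) t (U i) (z.1 i) *
            (algState G I ω₀ (n + 1)).policy i (z.1 i) (z.2 i) := by
  classical
  set π := (algState G I ω₀ (n + 1)).policy with hπ
  set κ := nextLaw G.P (ω₀ n) with hκ
  have hmarkov := fun (m : ℕ) (E : Set (ℕ → JointStep S A)) (hE : DependsBefore (m + 1) E)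
    (y : JointStep S A) (hy : ∀ ω ∈ E, ω m = y)
    (hp : ∀ ω ∈ E, (algState G I ω (m + 1)).policy = π) =>
    playLaw_real_inter_next (G := G) (s₀ := s₀) (σ := fun t ω => (algState G I ω t).policy)
      algLaw_policy_congr hE hy hp
  induction t generalizing U z with
  | zero =>
    have h1 : ∀ ω ∈ playsAgreeing ω₀ (n + 1),
        (algState G I ω (n + 1)).unvisited = fun _ => Finset.univ :=
      fun ω hω => ((hω₀.of_mem_playsAgreeing hω).fresh hd).2
    by_cases h2 : U = fun _ => Finset.univ
    · have h3 : arrivalEvent G I ω₀ k n 0 U z = playsAgreeing ω₀ (n + 1) ∩ {ω | ω (n + 1) = z} := by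
        ext ω
        constructor
        · rintro ⟨h4, -, -, h5⟩
          exact ⟨h4, h5⟩
        · rintro ⟨h4, h5⟩
          exact ⟨h4, (hω₀.of_mem_playsAgreeing h4).1, (h1 ω h4).trans h2.symm, h5⟩
      rw [h3]
      refine (hmarkov n _ (dependsBefore_playsAgreeing ω₀ (n + 1)) (ω₀ n)
        (fun ω hω => hω n n.lt_succ_self)
        (fun ω hω => by rw [algState_of_mem_playsAgreeing hω]) z).trans ?_
      subst h2
      simp only [arrivalLaw, if_true]
      rfl
    · have h3 : arrivalEvent G I ω₀ k n 0 U z = ∅ := by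
        ext ω
        simp only [Set.mem_empty_iff_false, iff_false]
        rintro ⟨h4, -, h5, -⟩
        exact h2 (h5.symm.trans (h1 ω h4))
      obtain ⟨i, hi⟩ := Function.ne_iff.1 h2
      rw [h3, measureReal_empty, Finset.prod_eq_zero (Finset.mem_univ i), mul_zero]
      rw [arrivalLaw, if_neg hi, zero_mul]
  | succ t ih =>
    -- condition on the joint step and the unsampled states one time instance earlier
    set f : (ℕ → JointStep S A) → (∀ i, Finset (S i)) × JointStep S A :=
      fun ω => ((algState G I ω (n + 1 + t)).unvisited, ω (n + 1 + t)) with hf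
    have hfdep : ∀ c, DependsBefore (n + 1 + t + 1) {ω | f ω = c} := by
      intro c ω ω' h h1
      rw [Set.mem_ofPred_eq] at h1 ⊢
      rw [← h1, hf]
      simp only
      rw [algState_congr (ω := ω') (ω' := ω) fun u hu => (h u (by omega)).symm,
        h _ (Nat.lt_succ_self _)]
    set E : Set (ℕ → JointStep S A) := {ω | ω ∈ playsAgreeing ω₀ (n + 1) ∧
      (algState G I ω (n + 1 + t + 1)).batch = k ∧
      (algState G I ω (n + 1 + t + 1)).unvisited = U} with hE
    have hEdep : DependsBefore (n + 1 + t + 1) E := by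
      rintro ω ω' h ⟨h1, h2⟩
      refine ⟨dependsBefore_playsAgreeing ω₀ (n + 1) ω ω' (fun u hu => h u (by omega)) h1, ?_⟩
      rwa [← algState_congr h]
    have hEf : ∀ c, E ∩ {ω | f ω = c} =
        if ∀ i, remaining I.d (t + 1) (c.1 i) (c.2.1 i) = U i then
          arrivalEvent G I ω₀ k n t c.1 c.2 else ∅ := by
      rintro ⟨W, y⟩
      ext ω
      constructor
      · rintro ⟨⟨h1, h2, h3⟩, h4⟩
        obtain ⟨h5, h6⟩ := not_ends_of_batch_eq (h2.trans (hω₀.of_mem_playsAgreeing h1).1.symm)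
        rw [(hω₀.of_mem_playsAgreeing h1).1] at h6
        have h7 : (algState G I ω (n + 1 + t)).unvisited = W := congrArg Prod.fst h4
        have h8 : ω (n + 1 + t) = y := congrArg Prod.snd h4
        have h9 : ∀ i, remaining I.d (t + 1) (W i) (y.1 i) = U i := fun i => by
          rw [← h3, algState_succ_of_not_ends h5, ← h7, ← h8]
          exact (stillUnvisited_in_playsAgreeing hω₀ h1 h6 i).symm
        rw [if_pos h9]
        exact ⟨h1, h6, h7, h8⟩
      · intro h
        split_ifs at h with h9
        · obtain ⟨h1, h2, h3, h4⟩ := h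
          have h5 : ∀ i, (algState G I ω (n + 1 + t)).stillUnvisited I (ω (n + 1 + t)) i = U i :=
            fun i => by
              rw [stillUnvisited_in_playsAgreeing hω₀ h1 h2, h3, h4]
              exact h9 i
          have h6 : ¬ BatchEnds G I ω (n + 1 + t) := fun h6 =>
            hU (funext fun i => (h5 i).symm.trans (h6 i))
          refine ⟨⟨h1, ?_, ?_⟩, Prod.ext h3 h4⟩
          · rw [batch_succ_of_not_ends h6, h2]
          · rw [algState_succ_of_not_ends h6]
            exact funext h5
        · exact absurd h (Set.notMem_empty ω)
    have hstep : ∀ c : (∀ i, Finset (S i)) × JointStep S A,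
        (algLaw G s₀ I).real (arrivalEvent G I ω₀ k n (t + 1) U z ∩ {ω | f ω = c}) =
        (algLaw G s₀ I).real (playsAgreeing ω₀ (n + 1)) *
          if ∀ i, remaining I.d (t + 1) (c.1 i) (c.2.1 i) = U i then
            ∏ i, arrivalLaw (chains G.P π i) I.d (κ i) t (c.1 i) (c.2.1 i) *
              (π i (c.2.1 i) (c.2.2 i) * (nextLaw G.P c.2 i (z.1 i) * π i (z.1 i) (z.2 i)))
          else 0 := by
      rintro ⟨W, y⟩
      have h1 : arrivalEvent G I ω₀ k n (t + 1) U z ∩ {ω | f ω = (W, y)} =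
          (E ∩ {ω | f ω = (W, y)}) ∩ {ω | ω (n + 1 + t + 1) = z} := by
        ext ω
        constructor
        · rintro ⟨⟨h1, h2, h3, h4⟩, h5⟩
          exact ⟨⟨⟨h1, h2, h3⟩, h5⟩, h4⟩
        · rintro ⟨⟨⟨h1, h2, h3⟩, h5⟩, h4⟩
          exact ⟨⟨h1, h2, h3, h4⟩, h5⟩
      have h2 : DependsBefore (n + 1 + t + 1) (E ∩ {ω | f ω = (W, y)}) := fun ω ω' h h3 =>
        ⟨hEdep ω ω' h h3.1, hfdep _ ω ω' h h3.2⟩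
      rw [h1]
      refine (hmarkov (n + 1 + t) _ h2 y (fun ω hω => congrArg Prod.snd hω.2)
        (fun ω hω => (batch_in_playsAgreeing hω₀ hω.1.1 (t := t + 1) hω.1.2.1).2) z).trans ?_
      change (algLaw G s₀ I).real _ * _ = _
      rw [hEf]
      split_ifs with h3
      · have hW : W ≠ fun _ => ∅ := by
          rintro rfl
          refine hU (funext fun i => ?_)
          rw [← h3 i]
          simp [remaining]
        rw [ih hW, mul_assoc, stepProb, ← Finset.prod_mul_distrib]
        simp only [mul_assoc]
      · rw [measureReal_empty, zero_mul, mul_zero]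
    rw [← sum_real_inter_fiber (algLaw G s₀ I) fun c => (hfdep c).measurableSet]
    simp only [hstep]
    rw [← Finset.mul_sum, Fintype.sum_prod_type, Finset.sum_comm]
    congr 1
    simp only
    have h1 : ∀ y : JointStep S A, ∑ W : ∀ i, Finset (S i),
        (if ∀ i, remaining I.d (t + 1) (W i) (y.1 i) = U i then
            ∏ i, arrivalLaw (chains G.P π i) I.d (κ i) t (W i) (y.1 i) *
              (π i (y.1 i) (y.2 i) * (nextLaw G.P y i (z.1 i) * π i (z.1 i) (z.2 i)))
          else 0) = ∏ i, (departureLaw (chains G.P π i) I.d (κ i) t (U i) (y.1 i) *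
            (π i (y.1 i) (y.2 i) * ((G.P i (y.1 i) (y.2 i) : S i → ℝ) (z.1 i) *
              π i (z.1 i) (z.2 i)))) := by
      intro y
      rw [sum_ite_forall_prod (fun i V => remaining I.d (t + 1) V (y.1 i) = U i)
        fun i V => arrivalLaw (chains G.P π i) I.d (κ i) t V (y.1 i) *
              (π i (y.1 i) (y.2 i) * (nextLaw G.P y i (z.1 i) * π i (z.1 i) (z.2 i)))]
      refine Finset.prod_congr rfl fun i _ => ?_
      rw [departureLaw, Finset.sum_mul]
      refine Finset.sum_congr rfl fun V _ => ?_
      split_ifs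
      · rfl
      · rw [zero_mul]
    simp only [h1]
    rw [sum_jointStep_prod fun i u => departureLaw (chains G.P π i) I.d (κ i) t (U i) u.1 *
      (π i u.1 u.2 * ((G.P i u.1 u.2 : S i → ℝ) (z.1 i) * π i (z.1 i) (z.2 i)))]
    refine Finset.prod_congr rfl fun i _ => ?_
    rw [arrivalLaw_succ, Fintype.sum_prod_type, Finset.sum_mul]
    refine Finset.sum_congr rfl fun x _ => ?_
    rw [chains_apply, Finset.mul_sum, Finset.sum_mul]
    exact Finset.sum_congr rfl fun a _ => by simp only; ring

end BatchLaw

/-! ### The end of a batch -/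

section BatchEnd

open Matrix

variable {ι : Type*} [Fintype ι] [DecidableEq ι] {S A : ι → Type*}
  [∀ i, Fintype (S i)] [∀ i, DecidableEq (S i)] [∀ i, Nonempty (S i)]
  [∀ i, Fintype (A i)] [∀ i, DecidableEq (A i)] [∀ i, Nonempty (A i)]
  {G : StochasticGame S A} {s₀ : ∀ i, S i} {I : AlgInput S A} {ω ω₀ : ℕ → JointStep S A}
  {k n : ℕ} {c : ℝ} [Nonempty ι]

/-- Batch `k` ends `t + 1` time instances after its first one, with the joint step `z`. -/
def endEvent (G : StochasticGame S A) (I : AlgInput S A) (ω₀ : ℕ → JointStep S A) (k n t : ℕ)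
    (z : JointStep S A) : Set (ℕ → JointStep S A) :=
  {ω | ω ∈ playsAgreeing ω₀ (n + 1) ∧ (algState G I ω (n + 1 + t)).batch = k ∧
    BatchEnds G I ω (n + 1 + t) ∧ ω (n + 1 + t) = z}

lemma dependsBefore_endEvent (t : ℕ) (z : JointStep S A) :
    DependsBefore (n + 1 + t + 1) (endEvent G I ω₀ k n t z) := by
  rintro ω ω' h ⟨h1, h2, h3, h4⟩
  have h5 : algState G I ω' (n + 1 + t) = algState G I ω (n + 1 + t) :=
    algState_congr fun u hu => (h u (by omega)).symm
  have h6 : ω' (n + 1 + t) = ω (n + 1 + t) := (h _ (Nat.lt_succ_self _)).symm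
  refine ⟨dependsBefore_playsAgreeing ω₀ (n + 1) ω ω' (fun u hu => h u (by omega)) h1, ?_, ?_, ?_⟩
  · rw [h5, h2]
  · rw [BatchEnds, h5, h6]
    exact h3
  · rw [h6, h4]

lemma dependsBefore_algState (m : ℕ) (p : AlgState S A → Prop) :
    DependsBefore m {ω | p (algState G I ω m)} := fun ω ω' h h1 => by
  rw [Set.mem_ofPred_eq] at h1 ⊢
  rwa [← algState_congr h]

/-- The batch ends when all players are done with the step, and it does not end before: hence the
difference of products in `batchEndAt`. -/
lemma real_endEvent (hd : 1 ≤ I.d) (hω₀ : IsStart G I ω₀ k (n + 1)) (t : ℕ) (z : JointStep S A) :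
    (algLaw G s₀ I).real (endEvent G I ω₀ k n t z) =
      (algLaw G s₀ I).real (playsAgreeing ω₀ (n + 1)) *
        (batchEndAt (chains G.P (algState G I ω₀ (n + 1)).policy) I.d (nextLaw G.P (ω₀ n)) t z.1 *
          jointProb (fun i => (algState G I ω₀ (n + 1)).policy i (z.1 i)) z.2) := by
  classical
  set π := (algState G I ω₀ (n + 1)).policy with hπ
  set κ := nextLaw G.P (ω₀ n) with hκ
  set a : (∀ i, Finset (S i)) → ℝ := fun W =>
    ∏ i, (arrivalLaw (chains G.P π i) I.d (κ i) t (W i) (z.1 i) * π i (z.1 i) (z.2 i)) with ha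
  have hfib : ∀ W, (algLaw G s₀ I).real (endEvent G I ω₀ k n t z ∩
      {ω | (algState G I ω (n + 1 + t)).unvisited = W}) =
      (algLaw G s₀ I).real (playsAgreeing ω₀ (n + 1)) *
        ((if ∀ i, remaining I.d (t + 1) (W i) (z.1 i) = ∅ then a W else 0) -
          if W = fun _ => ∅ then a W else 0) := by
    intro W
    by_cases hW : W = fun _ => ∅
    · have h1 : endEvent G I ω₀ k n t z ∩ {ω | (algState G I ω (n + 1 + t)).unvisited = W} = ∅ := by
        ext ω
        simp only [Set.mem_empty_iff_false, iff_false]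
        rintro ⟨⟨h1, h2, -⟩, h3⟩
        exact unvisited_ne_empty hd (hω₀.of_mem_playsAgreeing h1) h2 (Eq.trans h3 hW)
      have h2 : ∀ i, remaining I.d (t + 1) (W i) (z.1 i) = ∅ := fun i => by
        rw [hW]; simp [remaining]
      rw [h1, measureReal_empty, if_pos h2, if_pos hW, sub_self, mul_zero]
    · rw [if_neg hW, sub_zero]
      split_ifs with h1
      · rw [← real_arrivalEvent hd hω₀ t hW z]
        congr 1
        ext ω
        constructor
        · rintro ⟨⟨h2, h3, h4, h5⟩, h6⟩
          exact ⟨h2, h3, h6, h5⟩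
        · rintro ⟨h2, h3, h4, h5⟩
          refine ⟨⟨h2, h3, fun i => ?_, h5⟩, h4⟩
          rw [stillUnvisited_in_playsAgreeing hω₀ h2 h3, h4, h5, h1]
      · have h2 : endEvent G I ω₀ k n t z ∩
            {ω | (algState G I ω (n + 1 + t)).unvisited = W} = ∅ := by
          ext ω
          simp only [Set.mem_empty_iff_false, iff_false]
          rintro ⟨⟨h2, h3, h4, h5⟩, h6⟩
          refine h1 fun i => ?_
          rw [← h4 i, stillUnvisited_in_playsAgreeing hω₀ h2 h3, h5]
          exact congrArg (fun V => remaining I.d (t + 1) (V i) (z.1 i)) (Eq.symm h6)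
        rw [h2, measureReal_empty, mul_zero]
  rw [← sum_real_inter_fiber (algLaw G s₀ I) (f := fun ω => (algState G I ω (n + 1 + t)).unvisited)
    fun W => (dependsBefore_algState _ fun x => x.unvisited = W).measurableSet]
  simp only [hfib]
  rw [← Finset.mul_sum, Finset.sum_sub_distrib,
    sum_ite_forall_prod (fun i V => remaining I.d (t + 1) V (z.1 i) = ∅)
      fun i V => arrivalLaw (chains G.P π i) I.d (κ i) t V (z.1 i) * π i (z.1 i) (z.2 i),
    Finset.sum_ite_eq' Finset.univ, if_pos (Finset.mem_univ _), ha, batchEndAt, jointProb, sub_mul,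
    ← Finset.prod_mul_distrib, ← Finset.prod_mul_distrib]
  congr 3
  ext i
  rw [departureLaw, Finset.sum_mul]
  refine Finset.sum_congr rfl fun V _ => ?_
  split_ifs
  · rfl
  · rw [zero_mul]

/-- Batch `k` has not ended at the `N`-th time instance after its first one. -/
def ongoing (G : StochasticGame S A) (I : AlgInput S A) (ω₀ : ℕ → JointStep S A) (k n N : ℕ) :
    Set (ℕ → JointStep S A) :=
  playsAgreeing ω₀ (n + 1) ∩ {ω | (algState G I ω (n + 1 + N)).batch = k}

lemma measurableSet_ongoing (N : ℕ) : MeasurableSet (ongoing G I ω₀ k n N) :=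
  (dependsBefore_playsAgreeing ω₀ (n + 1)).measurableSet.inter
    (dependsBefore_algState _ fun x => x.batch = k).measurableSet

lemma ongoing_inter_ends (N : ℕ) (z : JointStep S A) :
    ongoing G I ω₀ k n N ∩ {ω | BatchEnds G I ω (n + 1 + N)} ∩ {ω | ω (n + 1 + N) = z} =
      endEvent G I ω₀ k n N z := by
  ext ω
  constructor
  · rintro ⟨⟨⟨h1, h2⟩, h3⟩, h4⟩
    exact ⟨h1, h2, h3, h4⟩
  · rintro ⟨h1, h2, h3, h4⟩
    exact ⟨⟨⟨h1, h2⟩, h3⟩, h4⟩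

lemma measurableSet_batchEnds (m : ℕ) : MeasurableSet {ω | BatchEnds G I ω m} :=
  DependsBefore.measurableSet (n := m + 1) fun ω ω' h h1 => by
    rw [Set.mem_ofPred_eq, BatchEnds] at h1 ⊢
    rwa [← algState_congr fun t ht => h t (ht.trans m.lt_succ_self), ← h m m.lt_succ_self]

lemma ongoing_succ (hω₀ : IsStart G I ω₀ k (n + 1)) (N : ℕ) :
    ongoing G I ω₀ k n (N + 1) =
      ongoing G I ω₀ k n N \ {ω | BatchEnds G I ω (n + 1 + N)} := by
  ext ω
  constructor
  · rintro ⟨h1, h2⟩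
    have h3 := (hω₀.of_mem_playsAgreeing h1).1
    obtain ⟨h4, h5⟩ := not_ends_of_batch_eq (Eq.trans h2 h3.symm)
    exact ⟨⟨h1, h5.trans h3⟩, h4⟩
  · rintro ⟨⟨h1, h2⟩, h3⟩
    exact ⟨h1, (batch_succ_of_not_ends h3).trans h2⟩

lemma real_ongoing (hd : 1 ≤ I.d) (hω₀ : IsStart G I ω₀ k (n + 1))
    (hK : ∀ i, IsContractingChain (chains G.P (algState G I ω₀ (n + 1)).policy i) c) (N : ℕ) :
    (algLaw G s₀ I).real (ongoing G I ω₀ k n N) =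
      (algLaw G s₀ I).real (playsAgreeing ω₀ (n + 1)) *
        (1 - ∏ i, coverProb (chains G.P (algState G I ω₀ (n + 1)).policy i) I.d
          (nextLaw G.P (ω₀ n) i) N) := by
  induction N with
  | zero =>
    have h1 : ongoing G I ω₀ k n 0 = playsAgreeing ω₀ (n + 1) :=
      Set.inter_eq_left.2 fun ω hω => (hω₀.of_mem_playsAgreeing hω).1
    rw [h1]
    simp [coverProb_zero]
  | succ N ih =>
    have h1 := measureReal_inter_add_sdiff (μ := algLaw G s₀ I) (s := ongoing G I ω₀ k n N)
      (measurableSet_batchEnds (G := G) (I := I) (n + 1 + N))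
    rw [← ongoing_succ hω₀, ← sum_real_inter_fiber (algLaw G s₀ I)
      (fun z => measurableSet_apply_eq (n + 1 + N) z)] at h1
    simp only [ongoing_inter_ends, real_endEvent hd hω₀] at h1
    rw [← Finset.mul_sum, sum_jointStep] at h1
    have h2 : ∀ x : ∀ i, S i, ∑ a, batchEndAt (chains G.P (algState G I ω₀ (n + 1)).policy) I.d
        (nextLaw G.P (ω₀ n)) N (JointStep.mk x a : JointStep S A).1 *
        jointProb (fun i => (algState G I ω₀ (n + 1)).policy i
          ((JointStep.mk x a : JointStep S A).1 i)) (JointStep.mk x a : JointStep S A).2 =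
        batchEndAt (chains G.P (algState G I ω₀ (n + 1)).policy) I.d (nextLaw G.P (ω₀ n)) N x := by
      intro x
      change ∑ a, batchEndAt _ _ _ _ x *
        jointProb (fun i => (algState G I ω₀ (n + 1)).policy i (x i)) a = _
      rw [← Finset.mul_sum, sum_jointProb, mul_one]
    simp only [h2, sum_batchEndAt hK] at h1
    rw [ih] at h1
    linarith

lemma tendsto_real_ongoing (hd : 1 ≤ I.d) (hω₀ : IsStart G I ω₀ k (n + 1))
    (hK : ∀ i, IsContractingChain (chains G.P (algState G I ω₀ (n + 1)).policy i) c)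
    (hprim : ∀ i, (chains G.P (algState G I ω₀ (n + 1)).policy i).IsPrimitive) :
    Tendsto (fun N => (algLaw G s₀ I).real (ongoing G I ω₀ k n N)) atTop (𝓝 0) := by
  simp only [real_ongoing hd hω₀ hK]
  have := ((tendsto_prod_coverProb (d := I.d) hK hprim (nextLaw_nonneg (P := G.P) (ω₀ n))
    (sum_nextLaw (ω₀ n))).const_sub 1).const_mul
      ((algLaw G s₀ I).real (playsAgreeing ω₀ (n + 1)))
  simpa using this

lemma startTime_of_endEvent {t : ℕ} {z : JointStep S A} (hω : ω ∈ endEvent G I ω₀ k n t z) :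
    IsStart G I ω (k + 1) (n + 1 + t + 1) := by
  have h := hω.2.2.1.isStart
  rwa [hω.2.1] at h

/-- The law of the last joint step of a batch. -/
lemma real_lastStep (hd : 1 ≤ I.d) (hω₀ : IsStart G I ω₀ k (n + 1))
    (hK : ∀ i, IsContractingChain (chains G.P (algState G I ω₀ (n + 1)).policy i) c)
    (hprim : ∀ i, (chains G.P (algState G I ω₀ (n + 1)).policy i).IsPrimitive)
    (z : JointStep S A) :
    (algLaw G s₀ I).real (playsAgreeing ω₀ (n + 1) ∩ {ω | lastStep G I (k + 1) ω = z}) =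
      (algLaw G s₀ I).real (playsAgreeing ω₀ (n + 1)) *
        batchKernel G.P (algState G I ω₀ (n + 1)).policy I.d (ω₀ n) z := by
  set π := (algState G I ω₀ (n + 1)).policy with hπ
  set F := playsAgreeing ω₀ (n + 1) ∩ {ω | lastStep G I (k + 1) ω = z} with hF
  -- decompose according to the duration of the batch
  have h1 : ∀ N, (algLaw G s₀ I).real (F \ ongoing G I ω₀ k n N) =
      ∑ t ∈ Finset.range N, (algLaw G s₀ I).real (endEvent G I ω₀ k n t z) := by
    intro N
    induction N with
    | zero =>
      have h2 : F \ ongoing G I ω₀ k n 0 = ∅ := Set.sdiff_eq_empty.2 fun ω hω =>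
        ⟨hω.1, (hω₀.of_mem_playsAgreeing hω.1).1⟩
      rw [h2, measureReal_empty, Finset.range_zero, Finset.sum_empty]
    | succ N ih =>
      have h2 : F \ ongoing G I ω₀ k n (N + 1) =
          (F \ ongoing G I ω₀ k n N) ∪ endEvent G I ω₀ k n N z := by
        rw [ongoing_succ hω₀]
        ext ω
        constructor
        · rintro ⟨h2, h3⟩
          by_cases h4 : ω ∈ ongoing G I ω₀ k n N
          · right
            have h5 : BatchEnds G I ω (n + 1 + N) := by
              by_contra h5
              exact h3 ⟨h4, h5⟩
            refine ⟨h2.1, h4.2, h5, ?_⟩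
            have h6 := h5.isStart
            rw [show (algState G I ω (n + 1 + N)).batch = k from h4.2] at h6
            rw [← h6.lastStep_eq]
            exact h2.2
          · exact Or.inl ⟨h2, h4⟩
        · rintro (⟨h2, h3⟩ | h2)
          · exact ⟨h2, fun h4 => h3 h4.1⟩
          · refine ⟨⟨h2.1, ?_⟩, fun h3 => h3.2 h2.2.2.1⟩
            exact (startTime_of_endEvent h2).lastStep_eq.trans h2.2.2.2
      rw [h2, measureReal_union ?_ (dependsBefore_endEvent N z).measurableSet, ih,
        Finset.sum_range_succ]
      exact Set.disjoint_left.2 fun ω h3 h4 => h3.2 ⟨h4.1, h4.2.1⟩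
  have h2 : Tendsto (fun N => (algLaw G s₀ I).real (F \ ongoing G I ω₀ k n N)) atTop
      (𝓝 ((algLaw G s₀ I).real (playsAgreeing ω₀ (n + 1)) * batchKernel G.P π I.d (ω₀ n) z)) := by
    simp only [h1, real_endEvent hd hω₀, ← Finset.mul_sum, ← Finset.sum_mul]
    exact ((tendsto_sum_batchEndAt hK (nextLaw_nonneg _) (sum_nextLaw _) _).mul_const _).const_mul _
  have h3 : Tendsto (fun N => (algLaw G s₀ I).real (ongoing G I ω₀ k n N)) atTop (𝓝 0) :=
    tendsto_real_ongoing hd hω₀ hK hprim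
  have h4 : Tendsto (fun N => (algLaw G s₀ I).real (F ∩ ongoing G I ω₀ k n N)) atTop (𝓝 0) :=
    squeeze_zero (fun _ => measureReal_nonneg)
      (fun N => measureReal_mono Set.inter_subset_right) h3
  have h5 := h4.add h2
  rw [zero_add] at h5
  refine tendsto_nhds_unique (tendsto_const_nhds.congr fun N => ?_) h5
  exact (measureReal_inter_add_sdiff (measurableSet_ongoing N)).symm

/-- Almost surely every batch ends. -/
lemma real_never_ends (hd : 1 ≤ I.d) (hω₀ : IsStart G I ω₀ k (n + 1))
    (hK : ∀ i, IsContractingChain (chains G.P (algState G I ω₀ (n + 1)).policy i) c)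
    (hprim : ∀ i, (chains G.P (algState G I ω₀ (n + 1)).policy i).IsPrimitive) :
    (algLaw G s₀ I).real (playsAgreeing ω₀ (n + 1) ∩ {ω | startTime G I (k + 1) ω = 0}) = 0 := by
  have h3 : Tendsto (fun N => (algLaw G s₀ I).real (ongoing G I ω₀ k n N)) atTop (𝓝 0) :=
    tendsto_real_ongoing hd hω₀ hK hprim
  refine le_antisymm (ge_of_tendsto' h3 fun N => measureReal_mono fun ω hω => ⟨hω.1, ?_⟩)
    measureReal_nonneg
  have h1 := hω₀.of_mem_playsAgreeing hω.1
  rw [Set.mem_ofPred_eq]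
  have h2 : k ≤ (algState G I ω (n + 1 + N)).batch := by
    rw [← h1.1]; exact batch_mono (Nat.le_add_right _ _)
  rcases h2.eq_or_lt with h4 | h4
  · exact h4.symm
  · exfalso
    rw [show n + 1 + N = (n + N) + 1 by omega] at h4
    obtain ⟨m, -, hm⟩ := exists_isStart hd (n + N) h4
    have h5 : startTime G I (k + 1) ω = 0 := hω.2
    rw [hm.startTime_eq] at h5
    exact hm.pos.ne' h5

end BatchEnd

/-! ### The mean of the reward vector of a batch -/

section BatchReward

open Matrix

variable {ι : Type*} [Fintype ι] [DecidableEq ι] {S A : ι → Type*}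
  [∀ i, Fintype (S i)] [∀ i, DecidableEq (S i)] [∀ i, Nonempty (S i)]
  [∀ i, Fintype (A i)] [∀ i, DecidableEq (A i)] [∀ i, Nonempty (A i)]
  {G : StochasticGame S A} {s₀ : ∀ i, S i} {I : AlgInput S A} {ω ω₀ : ℕ → JointStep S A}
  {k n : ℕ} {c : ℝ} [Nonempty ι]

/-- The weight `1 / π` of a sample compensates for the probability `π` of its action. -/
lemma sum_arrivalLaw_mul_weight {P : ∀ i, TransitionModel (S i) (A i)}
    {π : ∀ i, StationaryPolicy (S i) (A i)} {d : ℕ} {κ : ∀ i, S i → ℝ}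
    (i : ι) (u : S i × A i) (hu : π i u.1 u.2 ≠ 0) (x : ℝ) (t : ℕ) (z : JointStep S A) :
    ∑ W : ∀ j, Finset (S j),
      (∏ j, arrivalLaw (chains P π j) d (κ j) t (W j) (z.1 j) * π j (z.1 j) (z.2 j)) *
        (if d ≤ t + 1 ∧ z.1 i ∈ W i ∧ (z.1 i, z.2 i) = u then x / π i u.1 u.2 else 0) =
      firstVisitProb (chains P π i) d (κ i) u.1 t * (x *
        ∏ j, Function.update (pairLaw P π κ t) i (Pi.single u 1) j (z.1 j, z.2 j)) := by
  rw [prod_update_apply, firstVisitProb]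
  by_cases hd : d ≤ t + 1
  swap
  · simp [hd]
  by_cases hz : (z.1 i, z.2 i) = u
  swap
  · rw [Pi.single_eq_of_ne hz]
    simp [hz]
  have hs : (Pi.single u 1 : S i × A i → ℝ) (z.1 i, z.2 i) = 1 := by rw [hz, Pi.single_eq_same]
  rw [if_pos hd, hs, one_mul]
  have hz1 : z.1 i = u.1 := congrArg Prod.fst hz
  have hz2 : z.2 i = u.2 := congrArg Prod.snd hz
  have h1 : ∀ W : ∀ j, Finset (S j),
      (∏ j, arrivalLaw (chains P π j) d (κ j) t (W j) (z.1 j) * π j (z.1 j) (z.2 j)) *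
        (if d ≤ t + 1 ∧ z.1 i ∈ W i ∧ (z.1 i, z.2 i) = u then x / π i u.1 u.2 else 0) =
      (if ∀ j, j = i → z.1 j ∈ W j then
        ∏ j, arrivalLaw (chains P π j) d (κ j) t (W j) (z.1 j) * π j (z.1 j) (z.2 j) else 0) *
        (x / π i u.1 u.2) := by
    intro W
    have h2 : (∀ j, j = i → z.1 j ∈ W j) ↔ z.1 i ∈ W i :=
      ⟨fun h => h i rfl, fun h j hj => by subst hj; exact h⟩
    by_cases h3 : z.1 i ∈ W i
    · rw [if_pos ⟨hd, h3, hz⟩, if_pos (h2.2 h3)]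
    · rw [if_neg fun h => h3 h.2.1, if_neg fun h => h3 (h2.1 h), mul_zero, zero_mul]
  rw [Finset.sum_congr rfl fun W _ => h1 W, ← Finset.sum_mul,
    sum_ite_forall_prod (fun j V => j = i → z.1 j ∈ V)
    fun j V => arrivalLaw (chains P π j) d (κ j) t V (z.1 j) * π j (z.1 j) (z.2 j),
    ← Finset.mul_prod_erase _ _ (Finset.mem_univ i)]
  have h2 : (∑ V, if i = i → z.1 i ∈ V then
      arrivalLaw (chains P π i) d (κ i) t V (z.1 i) * π i (z.1 i) (z.2 i) else 0) =
      (∑ V with u.1 ∈ V, arrivalLaw (chains P π i) d (κ i) t V u.1) * π i u.1 u.2 := by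
    rw [Finset.sum_filter, Finset.sum_mul, hz1, hz2]
    refine Finset.sum_congr rfl fun V _ => ?_
    by_cases h : u.1 ∈ V <;> simp [h]
  have h3 : ∏ j ∈ Finset.univ.erase i, (∑ V, if j = i → z.1 j ∈ V then
      arrivalLaw (chains P π j) d (κ j) t V (z.1 j) * π j (z.1 j) (z.2 j) else 0) =
      ∏ j ∈ Finset.univ.erase i, pairLaw P π κ t j (z.1 j, z.2 j) := by
    refine Finset.prod_congr rfl fun j hj => ?_
    have hji := Finset.ne_of_mem_erase hj
    rw [pairLaw, ← sum_arrivalLaw (d := d), Finset.sum_mul]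
    exact Finset.sum_congr rfl fun V _ => if_pos fun h => absurd h hji
  rw [h2, h3]
  field_simp

open Classical in
/-- The contribution of the time `t` of batch `k` to the coordinate `u` of the reward vector. -/
def incrementAt (G : StochasticGame S A) (I : AlgInput S A) (ω₀ : ℕ → JointStep S A) (k n : ℕ)
    (i : ι) (u : S i × A i) (t : ℕ) (ω : ℕ → JointStep S A) : ℝ :=
  if ω ∈ ongoing G I ω₀ k n t then
    increment G I (algState G I ω (n + 1 + t)) i u (ω (n + 1 + t)) else 0

/-- The reward vector of a batch is the sum of the contributions of its time instances. -/
lemma sum_incrementAt (hd : 1 ≤ I.d) (hω₀ : IsStart G I ω₀ k (n + 1)) (i : ι) (u : S i × A i)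
    (hω : ω ∈ playsAgreeing ω₀ (n + 1)) (N : ℕ) :
    (ω ∈ ongoing G I ω₀ k n N → (algState G I ω (n + 1 + N)).R i u =
      ∑ t ∈ Finset.range N, incrementAt G I ω₀ k n i u t ω) ∧
    (ω ∉ ongoing G I ω₀ k n N → batchReward G I k ω i u =
      ∑ t ∈ Finset.range N, incrementAt G I ω₀ k n i u t ω) := by
  have hstart := hω₀.of_mem_playsAgreeing hω
  induction N with
  | zero =>
    refine ⟨fun _ => ?_, fun h => absurd ⟨hω, hstart.1⟩ h⟩
    rw [add_zero, (hstart.fresh hd).1]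
    simp
  | succ N ih =>
    rw [Finset.sum_range_succ, ongoing_succ hω₀]
    by_cases h1 : ω ∈ ongoing G I ω₀ k n N
    · rw [← ih.1 h1, incrementAt, if_pos h1, ← sampledR_eq]
      constructor
      · rintro ⟨-, h2⟩
        rw [← add_assoc, algState_succ_of_not_ends h2]
      · intro h2
        have h3 : BatchEnds G I ω (n + 1 + N) := by
          by_contra h3
          exact h2 ⟨h1, h3⟩
        have h4 := h3.isStart
        rw [show (algState G I ω (n + 1 + N)).batch = k from h1.2] at h4
        rw [h4.batchReward_eq]
    · rw [← ih.2 h1, incrementAt, if_neg h1, add_zero]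
      exact ⟨fun h => absurd h.1 h1, fun _ => rfl⟩

lemma incrementAt_eq_sum (hω₀ : IsStart G I ω₀ k (n + 1)) (i : ι) (u : S i × A i) (t : ℕ)
    (ω : ℕ → JointStep S A) : incrementAt G I ω₀ k n i u t ω =
      ∑ c : (∀ j, Finset (S j)) × JointStep S A,
        (arrivalEvent G I ω₀ k n t c.1 c.2).indicator (fun _ =>
          if I.d ≤ t + 1 ∧ c.2.1 i ∈ c.1 i ∧ (c.2.1 i, c.2.2 i) = u then
            G.r i c.2.1 c.2.2 / (algState G I ω₀ (n + 1)).policy i u.1 u.2 else 0) ω := by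
  classical
  rw [incrementAt]
  split_ifs with h
  · rw [Finset.sum_eq_single ((algState G I ω (n + 1 + t)).unvisited, ω (n + 1 + t))]
    · obtain ⟨h2, h3⟩ := batch_in_playsAgreeing hω₀ h.1 h.2
      have h4 : ω ∈ arrivalEvent G I ω₀ k n t (algState G I ω (n + 1 + t)).unvisited
          (ω (n + 1 + t)) := ⟨h.1, h.2, rfl, rfl⟩
      rw [Set.indicator_of_mem h4, increment, h2, h3]
    · intro c _ hc
      refine Set.indicator_of_notMem (fun h1 => hc ?_) _
      exact Prod.ext h1.2.2.1.symm h1.2.2.2.symm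
    · simp
  · refine (Finset.sum_eq_zero fun c _ => Set.indicator_of_notMem (fun h1 => h ?_) _).symm
    exact ⟨h1.1, h1.2.1⟩

lemma integrable_indicator_arrivalEvent (t : ℕ) (W : ∀ j, Finset (S j)) (z : JointStep S A)
    (x : ℝ) : Integrable ((arrivalEvent G I ω₀ k n t W z).indicator fun _ => x)
      (algLaw G s₀ I) :=
  (integrable_const x).indicator (dependsBefore_arrivalEvent t W z).measurableSet

lemma integrable_incrementAt (hω₀ : IsStart G I ω₀ k (n + 1)) (i : ι) (u : S i × A i) (t : ℕ) :
    Integrable (incrementAt G I ω₀ k n i u t) (algLaw G s₀ I) := by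
  rw [funext (incrementAt_eq_sum hω₀ i u t)]
  exact integrable_finsetSum _ fun c _ => integrable_indicator_arrivalEvent t c.1 c.2 _

lemma integral_incrementAt (hd : 1 ≤ I.d) (hω₀ : IsStart G I ω₀ k (n + 1)) (i : ι)
    (u : S i × A i) (hu : (algState G I ω₀ (n + 1)).policy i u.1 u.2 ≠ 0) (t : ℕ) :
    ∫ ω, incrementAt G I ω₀ k n i u t ω ∂(algLaw G s₀ I) =
      (algLaw G s₀ I).real (playsAgreeing ω₀ (n + 1)) *
        rewardAt G.P (algState G I ω₀ (n + 1)).policy I.d (fun z => G.r i z.1 z.2) i u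
          (nextLaw G.P (ω₀ n)) t := by
  simp only [incrementAt_eq_sum hω₀ i u t]
  rw [integral_finsetSum _ fun c _ => integrable_indicator_arrivalEvent t c.1 c.2 _]
  simp only [integral_indicator_const _ (dependsBefore_arrivalEvent t _ _).measurableSet,
    smul_eq_mul]
  have h1 : ∀ c : (∀ j, Finset (S j)) × JointStep S A,
      (algLaw G s₀ I).real (arrivalEvent G I ω₀ k n t c.1 c.2) *
        (if I.d ≤ t + 1 ∧ c.2.1 i ∈ c.1 i ∧ (c.2.1 i, c.2.2 i) = u then
            G.r i c.2.1 c.2.2 / (algState G I ω₀ (n + 1)).policy i u.1 u.2 else 0) =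
      (algLaw G s₀ I).real (playsAgreeing ω₀ (n + 1)) *
        ((∏ j, arrivalLaw (chains G.P (algState G I ω₀ (n + 1)).policy j) I.d
          (nextLaw G.P (ω₀ n) j) t (c.1 j) (c.2.1 j) *
            (algState G I ω₀ (n + 1)).policy j (c.2.1 j) (c.2.2 j)) *
        (if I.d ≤ t + 1 ∧ c.2.1 i ∈ c.1 i ∧ (c.2.1 i, c.2.2 i) = u then
            G.r i c.2.1 c.2.2 / (algState G I ω₀ (n + 1)).policy i u.1 u.2 else 0)) := by
    intro c
    by_cases hc : c.1 = fun _ => ∅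
    · have h2 : ¬ (I.d ≤ t + 1 ∧ c.2.1 i ∈ c.1 i ∧ (c.2.1 i, c.2.2 i) = u) := by
        rw [hc]; simp
      rw [if_neg h2, mul_zero, mul_zero, mul_zero]
    · rw [real_arrivalEvent hd hω₀ t hc, mul_assoc]
  simp only [h1]
  rw [← Finset.mul_sum, Fintype.sum_prod_type, Finset.sum_comm]
  congr 1
  simp only [sum_arrivalLaw_mul_weight i u hu]
  rw [← Finset.mul_sum, rewardAt, avgValue]

/-- The expected reward vector of a batch. -/
lemma setIntegral_batchReward (hd : 1 ≤ I.d) (hω₀ : IsStart G I ω₀ k (n + 1))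
    (hδ : ∀ i, 0 < I.δ i) (hρ : ∀ i, I.ρ₀ i ∈ shrunkPolytope (G.P i) (I.δ i))
    (hmax : ∀ i y, ∃ ρ ∈ shrunkPolytope (G.P i) (I.δ i),
      IsMaxOn (dualObjective (I.h i) y) (shrunkPolytope (G.P i) (I.δ i)) ρ)
    (hK : ∀ i, IsContractingChain (chains G.P (algState G I ω₀ (n + 1)).policy i) c)
    (hprim : ∀ i, (chains G.P (algState G I ω₀ (n + 1)).policy i).IsPrimitive) (i : ι)
    (u : S i × A i) :
    ∫ ω in playsAgreeing ω₀ (n + 1), batchReward G I k ω i u ∂(algLaw G s₀ I) =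
      (algLaw G s₀ I).real (playsAgreeing ω₀ (n + 1)) *
        expectedReward G.P (algState G I ω₀ (n + 1)).policy I.d (fun z => G.r i z.1 z.2) i u
          (ω₀ n) := by
  set π := (algState G I ω₀ (n + 1)).policy with hπ
  set Q := algLaw G s₀ I with hQ
  have hu : π i u.1 u.2 ≠ 0 :=
    ((hδ i).trans_le (le_inducedPolicy (hδ i) (algState_mem hρ hmax _ i) _ _)).ne'
  have hms : MeasurableSet (playsAgreeing ω₀ (n + 1)) :=
    (dependsBefore_playsAgreeing ω₀ (n + 1)).measurableSet
  have hmem := fun ω => batchReward_mem (ω := ω) hδ hρ hmax k i u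
  have hintR : Integrable (fun ω => batchReward G I k ω i u) Q := by
    refine Integrable.of_bound (measurable_of_cells (measurableSet_startHistory (k + 1))
      fun ω ω' h => by rw [batchReward_congr h]).aestronglyMeasurable (1 / I.δ i)
      (Eventually.of_forall fun ω => ?_)
    rw [Real.norm_eq_abs, abs_of_nonneg (hmem ω).1]
    exact (hmem ω).2
  have hset : ∀ t, ∫ ω in playsAgreeing ω₀ (n + 1), incrementAt G I ω₀ k n i u t ω ∂Q =
      ∫ ω, incrementAt G I ω₀ k n i u t ω ∂Q := fun t =>
    setIntegral_eq_integral_of_forall_compl_eq_zero fun ω hω => if_neg fun h => hω h.1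
  -- the first `N` time instances give the reward vector unless the batch lasts longer
  have hbound : ∀ N, |∫ ω in playsAgreeing ω₀ (n + 1), batchReward G I k ω i u ∂Q -
      Q.real (playsAgreeing ω₀ (n + 1)) * ∑ t ∈ Finset.range N,
        rewardAt G.P π I.d (fun z => G.r i z.1 z.2) i u (nextLaw G.P (ω₀ n)) t| ≤
      Q.real (ongoing G I ω₀ k n N) * (1 / I.δ i) := by
    intro N
    rw [Finset.mul_sum]
    simp only [hπ, hQ, ← integral_incrementAt hd hω₀ i u hu]
    simp only [← hQ, ← hset]
    rw [← integral_finsetSum _ fun t _ => (integrable_incrementAt hω₀ i u t).integrableOn,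
      ← integral_sub hintR.integrableOn
        (integrable_finsetSum _ fun t _ => (integrable_incrementAt hω₀ i u t).integrableOn),
      ← Real.norm_eq_abs]
    have h1 : ∫ ω in playsAgreeing ω₀ (n + 1),
        (ongoing G I ω₀ k n N).indicator (fun _ => 1 / I.δ i) ω ∂Q =
        Q.real (ongoing G I ω₀ k n N) * (1 / I.δ i) := by
      rw [setIntegral_eq_integral_of_forall_compl_eq_zero fun ω hω =>
        Set.indicator_of_notMem (fun h => hω h.1) _,
        integral_indicator_const _ (measurableSet_ongoing N), smul_eq_mul]
    rw [← h1]
    refine norm_integral_le_of_norm_le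
      ((integrable_const _).indicator (measurableSet_ongoing N)).integrableOn ?_
    refine (ae_restrict_iff' hms).2 (Eventually.of_forall fun ω hω => ?_)
    obtain ⟨h2, h3⟩ := sum_incrementAt hd hω₀ i u hω N
    by_cases h4 : ω ∈ ongoing G I ω₀ k n N
    · have h5 := (reward_mem (ω := ω) hδ hρ hmax (n + 1 + N) i u).1.2
      rw [← h2 h4, Set.indicator_of_mem h4, Real.norm_eq_abs, abs_le]
      have h6 := hmem ω
      constructor <;> linarith [h5.1, h5.2, h6.1, h6.2]
    · rw [← h3 h4, Set.indicator_of_notMem h4, sub_self, norm_zero]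
  have hlim1 : Tendsto (fun N => Q.real (ongoing G I ω₀ k n N) * (1 / I.δ i)) atTop (𝓝 0) := by
    simpa using (tendsto_real_ongoing (s₀ := s₀) hd hω₀ hK hprim).mul_const (1 / I.δ i)
  have hlim2 := (((summable_rewardAt (d := I.d) (κ := nextLaw G.P (ω₀ n)) hK
    (nextLaw_nonneg _) (sum_nextLaw _)
    (fun z => (G.r_mem i z.1 z.2).1) (fun z => (G.r_mem i z.1 z.2).2) i u).hasSum.tendsto_sum_nat
      ).const_mul (Q.real (playsAgreeing ω₀ (n + 1)))).const_sub
        (∫ ω in playsAgreeing ω₀ (n + 1), batchReward G I k ω i u ∂Q)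
  have h := le_of_tendsto_of_tendsto' hlim2.abs hlim1 hbound
  exact sub_eq_zero.1 (abs_nonpos_iff.1 h)

end BatchReward

/-! ### Continuity of the batch laws in the policies -/

section Continuity

/-- Sums of series depend continuously on a parameter if bounds on their tails do. -/
lemma tendsto_tsum_of_tail {f tail : ℕ → ℕ → ℝ} {g tail' : ℕ → ℝ}
    (hf : ∀ t, Tendsto (fun k => f k t) atTop (𝓝 (g t)))
    (h1 : ∀ k N, |∑' t, f k t - ∑ t ∈ Finset.range N, f k t| ≤ tail k N)
    (h2 : ∀ N, |∑' t, g t - ∑ t ∈ Finset.range N, g t| ≤ tail' N)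
    (h3 : ∀ N, Tendsto (fun k => tail k N) atTop (𝓝 (tail' N)))
    (h4 : Tendsto tail' atTop (𝓝 0)) :
    Tendsto (fun k => ∑' t, f k t) atTop (𝓝 (∑' t, g t)) := by
  rw [Metric.tendsto_atTop]
  intro γ hγ
  obtain ⟨N, hN⟩ := (h4.eventually (gt_mem_nhds (show 0 < γ / 4 by positivity))).exists
  have h5 : Tendsto (fun k => |∑ t ∈ Finset.range N, f k t - ∑ t ∈ Finset.range N, g t|) atTop
      (𝓝 0) := by
    simpa using ((tendsto_finsetSum (Finset.range N) fun t _ => hf t).sub_const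
      (∑ t ∈ Finset.range N, g t)).abs
  obtain ⟨K, hK⟩ := eventually_atTop.1 ((h5.eventually (gt_mem_nhds (show 0 < γ / 4 by
    positivity))).and ((h3 N).eventually (gt_mem_nhds hN)))
  refine ⟨K, fun k hk => ?_⟩
  rw [Real.dist_eq]
  calc |∑' t, f k t - ∑' t, g t| = |(∑' t, f k t - ∑ t ∈ Finset.range N, f k t) +
        (∑ t ∈ Finset.range N, f k t - ∑ t ∈ Finset.range N, g t) -
        (∑' t, g t - ∑ t ∈ Finset.range N, g t)| := by ring_nf
    _ ≤ |∑' t, f k t - ∑ t ∈ Finset.range N, f k t| +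
        |∑ t ∈ Finset.range N, f k t - ∑ t ∈ Finset.range N, g t| +
        |∑' t, g t - ∑ t ∈ Finset.range N, g t| :=
      (abs_sub _ _).trans (add_le_add (abs_add_le _ _) le_rfl)
    _ < γ := by linarith [h1 k N, h2 N, (hK k hk).1, (hK k hk).2]

variable {ι : Type*} [Fintype ι] [DecidableEq ι] {S A : ι → Type*}
  [∀ i, Fintype (S i)] [∀ i, DecidableEq (S i)] [∀ i, Nonempty (S i)]
  [∀ i, Fintype (A i)] [∀ i, DecidableEq (A i)]
  {P : ∀ i, TransitionModel (S i) (A i)} {π : ∀ i, StationaryPolicy (S i) (A i)}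
  {πs : ℕ → ∀ i, StationaryPolicy (S i) (A i)} {d : ℕ} {τ : ℝ}

/-- The tail of the series for `batchEnd` is at most the probability of a long batch, which is
continuous in the policies. -/
lemma abs_batchEnd_sub_le [Nonempty ι] (hG : ∀ i, UniformlyErgodic (P i) τ)
    {κ : ∀ i, S i → ℝ} (hκ0 : ∀ i x, 0 ≤ κ i x) (hκ : ∀ i, ∑ x, κ i x = 1) (y : ∀ i, S i)
    (N : ℕ) : |∑' t, batchEndAt (chains P π) d κ t y -
      ∑ t ∈ Finset.range N, batchEndAt (chains P π) d κ t y| ≤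
      1 - ∏ i, coverProb (chains P π i) d (κ i) N := by
  have hK : ∀ i, IsContractingChain (chains P π i) (Real.exp (-1 / τ)) :=
    fun i => (hG i).isContractingChain (π i)
  have hnn : ∀ y, 0 ≤ batchEnd (chains P π) d κ y -
      ∑ t ∈ Finset.range N, batchEndAt (chains P π) d κ t y := fun y => sub_nonneg.2 <|
    (summable_batchEndAt hK hκ0 hκ y).sum_le_tsum _ fun t _ => batchEndAt_nonneg hK hκ0 t y
  change |batchEnd (chains P π) d κ y - _| ≤ _
  rw [abs_of_nonneg (hnn y)]
  refine (Finset.single_le_sum (fun y _ => hnn y) (Finset.mem_univ y)).trans (le_of_eq ?_)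
  rw [Finset.sum_sub_distrib, sum_batchEnd (K := chains P π) hK (fun i => (hG i (π i)).1) hκ0 hκ,
    Finset.sum_comm, sum_range_sum_batchEndAt hK]

lemma tendsto_arrivalLaw (hπ : Tendsto πs atTop (𝓝 π)) (i : ι) (κ : S i → ℝ) (t : ℕ)
    (V : Finset (S i)) (y : S i) :
    Tendsto (fun k => arrivalLaw (chains P (πs k) i) d κ t V y) atTop
      (𝓝 (arrivalLaw (chains P π i) d κ t V y)) := by
  have h1 : Tendsto (fun k => chains P (πs k) i) atTop (𝓝 (chains P π i)) :=
    ((continuous_inducedChain (P i)).tendsto _).comp (tendsto_pi_nhds.1 hπ i)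
  exact ((continuous_arrivalLaw d t V y).tendsto (chains P π i, κ)).comp
    (h1.prodMk_nhds tendsto_const_nhds)

lemma tendsto_departureLaw (hπ : Tendsto πs atTop (𝓝 π)) (i : ι) (κ : S i → ℝ) (t : ℕ)
    (V : Finset (S i)) (y : S i) :
    Tendsto (fun k => departureLaw (chains P (πs k) i) d κ t V y) atTop
      (𝓝 (departureLaw (chains P π i) d κ t V y)) := by
  simp only [departureLaw]
  refine tendsto_finsetSum _ fun W _ => ?_
  split_ifs
  · exact tendsto_arrivalLaw hπ i κ t W y
  · exact tendsto_const_nhds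

lemma tendsto_coverProb_policy (hπ : Tendsto πs atTop (𝓝 π)) (i : ι) (κ : S i → ℝ) (N : ℕ) :
    Tendsto (fun k => coverProb (chains P (πs k) i) d κ N) atTop
      (𝓝 (coverProb (chains P π i) d κ N)) :=
  tendsto_finsetSum _ fun y _ => tendsto_arrivalLaw hπ i κ N ∅ y

lemma tendsto_policy_apply (hπ : Tendsto πs atTop (𝓝 π)) (i : ι) (x : S i) (a : A i) :
    Tendsto (fun k => πs k i x a) atTop (𝓝 (π i x a)) := by
  have h1 : Tendsto (fun k => πs k i x) atTop (𝓝 (π i x)) :=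
    tendsto_pi_nhds.1 (tendsto_pi_nhds.1 hπ i) x
  exact tendsto_pi_nhds.1 ((continuous_subtype_val.tendsto _).comp h1) a

lemma tendsto_batchKernel [Nonempty ι] (hG : ∀ i, UniformlyErgodic (P i) τ)
    (hπ : Tendsto πs atTop (𝓝 π)) (z z' : JointStep S A) :
    Tendsto (fun k => batchKernel P (πs k) d z z') atTop (𝓝 (batchKernel P π d z z')) := by
  refine Tendsto.mul ?_ (tendsto_finsetProd _ fun i _ => tendsto_policy_apply hπ i _ _)
  refine tendsto_tsum_of_tail (fun t => ?_)
    (fun k N => abs_batchEnd_sub_le hG (nextLaw_nonneg z) (sum_nextLaw z) z'.1 N)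
    (fun N => abs_batchEnd_sub_le hG (nextLaw_nonneg z) (sum_nextLaw z) z'.1 N) (fun N => ?_) ?_
  · exact (tendsto_finsetProd _ fun i _ => tendsto_departureLaw hπ i _ _ _ _).sub
      (tendsto_finsetProd _ fun i _ => tendsto_arrivalLaw hπ i _ _ _ _)
  · exact (tendsto_finsetProd _ fun i _ => tendsto_coverProb_policy hπ i _ _).const_sub 1
  · simpa using (tendsto_prod_coverProb (K := chains P π) (d := d)
      (fun i => (hG i).isContractingChain (π i)) (fun i => (hG i (π i)).1)
      (nextLaw_nonneg (P := P) z) (sum_nextLaw z)).const_sub 1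

/-- The tail of the series for `expectedReward` is at most the probability that player `i` takes long
to sample all states, which is continuous in the policies. -/
lemma abs_expectedReward_sub_le (hG : ∀ i, UniformlyErgodic (P i) τ)
    {κ : ∀ i, S i → ℝ} (hκ0 : ∀ i x, 0 ≤ κ i x) (hκ : ∀ i, ∑ x, κ i x = 1)
    {r : JointStep S A → ℝ} (hr0 : ∀ z, 0 ≤ r z) (hr1 : ∀ z, r z ≤ 1) (i : ι) (u : S i × A i)
    (N : ℕ) : |∑' t, rewardAt P π d r i u κ t - ∑ t ∈ Finset.range N, rewardAt P π d r i u κ t| ≤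
      1 - coverProb (chains P π i) d (κ i) N := by
  have hK : ∀ i, IsContractingChain (chains P π i) (Real.exp (-1 / τ)) :=
    fun i => (hG i).isContractingChain (π i)
  have hs := summable_rewardAt (d := d) hK hκ0 hκ hr0 hr1 i u
  rw [abs_of_nonneg (sub_nonneg.2 (hs.sum_le_tsum _ fun t _ =>
    rewardAt_nonneg hK hκ0 hκ hr0 i u t))]
  refine le_of_tendsto (hs.hasSum.tendsto_sum_nat.sub_const _) ?_
  filter_upwards [eventually_ge_atTop N] with M hM
  have h1 := Finset.sum_range_add_sum_Ico (fun t => rewardAt P π d r i u κ t) hM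
  have h2 := Finset.sum_range_add_sum_Ico
    (fun t => firstVisitProb (chains P π i) d (κ i) u.1 t) hM
  have h3 : ∑ t ∈ Finset.Ico N M, rewardAt P π d r i u κ t ≤
      ∑ t ∈ Finset.Ico N M, firstVisitProb (chains P π i) d (κ i) u.1 t :=
    Finset.sum_le_sum fun t _ => rewardAt_le hK hκ0 hκ hr1 i u t
  have h4 := sum_firstVisitProb_le (d := d) (hK i).nonneg (hK i).row_sum (hκ0 i) (hκ i) u.1 M
  have h5 := coverProb_le_sum_firstVisitProb (d := d) (hK i).nonneg (hK i).row_sum (hκ0 i) (hκ i)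
    u.1 N
  linarith

lemma tendsto_expectedReward (hG : ∀ i, UniformlyErgodic (P i) τ) (hπ : Tendsto πs atTop (𝓝 π))
    {r : JointStep S A → ℝ} (hr0 : ∀ z, 0 ≤ r z) (hr1 : ∀ z, r z ≤ 1) (i : ι) (u : S i × A i)
    (z : JointStep S A) : Tendsto (fun k => expectedReward P (πs k) d r i u z) atTop
      (𝓝 (expectedReward P π d r i u z)) := by
  refine tendsto_tsum_of_tail (fun t => ?_)
    (fun k N => abs_expectedReward_sub_le hG (nextLaw_nonneg z) (sum_nextLaw z) hr0 hr1 i u N)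
    (fun N => abs_expectedReward_sub_le hG (nextLaw_nonneg z) (sum_nextLaw z) hr0 hr1 i u N)
    (fun N => ?_) ?_
  · refine Tendsto.mul ?_ ?_
    · simp only [firstVisitProb]
      split_ifs
      · exact tendsto_finsetSum _ fun V _ => tendsto_arrivalLaw hπ i _ _ _ _
      · exact tendsto_const_nhds
    · refine tendsto_finsetSum _ fun z' _ => Tendsto.const_mul _ ?_
      simp only [prod_update_apply, pairLaw, ← sum_arrivalLaw (d := d)]
      refine Tendsto.const_mul _ (tendsto_finsetProd _ fun j _ => ?_)
      exact (tendsto_finsetSum _ fun V _ => tendsto_arrivalLaw hπ j _ _ _ _).mul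
        (tendsto_policy_apply hπ j _ _)
  · exact (tendsto_coverProb_policy hπ i _ _).const_sub 1
  · have hK : IsContractingChain (chains P π i) (Real.exp (-1 / τ)) :=
      (hG i).isContractingChain (π i)
    have := (tendsto_coverProb (d := d) hK.row_sum (hG i (π i)).1 (nextLaw_nonneg (P := P) z i)
      (sum_nextLaw z i)).const_sub 1
    simpa using this

/-- A sequence of functions on a finite type that converges pointwise does so along every
sequence of arguments. -/
lemma tendsto_sub_comp_of_finite {E : Type*} [Finite E] {f : ℕ → E → ℝ} {g : E → ℝ}
    (h : ∀ z, Tendsto (fun k => f k z) atTop (𝓝 (g z))) (Z : ℕ → E) :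
    Tendsto (fun k => f k (Z k) - g (Z k)) atTop (𝓝 0) := by
  have := Fintype.ofFinite E
  have h1 : Tendsto (fun k => ∑ z, |f k z - g z|) atTop (𝓝 0) := by
    have := tendsto_finsetSum (Finset.univ : Finset E) fun z _ => ((h z).sub_const (g z)).abs
    simpa using this
  exact squeeze_zero_norm (fun k => Finset.single_le_sum (f := fun z => |f k z - g z|)
    (fun z _ => abs_nonneg _) (Finset.mem_univ (Z k))) h1

end Continuity

/-! ### The limit of the averaged reward vectors -/

section Limit

open Matrix

variable {ι : Type*} [Fintype ι] [DecidableEq ι] {S A : ι → Type*}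
  [∀ i, Fintype (S i)] [∀ i, DecidableEq (S i)] [∀ i, Nonempty (S i)]
  [∀ i, Fintype (A i)] [∀ i, DecidableEq (A i)] [∀ i, Nonempty (A i)]
  {G : StochasticGame S A} {s₀ : ∀ i, S i} {I : AlgInput S A} {ω : ℕ → JointStep S A}
  {k : ℕ} {τ : ℝ} [Nonempty ι]

/-- The conditioning on the history before a batch is that on the play before it. -/
lemma startHistory_cell (hd : 1 ≤ I.d) {n : ℕ} (h : IsStart G I ω k (n + 1)) :
    startHistory G I k ⁻¹' {startHistory G I k ω} = playsAgreeing ω (n + 1) := by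
  ext ω'
  exact startHistory_eq_iff hd h

lemma IsStart.policy_eq (hd : 1 ≤ I.d) {n : ℕ} (h : IsStart G I ω k n) :
    (algState G I ω n).policy = fun i => inducedPolicy (iterate G I ω k i) := by
  ext i : 1
  rw [AlgState.policy, h.iterate_eq hd]

lemma exists_isStart_succ (h : startTime G I k ω ≠ 0) : ∃ n, IsStart G I ω k (n + 1) :=
  ⟨startTime G I k ω - 1, by
    rw [Nat.sub_add_cancel (Nat.one_le_iff_ne_zero.2 h)]
    exact isStart_startTime h⟩

lemma ae_startTime_ne_zero (hd : 1 ≤ I.d) (hG : ∀ i, UniformlyErgodic (G.P i) τ) (k : ℕ) :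
    ∀ᵐ ω ∂(algLaw G s₀ I), startTime G I k ω ≠ 0 := by
  induction k with
  | zero =>
    refine Eventually.of_forall fun ω => ?_
    have h1 : IsStart G I ω 0 1 := by rw [IsStart, algState_one hd]; exact ⟨rfl, rfl⟩
    rw [h1.startTime_eq]
    exact one_ne_zero
  | succ k ih =>
    have h : ∀ c, ∀ᵐ ω ∂(algLaw G s₀ I), startHistory G I k ω = c → startTime G I k ω ≠ 0 →
        startTime G I (k + 1) ω ≠ 0 := by
      intro c
      by_cases hc : ∃ ω₀, startHistory G I k ω₀ = c ∧ startTime G I k ω₀ ≠ 0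
      · obtain ⟨ω₀, rfl, h1⟩ := hc
        obtain ⟨n, hn⟩ := exists_isStart_succ h1
        have h2 := real_never_ends (s₀ := s₀) hd hn (fun i => (hG i).isContractingChain _)
          fun i => (hG i _).1
        rw [measureReal_eq_zero_iff] at h2
        filter_upwards [measure_eq_zero_iff_ae_notMem.1 h2] with ω hω h3 _ h4
        refine hω ⟨?_, h4⟩
        rw [← startHistory_cell hd hn]
        exact h3
      · exact Eventually.of_forall fun ω h1 h2 => absurd ⟨ω, h1, h2⟩ hc
    filter_upwards [ih, ae_all_iff.2 h] with ω h1 h2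
    exact h2 _ rfl h1

open Classical in
/-- The conditional law of the last joint step of a batch. -/
lemma cellMean_lastStep (hd : 1 ≤ I.d) (hG : ∀ i, UniformlyErgodic (G.P i) τ)
    (h : startTime G I k ω ≠ 0)
    (hpos : 0 < (algLaw G s₀ I).real (startHistory G I k ⁻¹' {startHistory G I k ω}))
    (z : JointStep S A) :
    cellMean (algLaw G s₀ I) (startHistory G I k)
      (fun ω' => if lastStep G I (k + 1) ω' = z then 1 else 0) ω =
      batchKernel G.P (fun i => inducedPolicy (iterate G I ω k i)) I.d (lastStep G I k ω) z := by
  obtain ⟨n, hn⟩ := exists_isStart_succ h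
  rw [cellMean, startHistory_cell hd hn, hn.lastStep_eq, ← hn.policy_eq hd]
  rw [startHistory_cell hd hn] at hpos
  have h5 : (fun ω' : ℕ → JointStep S A => if lastStep G I (k + 1) ω' = z then (1 : ℝ) else 0) =
      Set.indicator {ω' | lastStep G I (k + 1) ω' = z} fun _ => 1 := by
    ext ω'; simp [Set.indicator_apply]
  have hm : MeasurableSet {ω' : ℕ → JointStep S A | lastStep G I (k + 1) ω' = z} := by
    have h1 : Measurable fun ω' : ℕ → JointStep S A =>
        if lastStep G I (k + 1) ω' = z then (1 : ℝ) else 0 :=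
      measurable_of_cells (measurableSet_startHistory (k + 1)) fun ω ω' h => by
        rw [lastStep_congr h]
    rw [h5] at h1
    exact (measurable_indicator_const_iff (1 : ℝ)).1 h1
  rw [h5, setIntegral_indicator hm, setIntegral_const, smul_eq_mul, mul_one,
    real_lastStep hd hn (fun i => (hG i).isContractingChain _) (fun i => (hG i _).1) z,
    mul_div_cancel_left₀ _ hpos.ne']

/-- The conditional mean of the reward vector of a batch. -/
lemma cellMean_batchReward (hd : 1 ≤ I.d) (hG : ∀ i, UniformlyErgodic (G.P i) τ)
    (hδ : ∀ i, 0 < I.δ i) (hρ : ∀ i, I.ρ₀ i ∈ shrunkPolytope (G.P i) (I.δ i))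
    (hmax : ∀ i y, ∃ ρ ∈ shrunkPolytope (G.P i) (I.δ i),
      IsMaxOn (dualObjective (I.h i) y) (shrunkPolytope (G.P i) (I.δ i)) ρ)
    (h : startTime G I k ω ≠ 0)
    (hpos : 0 < (algLaw G s₀ I).real (startHistory G I k ⁻¹' {startHistory G I k ω}))
    (i : ι) (u : S i × A i) :
    cellMean (algLaw G s₀ I) (startHistory G I k) (fun ω' => batchReward G I k ω' i u) ω =
      expectedReward G.P (fun i => inducedPolicy (iterate G I ω k i)) I.d
        (fun z => G.r i z.1 z.2) i u (lastStep G I k ω) := by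
  obtain ⟨n, hn⟩ := exists_isStart_succ h
  rw [cellMean, startHistory_cell hd hn, hn.lastStep_eq, ← hn.policy_eq hd]
  rw [startHistory_cell hd hn] at hpos
  rw [setIntegral_batchReward hd hn hδ hρ hmax (fun i => (hG i).isContractingChain _)
    (fun i => (hG i _).1) i u, mul_div_cancel_left₀ _ hpos.ne']

lemma isClosed_shrunkPolytope {X Y : Type*} [Fintype X] [DecidableEq X] [Fintype Y]
    (p : TransitionModel X Y) (δ : ℝ) : IsClosed (shrunkPolytope p δ) := by
  simp only [shrunkPolytope, occupationPolytope, Set.ofPred_and, Set.ofPred_forall]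
  refine IsClosed.inter (IsClosed.inter ?_ (IsClosed.inter ?_ ?_)) ?_
  · exact isClosed_iInter fun z => isClosed_le continuous_const (continuous_apply z)
  · exact isClosed_iInter fun s' => isClosed_eq (by fun_prop) continuous_const
  · exact isClosed_eq (by fun_prop) continuous_const
  · exact isClosed_iInter fun z => isClosed_le continuous_const (continuous_apply z)

lemma tendsto_inducedPolicy {X Y : Type*} [Fintype X] [DecidableEq X] [Fintype Y] [Nonempty Y]
    {p : TransitionModel X Y} {δ : ℝ} (hδ : 0 < δ) {ρs : ℕ → X × Y → ℝ} {ρ : X × Y → ℝ}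
    (hρs : ∀ k, ρs k ∈ shrunkPolytope p δ) (h : Tendsto ρs atTop (𝓝 ρ)) :
    Tendsto (fun k => inducedPolicy (ρs k)) atTop (𝓝 (inducedPolicy ρ)) := by
  have hρ : ρ ∈ shrunkPolytope p δ :=
    (isClosed_shrunkPolytope p δ).mem_of_tendsto h (Eventually.of_forall hρs)
  refine tendsto_pi_nhds.2 fun s => tendsto_subtype_rng.2 (tendsto_pi_nhds.2 fun a => ?_)
  have h1 := fun z => tendsto_pi_nhds.1 h z
  have h2 : ∀ {ρ : X × Y → ℝ}, ρ ∈ shrunkPolytope p δ →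
      ((inducedPolicy ρ s : stdSimplex ℝ Y) : Y → ℝ) a = ρ (s, a) / ∑ a', ρ (s, a') := fun hρ =>
    inducedPolicy_apply hρ.1.1 (sum_pos_of_mem_shrunk hδ hρ s) a
  have h3 : Tendsto (fun k => ρs k (s, a) / ∑ a', ρs k (s, a')) atTop
      (𝓝 (ρ (s, a) / ∑ a', ρ (s, a'))) :=
    (h1 (s, a)).div (tendsto_finsetSum _ fun a' _ => h1 (s, a'))
    (sum_pos_of_mem_shrunk hδ hρ s).ne'
  rw [← h2 hρ] at h3
  exact h3.congr fun k => (h2 (hρs k)).symm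

/-- The state marginal of an occupation measure is stationary under the induced policy. -/
lemma vecMul_inducedChain_of_mem {X Y : Type*} [Fintype X] [DecidableEq X] [Fintype Y] [Nonempty Y]
    {p : TransitionModel X Y} {δ : ℝ} (hδ : 0 < δ) {ρ : X × Y → ℝ}
    (hρ : ρ ∈ shrunkPolytope p δ) :
    (∀ v : X × Y, (∑ a, ρ (v.1, a)) * inducedPolicy ρ v.1 v.2 = ρ v) ∧
    (fun x => ∑ a, ρ (x, a)) ᵥ* inducedChain p (inducedPolicy ρ) = fun x => ∑ a, ρ (x, a) := by
  have h1 : ∀ v : X × Y, (∑ a, ρ (v.1, a)) * inducedPolicy ρ v.1 v.2 = ρ v := fun v => by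
    have h := sum_pos_of_mem_shrunk hδ hρ v.1
    rw [inducedPolicy_apply hρ.1.1 h, mul_div_cancel₀ _ h.ne']
  refine ⟨h1, ?_⟩
  ext s'
  have h2 := hρ.1.2.1 s'
  simp only [sub_mul, Finset.sum_sub_distrib, Fintype.sum_prod_type] at h2
  rw [sub_eq_zero] at h2
  have h3 : ∑ x, ∑ a, (if x = s' then (1 : ℝ) else 0) * ρ (x, a) = ∑ a, ρ (s', a) := by
    simp
  rw [h3] at h2
  rw [← h2, Matrix.vecMul, dotProduct]
  refine Finset.sum_congr rfl fun x _ => ?_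
  rw [inducedChain_apply, Finset.mul_sum]
  refine Finset.sum_congr rfl fun a _ => ?_
  rw [← h1 (x, a)]
  ring

lemma iterate_mem (hρ : ∀ i, I.ρ₀ i ∈ shrunkPolytope (G.P i) (I.δ i))
    (hmax : ∀ i y, ∃ ρ ∈ shrunkPolytope (G.P i) (I.δ i),
      IsMaxOn (dualObjective (I.h i) y) (shrunkPolytope (G.P i) (I.δ i)) ρ) (k : ℕ) (i : ι) :
    iterate G I ω k i ∈ shrunkPolytope (G.P i) (I.δ i) :=
  algState_mem hρ hmax _ i

/-- Almost surely, if the occupation measures converge, then the averaged reward vectors are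
eventually close to the gradient of the payoff at the limit. -/
theorem ae_eventually_wAvg_batchReward_close (hd : 1 ≤ I.d) (hτ : 0 < τ)
    (hG : ∀ i, UniformlyErgodic (G.P i) τ)
    (hδ : ∀ i, 0 < I.δ i) (hρ : ∀ i, I.ρ₀ i ∈ shrunkPolytope (G.P i) (I.δ i))
    (hmax : ∀ i y, ∃ ρ ∈ shrunkPolytope (G.P i) (I.δ i),
      IsMaxOn (dualObjective (I.h i) y) (shrunkPolytope (G.P i) (I.δ i)) ρ)
    (hη : ∀ i k, 0 < I.η i k) (hdiv : ∀ i, ¬ Summable (I.η i))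
    (hsq : ∀ i, Summable fun k => (I.η i k / ∑ l ∈ Finset.range (k + 1), I.η i l) ^ 2) :
    ∀ᵐ ω ∂(algLaw G s₀ I), ∀ ρstar : ∀ i, S i × A i → ℝ,
      Tendsto (iterate G I ω) atTop (𝓝 ρstar) → ∀ i (u : S i × A i) (β : ℝ),
        2 * Real.exp (-1 / τ) ^ I.d / (1 - Real.exp (-1 / τ) ^ I.d) < β →
        ∀ᶠ n in atTop, |wAvg (I.η i) (fun k => batchReward G I k ω i u) n -
          avgValue (fun z => G.r i z.1 z.2) (Function.update ρstar i (Pi.single u 1))| ≤ β := by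
  classical
  set Q := algLaw G s₀ I with hQ
  have hc0 := (Real.exp_pos (-1 / τ)).le
  have hc1 : Real.exp (-1 / τ) < 1 := Real.exp_lt_one_iff.2 (div_neg_of_neg_of_pos (by norm_num) hτ)
  have hq : Real.exp (-1 / τ) ^ I.d < 1 := pow_lt_one₀ hc0 hc1 (by omega)
  -- the law of large numbers for the last joint steps and for the reward vectors
  have h1 : ∀ i z l, ∀ᵐ ω ∂Q, Tendsto (wAvg (I.η i) fun k =>
      (if lastStep G I (k - l + 1) ω = z then (1 : ℝ) else 0) -
        cellMean Q (startHistory G I (k - l)) (fun ω => if lastStep G I (k - l + 1) ω = z then (1 : ℝ) else 0) ω) atTop (𝓝 0) := by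
    intro i z l
    refine ae_tendsto_wAvg_sub_cellMean (P := Q) (H := startHistory G I)
      measurableSet_startHistory (fun k _ _ => startHistory_refines k)
      (X := fun k ω => if lastStep G I (k + 1) ω = z then (1 : ℝ) else 0) (b := 1) ?_ ?_
      (hη i) (hdiv i) (hsq i) l
    · intro k ω
      split_ifs <;> simp
    · intro k ω ω' h
      rw [lastStep_congr h]
  have h2 : ∀ i u, ∀ᵐ ω ∂Q, Tendsto (wAvg (I.η i) fun k =>
      batchReward G I (k - 0) ω i u - cellMean Q (startHistory G I (k - 0))
        (fun ω => batchReward G I (k - 0) ω i u) ω) atTop (𝓝 0) := by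
    intro i u
    refine ae_tendsto_wAvg_sub_cellMean (P := Q) (H := startHistory G I)
      measurableSet_startHistory (fun k _ _ => startHistory_refines k)
      (X := fun k ω => batchReward G I k ω i u) (b := 1 / I.δ i) ?_ ?_
      (hη i) (hdiv i) (hsq i) 0
    · intro k ω
      have h := batchReward_mem (ω := ω) hδ hρ hmax k i u
      rw [abs_of_nonneg h.1]
      exact h.2
    · intro k ω ω' h
      rw [batchReward_congr h]
  have h3 : ∀ k, ∀ᵐ ω ∂Q, 0 < Q.real (startHistory G I k ⁻¹' {startHistory G I k ω}) :=
    fun k => ae_cell_pos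
  filter_upwards [ae_all_iff.2 (ae_startTime_ne_zero (s₀ := s₀) hd hG), ae_all_iff.2 h3,
    ae_all_iff.2 fun i => ae_all_iff.2 fun z => ae_all_iff.2 (h1 i z),
    ae_all_iff.2 fun i => ae_all_iff.2 (h2 i)] with ω hω0 hω3 hω1 hω2 ρstar hlim i u β hβ
  set πstar : ∀ i, StationaryPolicy (S i) (A i) := fun i => inducedPolicy (ρstar i) with hπstar
  have hmem : ∀ i, ρstar i ∈ shrunkPolytope (G.P i) (I.δ i) := fun i =>
    (isClosed_shrunkPolytope _ _).mem_of_tendsto (tendsto_pi_nhds.1 hlim i)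
      (Eventually.of_forall fun k => iterate_mem hρ hmax k i)
  have hπ : Tendsto (fun k i => inducedPolicy (iterate G I ω k i)) atTop (𝓝 πstar) :=
    tendsto_pi_nhds.2 fun i => tendsto_inducedPolicy (hδ i) (fun k => iterate_mem hρ hmax k i)
      (tendsto_pi_nhds.1 hlim i)
  have hr0 : ∀ z : JointStep S A, 0 ≤ G.r i z.1 z.2 := fun z => (G.r_mem i z.1 z.2).1
  have hr1 : ∀ z : JointStep S A, G.r i z.1 z.2 ≤ 1 := fun z => (G.r_mem i z.1 z.2).2
  have hprod : (fun j (v : S j × A j) => (∑ a, ρstar j (v.1, a)) * πstar j v.1 v.2) = ρstar := by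
    ext j v
    exact (vecMul_inducedChain_of_mem (hδ j) (hmem j)).1 v
  obtain ⟨γ, hγ, hγβ⟩ : ∃ γ > 0,
      2 * Real.exp (-1 / τ) ^ I.d / (1 - Real.exp (-1 / τ) ^ I.d) + γ < β :=
    ⟨(β - 2 * Real.exp (-1 / τ) ^ I.d / (1 - Real.exp (-1 / τ) ^ I.d)) / 2, by linarith,
      by linarith⟩
  obtain ⟨m, hm⟩ := exists_iterate_expectedReward_close (P := G.P) (π := πstar) (d := I.d)
    (fun i => (hG i).isContractingChain _) hc0 hc1.le hq (fun i => (hG i _).1)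
    (μ := fun j x => ∑ a, ρstar j (x, a))
    (fun j x => Finset.sum_nonneg fun a _ => (hmem j).1.1 _)
    (fun j => by rw [← Fintype.sum_prod_type (f := ρstar j)]; exact (hmem j).1.2.2)
    (fun j => (vecMul_inducedChain_of_mem (hδ j) (hmem j)).2) hr0 hr1 i u hγ
  rw [hprod] at hm
  obtain ⟨β₁, hβ₁, hβ₁'⟩ := exists_between hγβ
  have h5 := eventually_abs_wAvg_sub_le_of_iterate (hη i) (hdiv i)
    (Z := fun k => lastStep G I k ω)
    (e := fun k z => cellMean Q (startHistory G I k)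
      (fun ω => if lastStep G I (k + 1) ω = z then (1 : ℝ) else 0) ω)
    (B := batchKernel G.P πstar I.d) (fun l z => hω1 i z l) (fun z => by
      rw [funext fun k => congrArg (· - batchKernel G.P πstar I.d (lastStep G I k ω) z)
        (cellMean_lastStep hd hG (hω0 k) (hω3 k) z)]
      exact tendsto_sub_comp_of_finite (fun z' => tendsto_batchKernel hG hπ z' z) _) hm hβ₁
  have h6 : Tendsto (wAvg (I.η i) fun k => batchReward G I k ω i u -
      expectedReward G.P πstar I.d (fun z => G.r i z.1 z.2) i u (lastStep G I k ω)) atTop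
      (𝓝 0) := by
    have h7 := tendsto_wAvg_zero (hη i) (hdiv i) (tendsto_sub_comp_of_finite
      (fun z' => tendsto_expectedReward (d := I.d) hG hπ hr0 hr1 i u z')
      fun k => lastStep G I k ω)
    have h8 := (hω2 i u).add h7
    simp only [Nat.sub_zero, ← wAvg_add, add_zero] at h8
    refine h8.congr fun n => ?_
    congr 1
    ext k
    rw [hQ, cellMean_batchReward hd hG hδ hρ hmax (hω0 k) (hω3 k), sub_add_sub_cancel]
  have h9 := h6.abs
  rw [abs_zero] at h9
  filter_upwards [h5, h9.eventually (ge_mem_nhds (sub_pos.2 hβ₁'))] with n hn1 hn2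
  rw [wAvg_sub] at hn2
  refine (abs_sub_le _ _ _).trans ((add_le_add hn2 hn1).trans (le_of_eq (by ring)))

end Limit

/-! ### From dual averaging to the equilibrium -/

section DualAveraging

variable {X Y : Type*} [Fintype X] [DecidableEq X] [Fintype Y]

/-- If the averaged dual scores are eventually within `β` of `v`, then a limit of dual averaging
is optimal for `v` up to `2 * β`. -/
lemma sum_sub_mul_le_of_dualArgmax {p : TransitionModel X Y} {δ : ℝ}
    {h : (X × Y → ℝ) → ℝ} {η : ℕ → ℝ} {R : ℕ → X × Y → ℝ} {ρs : ℕ → X × Y → ℝ}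
    {ρstar ρ v : X × Y → ℝ} {β : ℝ}
    (hmax : ∀ y, ∃ ρ ∈ shrunkPolytope p δ,
      IsMaxOn (dualObjective h y) (shrunkPolytope p δ) ρ)
    (hη : ∀ k, 0 < η k) (hdiv : ¬ Summable η)
    (hρs : ∀ k, ρs (k + 1) =
      dualArgmax (shrunkPolytope p δ) h (∑ l ∈ Finset.range (k + 1), η l • R l))
    (hlim : Tendsto ρs atTop (𝓝 ρstar))
    (hv : ∀ u, ∀ᶠ n in atTop, |wAvg η (fun k => R k u) n - v u| ≤ β)
    (hρ : ρ ∈ shrunkPolytope p δ) : ∑ u, (ρ u - ρstar u) * v u ≤ 2 * β := by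
  obtain ⟨ρm, -, hρm⟩ := hmax 0
  have hW := (tendsto_sum_weights hη hdiv).comp (tendsto_add_atTop_nat 1)
  have h1 : Tendsto (fun k => ∑ u, (ρ u - ρs (k + 1) u) * v u) atTop
      (𝓝 (∑ u, (ρ u - ρstar u) * v u)) :=
    tendsto_finsetSum _ fun u _ => (((tendsto_pi_nhds.1 hlim u).comp
      (tendsto_add_atTop_nat 1)).const_sub _).mul_const _
  have h2 : Tendsto (fun k => 2 * β + (h ρ - h ρm) / ∑ l ∈ Finset.range (k + 1), η l) atTop
      (𝓝 (2 * β)) := by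
    simpa using (hW.const_div_atTop (h ρ - h ρm)).const_add (2 * β)
  refine le_of_tendsto_of_tendsto h1 h2 ?_
  filter_upwards [(tendsto_add_atTop_nat 1).eventually (eventually_all.2 hv)] with k hk
  set W := ∑ l ∈ Finset.range (k + 1), η l with hWdef
  have hpos : 0 < W := Finset.sum_pos (fun k _ => hη k) (by simp)
  set Yk : X × Y → ℝ := ∑ l ∈ Finset.range (k + 1), η l • R l with hY
  obtain ⟨h3, h4⟩ := dualArgmax_mem (hmax Yk)
  rw [← hρs k] at h3 h4
  set ρ' := ρs (k + 1) with hρ'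
  have h5 : ∑ z, ρ z * Yk z - h ρ ≤ ∑ z, ρ' z * Yk z - h ρ' := h4 hρ
  -- `ρm` maximizes the objective for the score `0`, that is, it minimizes `h`
  have h6 : h ρm ≤ h ρ' := by
    have : ∑ z, ρ' z * (0 : X × Y → ℝ) z - h ρ' ≤ ∑ z, ρm z * (0 : X × Y → ℝ) z - h ρm :=
      hρm h3
    simpa using this
  have h7 : ∀ z, Yk z = W * wAvg η (fun k => R k z) (k + 1) := fun z => by
    rw [wAvg, mul_div_cancel₀ _ hpos.ne', hY]
    simp [Finset.sum_apply]
  have h8 : ∑ z, (ρ z - ρ' z) * wAvg η (fun k => R k z) (k + 1) ≤ (h ρ - h ρm) / W := by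
    rw [le_div_iff₀ hpos, Finset.sum_mul]
    calc ∑ z, (ρ z - ρ' z) * wAvg η (fun k => R k z) (k + 1) * W
        = ∑ z, ρ z * Yk z - ∑ z, ρ' z * Yk z := by
          rw [← Finset.sum_sub_distrib]
          exact Finset.sum_congr rfl fun z _ => by rw [h7]; ring
      _ ≤ _ := by linarith
  have h9 : ∀ z, (ρ z - ρ' z) * (v z - wAvg η (fun k => R k z) (k + 1)) ≤ (ρ z + ρ' z) * β := by
    intro z
    have ha := abs_le.1 (hk z)
    have hb := hρ.1.1 z
    have hc := h3.1.1 z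
    nlinarith
  have h10 := Finset.sum_le_sum fun z (_ : z ∈ Finset.univ) => h9 z
  rw [← Finset.sum_mul, Finset.sum_add_distrib, hρ.1.2.2, h3.1.2.2] at h10
  have h11 : ∑ u, (ρ u - ρ' u) * v u = ∑ z, (ρ z - ρ' z) * (v z - wAvg η (fun k => R k z) (k + 1))
      + ∑ z, (ρ z - ρ' z) * wAvg η (fun k => R k z) (k + 1) := by
    rw [← Finset.sum_add_distrib]
    exact Finset.sum_congr rfl fun z _ => by ring
  rw [h11]
  linarith

/-- The occupation measure of a stationary policy. -/
lemma mul_policy_mem_occupationPolytope {p : TransitionModel X Y} {π : StationaryPolicy X Y}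
    {μ : X → ℝ} (h0 : ∀ x, 0 ≤ μ x) (h1 : ∑ x, μ x = 1)
    (hμ : Matrix.vecMul μ (inducedChain p π) = μ) :
    (fun v : X × Y => μ v.1 * π v.1 v.2) ∈ occupationPolytope p := by
  refine ⟨fun v => mul_nonneg (h0 _) ((π v.1).2.1 _), fun s' => ?_, ?_⟩
  · have h2 := congrFun hμ s'
    rw [Matrix.vecMul, dotProduct] at h2
    have h3 : ∑ v : X × Y, (if v.1 = s' then (1 : ℝ) else 0) * (μ v.1 * π v.1 v.2) = μ s' := by
      have := sum_mul_policy π fun x => (if x = s' then (1 : ℝ) else 0) * μ x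
      simp only [mul_assoc] at this
      rw [this]
      simp
    simp only [sub_mul, Finset.sum_sub_distrib]
    rw [h3, sub_eq_zero]
    refine Eq.trans ?_ h2
    rw [Fintype.sum_prod_type]
    refine Finset.sum_congr rfl fun x _ => ?_
    rw [inducedChain_apply, Finset.mul_sum]
    exact Finset.sum_congr rfl fun a _ => by ring
  · rw [sum_mul_policy π μ, h1]

/-- Mixing with a point of a smaller polytope gives a point of a larger one. -/
lemma mix_mem_shrunkPolytope {p : TransitionModel X Y} {ρ ρ₀ : X × Y → ℝ} {a b δ : ℝ}
    (hρ : ρ ∈ occupationPolytope p) (hρ₀ : ρ₀ ∈ shrunkPolytope p b) (ha0 : 0 ≤ a) (ha1 : a ≤ 1)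
    (hδ : δ ≤ a * b) : (fun z => (1 - a) * ρ z + a * ρ₀ z) ∈ shrunkPolytope p δ := by
  have h1 : 0 ≤ 1 - a := by linarith
  refine ⟨⟨fun z => ?_, fun s' => ?_, ?_⟩, fun z => ?_⟩
  · exact add_nonneg (mul_nonneg h1 (hρ.1 z)) (mul_nonneg ha0 (hρ₀.1.1 z))
  · have h2 : ∀ z : X × Y, (p z.1 z.2 s' - if z.1 = s' then 1 else 0) *
        ((1 - a) * ρ z + a * ρ₀ z) =
        (1 - a) * ((p z.1 z.2 s' - if z.1 = s' then 1 else 0) * ρ z) +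
        a * ((p z.1 z.2 s' - if z.1 = s' then 1 else 0) * ρ₀ z) := fun z => by ring
    simp only [h2]
    rw [Finset.sum_add_distrib, ← Finset.mul_sum, ← Finset.mul_sum, hρ.2.1, hρ₀.1.2.1]
    ring
  · rw [Finset.sum_add_distrib, ← Finset.mul_sum, ← Finset.mul_sum, hρ.2.2, hρ₀.1.2.2]
    ring
  · have h2 := mul_nonneg h1 (hρ.1 z)
    have h3 := mul_le_mul_of_nonneg_left (hρ₀.2 z) ha0
    linarith

open Classical in
/-- A threshold `δ` for which every point of the occupation polytope can be brought into the shrunk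
polytope by mixing it, with weight `ε / 10`, with a fixed point of positive coordinates. If there is
no such point, then all shrunk polytopes are empty, and the value is irrelevant. -/
def shrinkThreshold (p : TransitionModel X Y) (ε : ℝ) : ℝ :=
  if h : ∃ b, 0 < b ∧ (shrunkPolytope p b).Nonempty then ε / 10 * h.choose else 1

lemma shrinkThreshold_pos (p : TransitionModel X Y) {ε : ℝ} (hε : 0 < ε) :
    0 < shrinkThreshold p ε := by
  rw [shrinkThreshold]
  split_ifs with h
  · exact mul_pos (by linarith) h.choose_spec.1
  · exact one_pos

lemma exists_mem_of_le_shrinkThreshold {p : TransitionModel X Y} {ε δ : ℝ} (hδ0 : 0 < δ)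
    (hne : (shrunkPolytope p δ).Nonempty) (hδ : δ ≤ shrinkThreshold p ε) :
    ∃ b, ∃ ρ₀ ∈ shrunkPolytope p b, δ ≤ ε / 10 * b := by
  have h : ∃ b, 0 < b ∧ (shrunkPolytope p b).Nonempty := ⟨δ, hδ0, hne⟩
  rw [shrinkThreshold, dif_pos h] at hδ
  obtain ⟨ρ₀, hρ₀⟩ := h.choose_spec.2
  exact ⟨_, ρ₀, hρ₀, hδ⟩

end DualAveraging

section Equilibrium

variable {ι : Type*} [Fintype ι] [DecidableEq ι] {S A : ι → Type*}
  [∀ i, Fintype (S i)] [∀ i, DecidableEq (S i)] [∀ i, Nonempty (S i)]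
  [∀ i, Fintype (A i)] [∀ i, DecidableEq (A i)] [∀ i, Nonempty (A i)]
  {G : StochasticGame S A} {s₀ : ∀ i, S i} {τ : ℝ}

lemma exp_neg_inv_lt_one (hτ : 0 < τ) : Real.exp (-1 / τ) < 1 :=
  Real.exp_lt_one_iff.2 (div_neg_of_neg_of_pos (by norm_num) hτ)

lemma exists_stationary_of_uniformlyErgodic (hτ : 0 < τ) {i : ι}
    (hG : UniformlyErgodic (G.P i) τ) (π : StationaryPolicy (S i) (A i)) :
    ∃ μ : S i → ℝ, (∀ x, 0 ≤ μ x) ∧ ∑ x, μ x = 1 ∧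
      Matrix.vecMul μ (inducedChain (G.P i) π) = μ :=
  (hG.isContractingChain π).exists_stationary (Real.exp_pos _).le (exp_neg_inv_lt_one hτ)

lemma payoff_mem (hτ : 0 < τ) (hG : ∀ i, UniformlyErgodic (G.P i) τ) (i : ι)
    (π : ∀ i, StationaryPolicy (S i) (A i)) : payoff G s₀ i π ∈ Set.Icc 0 1 := by
  choose μ h0 h1 h2 using fun j => exists_stationary_of_uniformlyErgodic hτ (hG j) (π j)
  have h3 : ∀ j (v : S j × A j), 0 ≤ μ j v.1 * π j v.1 v.2 := fun j v =>
    mul_nonneg (h0 j _) ((π j v.1).2.1 _)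
  rw [payoff_eq_avgValue G s₀ hτ hG i π h1 h2]
  exact ⟨avgValue_nonneg (fun z => (G.r_mem i z.1 z.2).1) h3,
    avgValue_le_one (fun z => (G.r_mem i z.1 z.2).2) h3 fun j => by
      rw [sum_mul_policy (π j) (μ j), h1]⟩

/-- The payoff is linear in the occupation measure of each player. If the limit of the occupation
measures of player `i` is almost optimal among those in the shrunk polytope, then it is almost a
best response. -/
lemma payoff_update_le (hτ : 0 < τ) (hG : ∀ i, UniformlyErgodic (G.P i) τ) {δ : ι → ℝ}
    (hδ : ∀ i, 0 < δ i) {ρstar : ∀ i, S i × A i → ℝ}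
    (hρ : ∀ i, ρstar i ∈ shrunkPolytope (G.P i) (δ i)) (i : ι)
    (π' : StationaryPolicy (S i) (A i)) {a b β : ℝ} (ha0 : 0 ≤ a) (ha1 : a ≤ 1)
    {ρ₀ : S i × A i → ℝ} (hρ₀ : ρ₀ ∈ shrunkPolytope (G.P i) b) (hab : δ i ≤ a * b)
    (hopt : ∀ ρ ∈ shrunkPolytope (G.P i) (δ i), ∑ u, (ρ u - ρstar i u) *
      avgValue (fun z => G.r i z.1 z.2) (Function.update ρstar i (Pi.single u 1)) ≤ β) :
    payoff G s₀ i (Function.update (fun i => inducedPolicy (ρstar i)) i π') - (β + a) ≤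
      payoff G s₀ i fun i => inducedPolicy (ρstar i) := by
  set πs : ∀ i, StationaryPolicy (S i) (A i) := fun i => inducedPolicy (ρstar i) with hπs
  set r : JointStep S A → ℝ := fun z => G.r i z.1 z.2 with hr
  obtain ⟨μ', h0', h1', h2'⟩ := exists_stationary_of_uniformlyErgodic hτ (hG i) π'
  set ρ' : S i × A i → ℝ := fun v => μ' v.1 * π' v.1 v.2 with hρ'
  set μ : ∀ j, S j → ℝ := fun j x => ∑ b, ρstar j (x, b) with hμ
  have hμ1 : ∀ j, ∑ x, μ j x = 1 := fun j => by
    rw [hμ, ← Fintype.sum_prod_type (f := ρstar j)]; exact (hρ j).1.2.2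
  have hstat := fun j => vecMul_inducedChain_of_mem (hδ j) (hρ j)
  set val : S i × A i → ℝ := fun u => avgValue r (Function.update ρstar i (Pi.single u 1)) with hval
  have hpay : payoff G s₀ i πs = ∑ u, ρstar i u * val u := by
    rw [payoff_eq_avgValue G s₀ hτ hG i πs hμ1 fun j => (hstat j).2, hval,
      ← avgValue_update_eq_sum, Function.update_eq_self]
    congr 1
    ext j v
    exact (hstat j).1 v
  have hpay' : payoff G s₀ i (Function.update πs i π') = ∑ u, ρ' u * val u := by
    rw [payoff_eq_avgValue G s₀ hτ hG i (Function.update πs i π')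
      (μ := Function.update μ i μ') ?_ ?_,
      hval, ← avgValue_update_eq_sum]
    · congr 1
      ext j v
      by_cases hj : j = i
      · subst hj
        simp only [Function.update_self, hρ']
      · simp only [Function.update_of_ne hj]
        exact (hstat j).1 v
    · intro j
      by_cases hj : j = i
      · subst hj
        rw [Function.update_self, h1']
      · rw [Function.update_of_ne hj, hμ1]
    · intro j
      by_cases hj : j = i
      · subst hj
        rw [chains, Function.update_self, Function.update_self, h2']
      · rw [chains, Function.update_of_ne hj, Function.update_of_ne hj]
        exact (hstat j).2
  have hlaw := fun u => isLaw_update_single (lam := ρstar) i u (fun j => (hρ j).1.1)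
    fun j => (hρ j).1.2.2
  have hval0 : ∀ u, 0 ≤ val u := fun u =>
    avgValue_nonneg (fun z => (G.r_mem i z.1 z.2).1) (hlaw u).1
  have hval1 : ∀ u, val u ≤ 1 := fun u =>
    avgValue_le_one (fun z => (G.r_mem i z.1 z.2).2) (hlaw u).1 (hlaw u).2
  have hocc := mul_policy_mem_occupationPolytope h0' h1' h2'
  have h3 := hopt _ (mix_mem_shrunkPolytope hocc hρ₀ ha0 ha1 hab)
  have h4 : ∑ u, ((1 - a) * ρ' u + a * ρ₀ u - ρstar i u) * val u =
      (1 - a) * ∑ u, ρ' u * val u + a * ∑ u, ρ₀ u * val u - ∑ u, ρstar i u * val u := by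
    rw [Finset.mul_sum, Finset.mul_sum, ← Finset.sum_add_distrib, ← Finset.sum_sub_distrib]
    exact Finset.sum_congr rfl fun u _ => by ring
  have h5 : 0 ≤ ∑ u, ρ₀ u * val u :=
    Finset.sum_nonneg fun u _ => mul_nonneg (hρ₀.1.1 u) (hval0 u)
  have h6 : ∑ u, ρ' u * val u ≤ 1 := by
    rw [← hocc.2.2]
    exact Finset.sum_le_sum fun u _ => mul_le_of_le_one_right (hocc.1 u) (hval1 u)
  have h7 := h4.symm.le.trans h3
  rw [hpay, hpay']
  nlinarith

/-- The contraction factor `q = exp (-d / τ)` under the assumption on `d`. -/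
lemma exp_pow_le {M d : ℕ} {ε : ℝ} (hτ : 0 < τ) (hε : 0 < ε) (hM : 0 < M)
    (hd : τ * Real.log (3 / ε * (M : ℝ)) ≤ d) :
    Real.exp (-1 / τ) ^ d ≤ ε / (3 * M) := by
  have hM' : (0 : ℝ) < M := Nat.cast_pos.2 hM
  have h1 : Real.log (3 / ε * M) ≤ d / τ := by
    rw [le_div_iff₀ hτ, mul_comm]
    exact hd
  have h2 : ε / (3 * M) = Real.exp (-Real.log (3 / ε * M)) := by
    rw [Real.exp_neg, Real.exp_log (by positivity)]
    field_simp
  rw [h2, ← Real.exp_nat_mul]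
  refine Real.exp_le_exp.2 ?_
  have : (d : ℝ) * (-1 / τ) = -(d / τ) := by ring
  rw [this]
  exact neg_le_neg h1

end Equilibrium

end

theorem mainTheorem6 {ι : Type*} [Fintype ι] [DecidableEq ι] {S A : ι → Type*}
    [∀ i, Fintype (S i)] [∀ i, DecidableEq (S i)] [∀ i, Nonempty (S i)]
    [∀ i, Fintype (A i)] [∀ i, DecidableEq (A i)] [∀ i, Nonempty (A i)] :
    -- the shrinking thresholds: player `i` computes its own from its transition model and `ε`
    ∃ δbar : ∀ i, TransitionModel (S i) (A i) → ℝ → ℝ,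
      (∀ i p ε, 0 < ε → 0 < δbar i p ε) ∧
      ∀ (G : StochasticGame S A) (s₀ : ∀ i, S i) (τ ε : ℝ), 0 < τ → 0 < ε →
        (∀ i, UniformlyErgodic (G.P i) τ) →
      ∀ I : AlgInput S A,
        τ * Real.log (3 / ε * ((Finset.univ.sup fun i =>
          Fintype.card (A i) * Fintype.card (S i) : ℕ) : ℝ)) ≤ (I.d : ℝ) →
        (∀ i, 0 < I.δ i ∧ I.δ i ≤ δbar i (G.P i) ε) →
        (∀ i, I.ρ₀ i ∈ shrunkPolytope (G.P i) (I.δ i)) →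
        (∀ i, ∃ K > 0, StrongConvexOn (shrunkPolytope (G.P i) (I.δ i)) K (I.h i)) →
        -- (with respect to any norm: only the constant `K` depends on it)
        -- the maximizer in the update exists (it is unique by strong convexity)
        (∀ i y, ∃ ρ ∈ shrunkPolytope (G.P i) (I.δ i),
          IsMaxOn (dualObjective (I.h i) y) (shrunkPolytope (G.P i) (I.δ i)) ρ) →
        (∀ i k, 0 < I.η i k) →
        (∀ i, ¬ Summable (I.η i)) →
        (∀ i, Summable fun k => (I.η i k / ∑ l ∈ Finset.range (k + 1), I.η i l) ^ 2) →
        -- a point that is the limit with positive probability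
        (∀ ρstar : ∀ i, S i × A i → ℝ,
          0 < algLaw G s₀ I {ω | Tendsto (iterate G I ω) atTop (𝓝 ρstar)} →
          IsStationaryNE G s₀ ε fun i => inducedPolicy (ρstar i)) ∧
        -- a limit that may depend on the realization
        ∀ᵐ ω ∂(algLaw G s₀ I), ∀ ρstar : ∀ i, S i × A i → ℝ,
          Tendsto (iterate G I ω) atTop (𝓝 ρstar) →
          IsStationaryNE G s₀ ε fun i => inducedPolicy (ρstar i) := by
  refine ⟨fun i p ε => shrinkThreshold p ε, fun i p ε hε => shrinkThreshold_pos p hε, ?_⟩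
  intro G s₀ τ ε hτ hε hG I hd hδ hρ _ hmax hη hdiv hsq
  suffices hae : ∀ᵐ ω ∂(algLaw G s₀ I), ∀ ρstar : ∀ i, S i × A i → ℝ,
      Tendsto (iterate G I ω) atTop (𝓝 ρstar) →
      IsStationaryNE G s₀ ε fun i => inducedPolicy (ρstar i) by
    refine ⟨fun ρstar hpos => ?_, hae⟩
    by_contra hne
    refine hpos.ne' (measure_eq_zero_iff_ae_notMem.2 ?_)
    filter_upwards [hae] with ω hω h1
    exact hne (hω ρstar h1)
  rcases le_or_gt 1 ε with hε1 | hε1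
  · -- payoffs lie in `[0, 1]`
    refine Eventually.of_forall fun ω ρstar _ i π' => ?_
    have h1 := (payoff_mem (s₀ := s₀) hτ hG i
      (Function.update (fun i => inducedPolicy (ρstar i)) i π')).2
    have h2 := (payoff_mem (s₀ := s₀) hτ hG i fun i => inducedPolicy (ρstar i)).1
    linarith
  rcases isEmpty_or_nonempty ι with hι | hι
  · exact Eventually.of_forall fun ω ρstar _ i => isEmptyElim i
  set M := Finset.univ.sup fun i => Fintype.card (A i) * Fintype.card (S i) with hM
  have hcard : ∀ i, Fintype.card (A i) * Fintype.card (S i) ≤ M := fun i =>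
    Finset.le_sup (f := fun i => Fintype.card (A i) * Fintype.card (S i)) (Finset.mem_univ i)
  have hM0 : 0 < M := (Nat.mul_pos Fintype.card_pos Fintype.card_pos).trans_le
    (hcard (Classical.arbitrary ι))
  have hq := exp_pow_le hτ hε hM0 hd
  -- `d = 0` would mean `ε ≥ 3 M`
  have hd1 : 1 ≤ I.d := by
    by_contra h
    rw [Nat.lt_one_iff.1 (not_le.1 h), pow_zero, le_div_iff₀ (by positivity)] at hq
    have : (1 : ℝ) ≤ M := Nat.one_le_cast.2 hM0
    linarith
  filter_upwards [ae_eventually_wAvg_batchReward_close (s₀ := s₀) hd1 hτ hG (fun i => (hδ i).1) hρ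
    hmax hη hdiv hsq, ae_all_iff.2 (ae_startTime_ne_zero (s₀ := s₀) hd1 hG)] with ω h1 h2 ρstar hlim
  intro i π'
  by_cases hA : Fintype.card (A i) = 1
  · -- a player with a single action has a single policy
    have := (Fintype.card_le_one_iff_subsingleton (α := A i)).1 hA.le
    have h3 : π' = inducedPolicy (ρstar i) := by
      ext s a
      have h4 := fun π : stdSimplex ℝ (A i) => π.2.2
      simp only [Fintype.sum_subsingleton _ a] at h4
      exact (h4 (π' s)).trans (h4 (inducedPolicy (ρstar i) s)).symm
    rw [h3, Function.update_eq_self]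
    linarith
  have hM2 : 2 ≤ M := by
    have h3 : 2 ≤ Fintype.card (A i) := by
      have := Fintype.card_pos (α := A i)
      omega
    exact (Nat.mul_le_mul h3 Fintype.card_pos).trans (hcard i)
  -- `2 q / (1 - q) ≤ (2 / 5) ε` as `q ≤ ε / 6 ≤ 1 / 6`
  have hβ : 2 * Real.exp (-1 / τ) ^ I.d / (1 - Real.exp (-1 / τ) ^ I.d) < 9 / 20 * ε := by
    have h3 : ε / (3 * M) ≤ ε / 6 := by
      have : (2 : ℝ) ≤ M := Nat.ofNat_le_cast.2 hM2
      exact div_le_div_of_nonneg_left hε.le (by norm_num) (by linarith)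
    rw [div_lt_iff₀ (by linarith)]
    nlinarith
  have hmem : ∀ i, ρstar i ∈ shrunkPolytope (G.P i) (I.δ i) := fun i =>
    (isClosed_shrunkPolytope _ _).mem_of_tendsto (tendsto_pi_nhds.1 hlim i)
      (Eventually.of_forall fun k => iterate_mem hρ hmax k i)
  obtain ⟨b, ρ₀, hρ₀, hb⟩ := exists_mem_of_le_shrinkThreshold (hδ i).1 ⟨_, hρ i⟩ (hδ i).2
  have h3 := payoff_update_le (s₀ := s₀) hτ hG (fun i => (hδ i).1) hmem i π'
    (a := ε / 10) (by linarith) (by linarith) hρ₀ hb fun ρ hρ' =>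
    sum_sub_mul_le_of_dualArgmax (hmax i) (hη i) (hdiv i)
      (ρs := fun k => iterate G I ω k i) (fun k => iterate_succ_eq hd1 h2 k i)
      (tendsto_pi_nhds.1 hlim i) (fun u => h1 ρstar hlim i u _ hβ) hρ'
  -- `2 * (9 / 20) * ε + ε / 10 = ε`
  linarith
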